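/- Lemma 1. Let $m>2$ be an integer, let $0<2\alpha<1$, and write points of $\mathbb{R}^m$ as $x=(x_1,\dots,x_m)$. For $x\neq\xi$ in the half-space $x_1\ge 0$, $\xi_1\ge 0$ put $$q_1(x,\xi)=k_1\,(r^2)^{-\alpha-\frac{m-2}{2}}\,F\Big(\alpha+\tfrac{m-2}{2},\alpha;2\alpha;1-\tfrac{r_1^2}{r^2}\Big),\qquad k_1=\frac{\Gamma(\alpha)\,\Gamma\big(\alpha+\frac{m-2}{2}\big)}{4^{1-\alpha}\pi^{m/2}\,\Gamma(2\alpha)},$$ where $r^2=\sum_{i=1}^m(x_i-\xi_i)^2$, $r_1^2=(x_1+\xi_1)^2+\sum_{i=2}^m(x_i-\xi_i)^2$, and $F(a,b;c;z)$ is the Gauss hypergeometric function, continued analytically to $z<1$. Let $\Omega$ be a bounded domain contained in the half-space $\{x_1>0\}$, whose boundary consists of a relatively open part $\Gamma_1$ of the hyperplane $x_1=0$, the surface $\Gamma=\partial\Omega\cap\{x_1>0\}$, and their common edge $\gamma=\overline{\Gamma}\cap\{x_1=0\}$. Assume that $\Gamma$ is a Lyapunov surface up to its edge that approaches the hyperplane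 $x_1=0$ under a right angle. That is: $\Gamma$ has an outer unit normal $n_\xi$ at each point $\xi$; there are constants $a,\lambda>0$ such that the angle between $n_\xi$ and $n_\eta$ is at most $a|\xi-\eta|^{\lambda}$ for all $\xi,\eta\in\Gamma$; and near each point $p$ of $\Gamma\cup\gamma$, inside $x_1>0$, the domain $\Omega$ is the region on one side of the graph of a $C^1$ function over the tangent hyperplane at $p$, this tangent hyperplane being perpendicular to $\{x_1=0\}$ if $p\in\gamma$. For each $x$ with $x_1\ge 0$ that lies in $\Omega$, on $\Gamma$, or outside the closure $\overline{\Omega}$, the integral defining the double-layer potential with unit density, $$w_1^{(1)}(x)=\int_\Gamma \xi_1^{2\alpha}\,\frac{\partial q_1(\xi,x)}{\partial n_\xi}\,d_\xi\Gamma ,$$ converges absolutely, and $$w_1^{(1)}(x)=\begin{cases}-1,& x\in\Omega,\\ -\tfrac12,& x\in\Gamma,\\ 0,& x\notin\overline{\Omega}.\end{cases}$$ -/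

import Mathlib

open MeasureTheory Set Filter Topology
open scoped InnerProductSpace

noncomputable section

/-! ### The Gauss hypergeometric function on `(-∞, 1)` -/

/-- The Gauss hypergeometric function `F(a, b; c; z)` for real parameters with `0 < b < c` and real
`z < 1`, by Euler's integral, which is the analytic continuation to `z < 1` of the hypergeometric
series (the series itself only converges for `|z| < 1`; see `gaussF_eq_ordinaryHypergeometric`). -/
def gaussF (a b c z : ℝ) : ℝ :=
  Real.Gamma c / (Real.Gamma b * Real.Gamma (c - b)) *
    ∫ t in (0 : ℝ)..1, t ^ (b - 1) * (1 - t) ^ (c - b - 1) * (1 - t * z) ^ (-a)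

theorem gaussF_beta_integral {u v : ℝ} (hu : 0 < u) (hv : 0 < v) :
    IntervalIntegrable (fun t : ℝ => t ^ (u - 1) * (1 - t) ^ (v - 1)) volume 0 1 ∧
      ∫ t in (0 : ℝ)..1, t ^ (u - 1) * (1 - t) ^ (v - 1) =
        Real.Gamma u * Real.Gamma v / Real.Gamma (u + v) := by
  have key : ∀ t ∈ Ioc (0 : ℝ) 1, (t : ℂ) ^ ((u : ℂ) - 1) * (1 - (t : ℂ)) ^ ((v : ℂ) - 1) =
      ((t ^ (u - 1) * (1 - t) ^ (v - 1) : ℝ) : ℂ) := by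
    intro t ht
    have h1 : 0 ≤ 1 - t := by linarith [ht.2]
    push_cast [Complex.ofReal_cpow ht.1.le, Complex.ofReal_cpow h1]
    rfl
  have hconv := Complex.betaIntegral_convergent (u := u) (v := v) (by simpa) (by simpa)
  have hint : IntervalIntegrable (fun t : ℝ => t ^ (u - 1) * (1 - t) ^ (v - 1)) volume 0 1 := by
    rw [intervalIntegrable_iff_integrableOn_Ioc_of_le zero_le_one] at hconv ⊢
    have := (hconv.congr_fun key measurableSet_Ioc).re
    simpa [IntegrableOn] using this
  refine ⟨hint, ?_⟩
  have hb := ProbabilityTheory.beta_eq_betaIntegralReal u v hu hv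
  have hb' : Complex.betaIntegral u v =
      ((∫ t in (0 : ℝ)..1, t ^ (u - 1) * (1 - t) ^ (v - 1) : ℝ) : ℂ) := by
    rw [Complex.betaIntegral, ← intervalIntegral.integral_ofReal]
    refine intervalIntegral.integral_congr_ae (Eventually.of_forall fun t ht => ?_)
    rw [uIoc_of_le zero_le_one] at ht
    exact key t ht
  rw [hb', Complex.ofReal_re] at hb
  rw [← hb, ProbabilityTheory.beta]

theorem gaussF_binomial (a : ℝ) {z : ℝ} (hz : |z| < 1) :
    HasSum (fun n : ℕ => ((n.factorial : ℝ)⁻¹ * (ascPochhammer ℝ n).eval a) * z ^ n)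
      ((1 - z) ^ (-a)) := by
  have h := Real.one_add_rpow_hasFPowerSeriesOnBall_zero (a := -a)
  rw [binomialSeries_eq_ordinaryHypergeometricSeries (b := (1 : ℝ))
    (fun k hk => by have := k.cast_nonneg (α := ℝ); linarith)] at h
  have h2 := h.hasSum (y := -z) (by simpa [enorm_eq_nnnorm, ← NNReal.coe_lt_coe] using hz)
  have e : (1 + (0 + -z)) ^ (-a) = (1 - z) ^ (-a) := by ring_nf
  rw [e] at h2
  have e1 : (fun n : ℕ => ((n.factorial : ℝ)⁻¹ * (ascPochhammer ℝ n).eval a) * z ^ n) =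
      fun n => ((ordinaryHypergeometricSeries ℝ (- -a) 1 1).compContinuousLinearMap
        (-ContinuousLinearMap.id ℝ ℝ) n) fun _ => -z := by
    funext n
    rw [FormalMultilinearSeries.compContinuousLinearMap_apply]
    have e2 : (⇑(-ContinuousLinearMap.id ℝ ℝ) ∘ fun _ : Fin n => -z) = fun _ => z := by
      funext i; simp
    have e3 : (ascPochhammer ℝ n).eval (1 : ℝ) ≠ 0 := (ascPochhammer_pos n 1 one_pos).ne'
    rw [e2, ordinaryHypergeometricSeries_apply_eq, neg_neg, mul_inv_cancel_right₀ e3, smul_eq_mul]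
  rw [e1]
  exact h2

theorem gaussF_pochhammer {x : ℝ} (hx : 0 < x) (n : ℕ) :
    Real.Gamma (x + n) = (ascPochhammer ℝ n).eval x * Real.Gamma x := by
  induction n with
  | zero => simp
  | succ k ih =>
    have : x + k ≠ 0 := by positivity
    push_cast
    rw [← add_assoc, Real.Gamma_add_one this, ih, ascPochhammer_succ_eval]
    ring

/-- For `|z| < 1`, `gaussF` is the sum of the hypergeometric series. -/
theorem gaussF_eq_ordinaryHypergeometric (a : ℝ) {b c z : ℝ} (hb : 0 < b) (hbc : b < c)
    (hz : |z| < 1) : gaussF a b c z = ₂F₁ a b c z := by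
  have hc : 0 < c := hb.trans hbc
  have hcb : 0 < c - b := sub_pos.2 hbc
  set C : ℕ → ℝ := fun n => (n.factorial : ℝ)⁻¹ * (ascPochhammer ℝ n).eval a with hC
  set G : ℕ → ℝ → ℝ := fun n t => t ^ (b + n - 1) * (1 - t) ^ (c - b - 1) with hG
  have hbn : ∀ n : ℕ, 0 < b + n := fun n => by positivity
  have hGint : ∀ n, Integrable (G n) (volume.restrict (Ioc (0 : ℝ) 1)) := fun n => by
    have := (gaussF_beta_integral (hbn n) hcb).1
    rwa [intervalIntegrable_iff_integrableOn_Ioc_of_le zero_le_one] at this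
  have hGval : ∀ n, ∫ t in Ioc (0 : ℝ) 1, G n t =
      Real.Gamma (b + n) * Real.Gamma (c - b) / Real.Gamma (c + n) := fun n => by
    have := (gaussF_beta_integral (hbn n) hcb).2
    rw [intervalIntegral.integral_of_le zero_le_one] at this
    rw [this]; ring_nf
  have hGnn : ∀ n, ∀ t ∈ Ioc (0 : ℝ) 1, 0 ≤ G n t := fun n t ht =>
    mul_nonneg (Real.rpow_nonneg ht.1.le _) (Real.rpow_nonneg (by linarith [ht.2]) _)
  have hGle : ∀ n, ∀ t ∈ Ioc (0 : ℝ) 1, G n t ≤ G 0 t := fun n t ht => by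
    refine mul_le_mul_of_nonneg_right ?_ (Real.rpow_nonneg (by linarith [ht.2]) _)
    exact Real.rpow_le_rpow_of_exponent_ge ht.1 ht.2 (by simp)
  have hsum : Summable fun n => |C n * z ^ n| := (gaussF_binomial a hz).summable.abs
  have hmain := hasSum_integral_of_summable_integral_norm
    (μ := volume.restrict (Ioc (0 : ℝ) 1)) (F := fun n t => C n * z ^ n * G n t)
    (fun n => (hGint n).const_mul _) (by
      refine Summable.of_nonneg_of_le (fun n => integral_nonneg fun t => norm_nonneg _)
        (fun n => ?_) (hsum.mul_right (∫ t in Ioc (0 : ℝ) 1, G 0 t))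
      rw [← integral_const_mul]
      refine setIntegral_mono_on ((hGint n).const_mul _).norm ((hGint 0).const_mul _)
        measurableSet_Ioc fun t ht => ?_
      rw [norm_mul, Real.norm_eq_abs, Real.norm_eq_abs, abs_of_nonneg (hGnn n t ht)]
      exact mul_le_mul_of_nonneg_left (hGle n t ht) (abs_nonneg _))
  have hrhs : ∫ t in Ioc (0 : ℝ) 1, ∑' n, C n * z ^ n * G n t =
      ∫ t in (0 : ℝ)..1, t ^ (b - 1) * (1 - t) ^ (c - b - 1) * (1 - t * z) ^ (-a) := by
    rw [intervalIntegral.integral_of_le zero_le_one]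
    refine setIntegral_congr_fun measurableSet_Ioc fun t ht => ?_
    have htz : |t * z| < 1 := by
      rw [abs_mul, abs_of_pos ht.1]
      exact (mul_le_of_le_one_left (abs_nonneg _) ht.2).trans_lt hz
    have h1 := ((gaussF_binomial a htz).mul_left (t ^ (b - 1) * (1 - t) ^ (c - b - 1))).tsum_eq
    refine Eq.trans ?_ h1
    congr 1 with n
    have : t ^ (b + n - 1) = t ^ (b - 1) * t ^ n := by
      rw [← Real.rpow_natCast, ← Real.rpow_add ht.1]; ring_nf
    simp only [hG, hC, this, mul_pow]
    ring
  rw [hrhs] at hmain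
  have hfin := (hmain.mul_left (Real.Gamma c / (Real.Gamma b * Real.Gamma (c - b)))).tsum_eq
  rw [gaussF, ← hfin, ordinaryHypergeometric_eq_tsum]
  refine tsum_congr fun n => ?_
  rw [integral_const_mul, hGval, gaussF_pochhammer hb, gaussF_pochhammer hc, smul_eq_mul]
  have h1 := (Real.Gamma_pos_of_pos hb).ne'
  have h2 := (Real.Gamma_pos_of_pos hc).ne'
  have h3 := (Real.Gamma_pos_of_pos hcb).ne'
  have h4 := (ascPochhammer_pos n c hc).ne'
  simp only [hC]
  field_simp

/-! ### The fundamental solution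

Points of `ℝᵐ` are elements of `EuclideanSpace ℝ (Fin m)`; the distinguished coordinate `x₁` of the
singular equation is the coordinate with index `0`. -/

/-- The squared distance from `x` to the mirror image of `ξ`, `r₁² = (x₁ + ξ₁)² + ∑_{i ≥ 2} (xᵢ - ξᵢ)²`. -/
def reflDistSq {m : ℕ} [NeZero m] (x ξ : EuclideanSpace ℝ (Fin m)) : ℝ :=
  (x 0 + ξ 0) ^ 2 + ∑ i ∈ Finset.univ.erase (0 : Fin m), (x i - ξ i) ^ 2

/-- The constant `k₁` of the fundamental solution. -/
def fundConst (m : ℕ) (α : ℝ) : ℝ :=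
  Real.Gamma α * Real.Gamma (α + ((m : ℝ) - 2) / 2) /
    ((4 : ℝ) ^ (1 - α) * Real.pi ^ ((m : ℝ) / 2) * Real.Gamma (2 * α))

/-- The fundamental solution `q₁(x, ξ)` of `Δu + (2α / x₁) ∂u/∂x₁ = 0`. -/
def fundSol {m : ℕ} [NeZero m] (α : ℝ) (x ξ : EuclideanSpace ℝ (Fin m)) : ℝ :=
  fundConst m α * (‖x - ξ‖ ^ 2) ^ (-α - ((m : ℝ) - 2) / 2) *
    gaussF (α + ((m : ℝ) - 2) / 2) α (2 * α) (1 - reflDistSq x ξ / ‖x - ξ‖ ^ 2)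

/-! ### The domain and its boundary surface -/

/-- `n` is the outer unit normal to the boundary of `Ω` at `p`: every closed cone inside the open
half-space `⟪n, x - p⟫ < 0` is, near its apex `p`, contained in `Ω`, and every closed cone inside
`⟪n, x - p⟫ > 0` is, near `p`, disjoint from `Ω`. -/
def IsOuterUnitNormal {E : Type*} [NormedAddCommGroup E] [InnerProductSpace ℝ E]
    (Ω : Set E) (p n : E) : Prop :=
  ‖n‖ = 1 ∧ ∀ ε : ℝ, 0 < ε → ∀ᶠ x in 𝓝 p,
    (⟪n, x - p⟫_ℝ < -(ε * ‖x - p‖) → x ∈ Ω) ∧ (ε * ‖x - p‖ < ⟪n, x - p⟫_ℝ → x ∉ Ω)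

open Classical in
/-- The outer unit normal to the boundary of `Ω` at `p` (and `0` where there is none). -/
def outerUnitNormal {E : Type*} [NormedAddCommGroup E] [InnerProductSpace ℝ E]
    (Ω : Set E) (p : E) : E :=
  if h : ∃ n, IsOuterUnitNormal Ω p n then h.choose else 0

theorem IsOuterUnitNormal.unique {E : Type*} [NormedAddCommGroup E] [InnerProductSpace ℝ E]
    {Ω : Set E} {p n n' : E} (h : IsOuterUnitNormal Ω p n) (h' : IsOuterUnitNormal Ω p n') :
    n = n' := by
  by_contra hne
  have hlt : ⟪n, n'⟫_ℝ < 1 := (inner_lt_one_iff_real_of_norm_eq_one h.1 h'.1).2 hne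
  set v : E := n' - n with hv
  have hv0 : 0 < ‖v‖ := norm_pos_iff.2 (sub_ne_zero.2 (Ne.symm hne))
  have h1 : ⟪n, v⟫_ℝ = -(1 - ⟪n, n'⟫_ℝ) := by
    rw [hv, inner_sub_right, real_inner_self_eq_norm_sq, h.1]; ring
  have h2 : ⟪n', v⟫_ℝ = 1 - ⟪n, n'⟫_ℝ := by
    rw [hv, inner_sub_right, real_inner_self_eq_norm_sq, h'.1, real_inner_comm]; ring
  set ε : ℝ := (1 - ⟪n, n'⟫_ℝ) / (2 * ‖v‖) with hε
  have hpos : 0 < 1 - ⟪n, n'⟫_ℝ := by linarith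
  have hε0 : 0 < ε := by positivity
  have hεv : ε * ‖v‖ < 1 - ⟪n, n'⟫_ℝ := by
    have : ε * ‖v‖ = (1 - ⟪n, n'⟫_ℝ) / 2 := by rw [hε]; field_simp
    linarith
  have ht : Tendsto (fun t : ℝ => p + t • v) (𝓝[>] 0) (𝓝 p) := by
    have : Continuous fun t : ℝ => p + t • v := by fun_prop
    simpa using (this.tendsto 0).mono_left nhdsWithin_le_nhds
  obtain ⟨t, ht1, ht2, ht0⟩ := ((ht.eventually (h.2 ε hε0)).and
    ((ht.eventually (h'.2 ε hε0)).and self_mem_nhdsWithin)).exists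
  have ht0' : 0 < t := ht0
  simp only [add_sub_cancel_left, inner_smul_right, norm_smul, Real.norm_eq_abs,
    abs_of_pos ht0', h1, h2] at ht1 ht2
  exact ht2.2 (by nlinarith) (ht1.1 (by nlinarith))

theorem IsOuterUnitNormal.outerUnitNormal_eq {E : Type*} [NormedAddCommGroup E]
    [InnerProductSpace ℝ E] {Ω : Set E} {p n : E} (h : IsOuterUnitNormal Ω p n) :
    outerUnitNormal Ω p = n := by
  have hex : ∃ n, IsOuterUnitNormal Ω p n := ⟨n, h⟩
  rw [outerUnitNormal, dif_pos hex]
  exact hex.choose_spec.unique h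

/-- The part `Γ` of the boundary of `Ω` that lies in the open half-space `x₁ > 0`. -/
def lateralBoundary {m : ℕ} [NeZero m] (Ω : Set (EuclideanSpace ℝ (Fin m))) :
    Set (EuclideanSpace ℝ (Fin m)) :=
  frontier Ω ∩ {x | 0 < x 0}

/-- `Ω` is a finite (bounded) domain of the half-space `x₁ > 0`, bounded by a part of the hyperplane
`x₁ = 0` and by a Lyapunov surface `Γ` that approaches this hyperplane under a right angle.
Here `Γ` is the part of the boundary in `x₁ > 0`, the edge `γ` is the set of the points of the
closure of `Γ` with `x₁ = 0`, and the rest of the boundary of `Ω` is then automatically a relatively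
open subset of the hyperplane `x₁ = 0`. -/
structure IsLyapunovDomain {m : ℕ} [NeZero m] (Ω : Set (EuclideanSpace ℝ (Fin m))) : Prop where
  isOpen : IsOpen Ω
  isConnected : IsConnected Ω
  isBounded : Bornology.IsBounded Ω
  subset_halfSpace : Ω ⊆ {x | 0 < x 0}
  /-- There is a definite normal at every point of `Γ`. -/
  exists_normal : ∀ p ∈ lateralBoundary Ω, ∃ n, IsOuterUnitNormal Ω p n
  /-- The angle between the normals at two points of `Γ` is at most `a r ^ lam`. -/
  angle_le : ∃ a lam : ℝ, 0 < a ∧ 0 < lam ∧ ∀ x ∈ lateralBoundary Ω, ∀ y ∈ lateralBoundary Ω,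
    InnerProductGeometry.angle (outerUnitNormal Ω x) (outerUnitNormal Ω y) ≤ a * ‖x - y‖ ^ lam
  /-- `Γ` is a surface up to its edge: near every point `p` of `Γ` or `γ`, and inside `x₁ > 0`, the
  domain is the part below a continuously differentiable graph over the tangent hyperplane `n^⊥` of
  the surface at `p`. At the edge this tangent hyperplane is perpendicular to `x₁ = 0`. -/
  exists_graph : ∀ p ∈ closure (lateralBoundary Ω), ∃ n : EuclideanSpace ℝ (Fin m),
    ‖n‖ = 1 ∧ (p 0 = 0 → n 0 = 0) ∧
    ∃ d : ℝ, 0 < d ∧ ∃ f : (ℝ ∙ n)ᗮ → ℝ, ContDiff ℝ 1 f ∧ f 0 = 0 ∧ fderiv ℝ f 0 = 0 ∧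
      ∀ x ∈ Metric.ball p d, 0 < x 0 →
        (x ∈ Ω ↔ ⟪n, x - p⟫_ℝ < f ((ℝ ∙ n)ᗮ.orthogonalProjectionOnto (x - p)))

/-! ### The double-layer potential -/

/-- The integrand `ξ₁^{2α} μ(ξ) ∂q₁(ξ, x)/∂n_ξ` of the double-layer potential with density `μ`,
where `n_ξ` is the outer unit normal at `ξ`. -/
def doubleLayerIntegrand {m : ℕ} [NeZero m] (α : ℝ) (Ω : Set (EuclideanSpace ℝ (Fin m)))
    (μ : EuclideanSpace ℝ (Fin m) → ℝ) (x ξ : EuclideanSpace ℝ (Fin m)) : ℝ :=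
  (ξ 0) ^ (2 * α) * μ ξ * fderiv ℝ (fun η => fundSol α η x) ξ (outerUnitNormal Ω ξ)

/-- The double-layer potential with density `μ`. The surface measure on `Γ` is the
`(m - 1)`-dimensional Hausdorff measure, normalized to agree with Lebesgue measure on hyperplanes. -/
def doubleLayerPotential {m : ℕ} [NeZero m] (α : ℝ) (Ω : Set (EuclideanSpace ℝ (Fin m)))
    (μ : EuclideanSpace ℝ (Fin m) → ℝ) (x : EuclideanSpace ℝ (Fin m)) : ℝ :=
  ∫ ξ in lateralBoundary Ω, doubleLayerIntegrand α Ω μ x ξ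
    ∂(Measure.euclideanHausdorffMeasure (m - 1))

end

noncomputable section

/-! ### The area formula for embedded surfaces -/

/-! The field ξ₁^{2α} ∇q₁(·, x) is divergence free off its pole x and sends flux -1 through small
spheres about x. Its flux through Γ is therefore minus the fraction of a small sphere about x that
lies in Ω: all of it at an interior point, half of it at a point of Γ, where Ω has a tangent
half-space, and none outside. The flat part of the boundary contributes nothing because the weight
ξ₁^{2α} vanishes there.

Euler's integral (`fundSol_eq_integral`) writes q₁ as a superposition over t ∈ (0, 1), with weight w
= (t(1-t))^{α-1}, of powers of D_t = |ξ-x|² + 4t x₁ξ₁. Hence ∇q₁ = -`fluxConst` · K with K = ∫ w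
D_t^{-A} (½∇D_t) dt and A = α + m/2 (`fderiv_fundSol`). For a single t the field ξ₁^{2α} D_t^{-A}
(½∇D_t) is not divergence free, but w times its divergence is ξ₁^{2α} times a total derivative in t
that integrates to zero (`integral_betaWeight_mul_kernelDiv`).

The divergence theorem on Ω is obtained by straightening graphs (`setIntegral_fderiv_subgraph`),
with the area formula identifying the surface measure, and by a partition of unity
(`IsLyapunovDomain.setIntegral_fderiv`). It is proved for fields that vanish near x₁ = 0. A cut-off
at height ε provides such fields: its gradient is O(1/ε) on a slab of volume O(ε) where the weight
is O(ε^{2α}), so the error tends to zero (`IsLyapunovDomain.setIntegral_cutoff_flux`).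

A second cut-off, at radius ρ, removes the pole. As ρ → 0 the surface integrals converge to the full
flux as soon as that flux converges absolutely. At a point of Γ this is where the Lyapunov condition
enters: |⟪ξ-x, n_ξ⟫| ≤ C r^{1+λ} with r = |ξ-x| lowers the singularity r^{1-m} of K to r^{1-m+λ},
which is integrable over a surface of dimension m-1. The volume integrals are rescaled by ρ. Since
r^{m-2} ξ₁^{2α} ⟪ξ-x, K⟫ tends to a constant independent of x (`tendsto_radial_kernelField`), they
converge to that constant times the integral, over the tangent cone of Ω at x, of an even radial
weight whose total mass is the area of the unit sphere (`IsLyapunovDomain.setIntegral_flux_eq`). The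
constant k₁ normalises the product to 1 (`fluxConst_mul_solidAngle`). For x outside the closure the
cut-off is identically 1 on Ω, so the flux is zero. -/

theorem measure_le_smul_of_locally_le {X : Type*} [TopologicalSpace X] [SecondCountableTopology X]
    [MeasurableSpace X] [OpensMeasurableSpace X] {μ ν : Measure X} {c : ENNReal}
    (h : ∀ x, ∃ U ∈ 𝓝 x, ∀ A ⊆ U, MeasurableSet A → ν A ≤ c * μ A) : ν ≤ c • μ := by
  choose U hU hUA using h
  obtain ⟨s, hs, hcov⟩ := TopologicalSpace.countable_cover_nhds
    (f := fun x => interior (U x)) fun x => interior_mem_nhds.2 (hU x)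
  rcases s.eq_empty_or_nonempty with rfl | hne
  · have : IsEmpty X := univ_eq_empty_iff.1 (by simpa using hcov.symm)
    exact fun A => by simp [Set.eq_empty_of_isEmpty A]
  obtain ⟨u, rfl⟩ := hs.exists_eq_range hne
  refine Measure.le_iff.2 fun A hA => ?_
  -- Disjoint pieces, each inside one good neighbourhood, so that the local inequalities can be
  -- added up.
  set V : ℕ → Set X := fun n => interior (U (u n))
  have hVm : ∀ n, MeasurableSet (disjointed V n) :=
    MeasurableSet.disjointed fun n => isOpen_interior.measurableSet
  have hVu : ⋃ n, disjointed V n = univ := by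
    rw [iUnion_disjointed]; simpa [V] using hcov
  have hAu : A = ⋃ n, A ∩ disjointed V n := by rw [← inter_iUnion, hVu, inter_univ]
  have hdisj : Pairwise (Function.onFun Disjoint fun n => A ∩ disjointed V n) :=
    fun i j hij => (disjoint_disjointed V hij).mono inter_subset_right inter_subset_right
  calc ν A = ν (⋃ n, A ∩ disjointed V n) := by rw [← hAu]
    _ ≤ ∑' n, ν (A ∩ disjointed V n) := measure_iUnion_le _
    _ ≤ ∑' n, c * μ (A ∩ disjointed V n) := ENNReal.tsum_le_tsum fun n =>
        hUA (u n) _ (fun y hy => interior_subset (disjointed_subset V n hy.2)) (hA.inter (hVm n))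
    _ = c * μ A := by
        rw [ENNReal.tsum_mul_left, ← measure_iUnion hdisj fun n => hA.inter (hVm n), ← hAu]
    _ = (c • μ) A := by simp

section AreaFormula

variable {U V : Type*} [NormedAddCommGroup U] [InnerProductSpace ℝ U] [FiniteDimensional ℝ U]
  [MeasurableSpace U] [BorelSpace U] [NormedAddCommGroup V] [InnerProductSpace ℝ V]
  [MeasurableSpace V] [BorelSpace V]

/-- The hypothesis says that G factors over A as a k-Lipschitz map after L. Injectivity of L is not
needed: L x = L y forces G x = G y. -/
theorem euclideanHausdorffMeasure_image_le_of_dist_le {X V : Type*} [NormedAddCommGroup V]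
    [MeasurableSpace V] [BorelSpace V] {G L : X → V} {A : Set X} {k : NNReal}
    (h : ∀ x ∈ A, ∀ y ∈ A, ‖G x - G y‖ ≤ k * ‖L x - L y‖) (d : ℕ) :
    μHE[d] (G '' A) ≤ (k : ENNReal) ^ d * μHE[d] (L '' A) := by
  rcases A.eq_empty_or_nonempty with rfl | ⟨x0, hx0⟩
  · simp
  have : Nonempty X := ⟨x0⟩
  set T : V → V := G ∘ Function.invFunOn L A
  have hTL : ∀ x ∈ A, T (L x) = G x := by
    intro x hx
    have hm : L x ∈ L '' A := mem_image_of_mem _ hx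
    have h1 := Function.invFunOn_mem hm
    have h2 := Function.invFunOn_eq hm
    have h3 := h _ h1 _ hx
    rw [h2, sub_self, norm_zero, mul_zero] at h3
    exact sub_eq_zero.1 (norm_le_zero_iff.1 h3)
  have hLip : LipschitzOnWith k T (L '' A) := by
    refine LipschitzOnWith.of_dist_le_mul ?_
    rintro _ ⟨x, hx, rfl⟩ _ ⟨y, hy, rfl⟩
    rw [hTL x hx, hTL y hy, dist_eq_norm, dist_eq_norm]
    exact h x hx y hy
  have himg : T '' (L '' A) = G '' A := by
    rw [image_image]
    exact image_congr hTL
  have := hLip.hausdorffMeasure_image_le (d := d) (by positivity)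
  rw [himg, ENNReal.rpow_natCast] at this
  rw [Measure.euclideanHausdorffMeasure_def, Measure.smul_apply, Measure.smul_apply,
    ENNReal.smul_def, ENNReal.smul_def, smul_eq_mul, smul_eq_mul, mul_left_comm]
  gcongr

/-- Let k decrease to 1. Infinite b is separated because multiplication by b must be continuous in
the limit. -/
theorem ENNReal.le_of_forall_one_lt_pow_mul {a b : ENNReal} (n : ℕ)
    (h : ∀ k : NNReal, 1 < k → a ≤ (k : ENNReal) ^ n * b) : a ≤ b := by
  rcases eq_or_ne b ⊤ with rfl | hb
  · exact le_top
  have hc : Tendsto (fun k : NNReal => (k : ENNReal) ^ n * b) (𝓝[>] 1) (𝓝 (1 * b)) := by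
    refine ENNReal.Tendsto.mul_const ?_ (Or.inr hb)
    have : Continuous fun k : NNReal => ((k ^ n : NNReal) : ENNReal) := by fun_prop
    have h1 := (this.tendsto 1).mono_left (nhdsWithin_le_nhds (s := Ioi (1 : NNReal)))
    simpa using h1
  rw [one_mul] at hc
  exact ge_of_tendsto hc (eventually_nhdsWithin_of_forall fun k hk => h k hk)

/-- Area formula for an embedding whose derivative expands distances. -/
theorem comap_euclideanHausdorffMeasure {G : U → V} {L : U → U →L[ℝ] V}
    (hG : ∀ y, HasStrictFDerivAt G (L y) y) (hL : ∀ y v, ‖v‖ ≤ ‖L y v‖)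
    (hJ : Continuous fun y => (L y).toLinearMap.normDet) (hemb : MeasurableEmbedding G) :
    Measure.comap G μHE[Module.finrank ℝ U] =
      volume.withDensity fun y => ENNReal.ofReal (L y).toLinearMap.normDet := by
  set d := Module.finrank ℝ U with hd
  set J : U → ℝ := fun y => (L y).toLinearMap.normDet with hJdef
  have hJpos : ∀ y, 0 < J y := by
    intro y
    have hinj : LinearMap.ker (L y).toLinearMap = ⊥ := by
      rw [LinearMap.ker_eq_bot']
      intro v hv
      have := hL y v
      rw [show L y v = 0 from hv, norm_zero] at this
      exact norm_le_zero_iff.1 this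
    refine lt_of_le_of_ne (LinearMap.normDet_nonneg _) fun h => ?_
    exact (LinearMap.normDet_eq_zero_iff_ker_ne_bot.1 h.symm) hinj
  have hlin : ∀ y (A : Set U), μHE[d] (L y '' A) = ENNReal.ofReal (J y) * volume A := by
    intro y A
    have := LinearMap.euclideanHausdorffMeasure_image (L y).toLinearMap A
    rw [InnerProductSpace.euclideanHausdorffMeasure_eq_volume] at this
    exact this
  have hcomap : ∀ A, MeasurableSet A → Measure.comap G μHE[d] A = μHE[d] (G '' A) := fun A _ =>
    hemb.comap_apply _ _
  -- local comparison
  have hloc : ∀ k : NNReal, 1 < k → ∀ y0, ∃ W ∈ 𝓝 y0, ∀ A ⊆ W, MeasurableSet A →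
      μHE[d] (G '' A) ≤ (k : ENNReal) ^ (d + 1) *
        (volume.withDensity fun y => ENNReal.ofReal (J y)) A ∧
      (volume.withDensity fun y => ENNReal.ofReal (J y)) A ≤
        (k : ENNReal) ^ (d + 1) * μHE[d] (G '' A) := by
    intro k hk y0
    have hk' : (1 : ℝ) < k := by exact_mod_cast hk
    have hk0 : (0 : ℝ) < k := by linarith
    -- This ε satisfies both 1 + ε ≤ k and 1/(1 - ε) = k, so an ε-approximation of G by `L y0` is
    -- k-Lipschitz in both directions.
    set ε : ℝ := 1 - (k : ℝ)⁻¹ with hε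
    have hεpos : 0 < ε := by rw [hε, sub_pos]; exact inv_lt_one_of_one_lt₀ hk'
    have hε1 : 1 + ε ≤ k := by
      have h1 : (k : ℝ) * (k : ℝ)⁻¹ = 1 := mul_inv_cancel₀ hk0.ne'
      have h2 : 0 < (k : ℝ)⁻¹ := inv_pos.2 hk0
      nlinarith [sq_nonneg ((k : ℝ) - 1)]
    have hε2 : (k : ℝ) * (1 - ε) = 1 := by rw [hε]; field_simp; ring
    -- Strict differentiability controls pairs of points, hence a whole square W1 × W1. As `L y0`
    -- expands distances, the error ε‖x - y‖ is at most ε‖L y0 (x - y)‖.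
    have hst := (hasStrictFDerivAt_iff_isLittleO.1 (hG y0)).def hεpos
    rw [nhds_prod_eq] at hst
    obtain ⟨W1, hW1, hW1'⟩ := eventually_prod_self_iff'.1 hst
    have hW2 : {y | J y < k * J y0} ∈ 𝓝 y0 :=
      (isOpen_lt hJ continuous_const).mem_nhds (by
        show J y0 < k * J y0
        nlinarith [hJpos y0])
    have hW3 : {y | J y0 < k * J y} ∈ 𝓝 y0 :=
      (isOpen_lt continuous_const (continuous_const.mul hJ)).mem_nhds (by
        show J y0 < k * J y0
        nlinarith [hJpos y0])
    refine ⟨W1 ∩ ({y | J y < k * J y0} ∩ {y | J y0 < k * J y}),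
      inter_mem hW1 (inter_mem hW2 hW3), fun A hA hAm => ?_⟩
    have hup : ∀ x ∈ A, ∀ y ∈ A, ‖G x - G y‖ ≤ k * ‖L y0 x - L y0 y‖ := by
      intro x hx y hy
      have h1 := hW1' x (hA hx).1 y (hA hy).1
      have h2 := hL y0 (x - y)
      have h3 : ‖G x - G y‖ ≤ ‖G x - G y - L y0 (x - y)‖ + ‖L y0 (x - y)‖ := by
        simpa using norm_add_le (G x - G y - L y0 (x - y)) (L y0 (x - y))
      rw [← map_sub]
      simp only at h1
      nlinarith [norm_nonneg (L y0 (x - y))]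
    have hdn : ∀ x ∈ A, ∀ y ∈ A, ‖L y0 x - L y0 y‖ ≤ k * ‖G x - G y‖ := by
      intro x hx y hy
      have h1 := hW1' x (hA hx).1 y (hA hy).1
      have h2 := hL y0 (x - y)
      have h3 : ‖L y0 (x - y)‖ ≤ ‖G x - G y - L y0 (x - y)‖ + ‖G x - G y‖ := by
        have := norm_sub_le (G x - G y) (G x - G y - L y0 (x - y))
        rw [sub_sub_cancel] at this; linarith
      rw [← map_sub]
      simp only at h1
      have h4 : (1 - ε) * ‖L y0 (x - y)‖ ≤ ‖G x - G y‖ := by nlinarith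
      calc ‖L y0 (x - y)‖ = k * ((1 - ε) * ‖L y0 (x - y)‖) := by rw [← mul_assoc, hε2, one_mul]
        _ ≤ _ := by gcongr
    have hupm := euclideanHausdorffMeasure_image_le_of_dist_le hup d
    have hdnm := euclideanHausdorffMeasure_image_le_of_dist_le hdn d
    rw [hlin] at hupm hdnm
    rw [withDensity_apply _ hAm]
    -- In the exponent d + 1, the d-th power of k comes from the Lipschitz comparison and the
    -- remaining factor from freezing the density at y0.
    have hi1 : ENNReal.ofReal (J y0) * volume A ≤
        (k : ENNReal) * ∫⁻ y in A, ENNReal.ofReal (J y) := by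
      rw [← lintegral_const_mul _ (by fun_prop), ← setLIntegral_const]
      refine setLIntegral_mono' hAm fun y hy => ?_
      rw [← ENNReal.ofReal_coe_nnreal, ← ENNReal.ofReal_mul k.coe_nonneg]
      exact ENNReal.ofReal_le_ofReal (le_of_lt (hA hy).2.2)
    have hi2 : ∫⁻ y in A, ENNReal.ofReal (J y) ≤
        (k : ENNReal) * (ENNReal.ofReal (J y0) * volume A) := by
      rw [← mul_assoc, ← setLIntegral_const]
      refine setLIntegral_mono' hAm fun y hy => ?_
      rw [← ENNReal.ofReal_coe_nnreal, ← ENNReal.ofReal_mul k.coe_nonneg]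
      exact ENNReal.ofReal_le_ofReal (le_of_lt (hA hy).2.1)
    refine ⟨hupm.trans ?_, hi2.trans ?_⟩
    · rw [pow_succ, mul_assoc]; gcongr
    · rw [pow_succ', mul_assoc]; gcongr
  refine le_antisymm ?_ ?_
  · refine Measure.le_iff.2 fun A hA => ENNReal.le_of_forall_one_lt_pow_mul (d + 1) fun k hk => ?_
    have := measure_le_smul_of_locally_le (μ := volume.withDensity fun y => ENNReal.ofReal (J y))
      (ν := Measure.comap G μHE[d]) (c := (k : ENNReal) ^ (d + 1)) fun y0 => by
        obtain ⟨W, hW, hWA⟩ := hloc k hk y0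
        exact ⟨W, hW, fun A hA hAm => by rw [hcomap A hAm]; exact (hWA A hA hAm).1⟩
    simpa using this A
  · refine Measure.le_iff.2 fun A hA => ENNReal.le_of_forall_one_lt_pow_mul (d + 1) fun k hk => ?_
    have := measure_le_smul_of_locally_le (ν := volume.withDensity fun y => ENNReal.ofReal (J y))
      (μ := Measure.comap G μHE[d]) (c := (k : ENNReal) ^ (d + 1)) fun y0 => by
        obtain ⟨W, hW, hWA⟩ := hloc k hk y0
        exact ⟨W, hW, fun A hA hAm => by rw [hcomap A hAm]; exact (hWA A hA hAm).2⟩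
    simpa using this A

end AreaFormula


/-! ### Graphs over a hyperplane -/

section Graph

variable {E : Type*} [NormedAddCommGroup E] [InnerProductSpace ℝ E]

/-- Inside a cone of slope ε the linear part ⟪N, x - ξ⟫ dominates the error of the differential, so
it decides the sign of F. The error is taken as ε‖N‖ because the normal is normalised. -/
theorem IsOuterUnitNormal.of_hasFDerivAt {Ω : Set E} {F : E → ℝ} {N ξ : E} (hN : N ≠ 0)
    (hF : HasFDerivAt F (innerSL ℝ N) ξ) (h0 : F ξ = 0) (hΩ : ∀ᶠ x in 𝓝 ξ, (x ∈ Ω ↔ F x < 0)) :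
    IsOuterUnitNormal Ω ξ (‖N‖⁻¹ • N) := by
  have hNpos : 0 < ‖N‖ := norm_pos_iff.2 hN
  refine ⟨by rw [norm_smul, norm_inv, norm_norm, inv_mul_cancel₀ hNpos.ne'], fun ε hε => ?_⟩
  have hd := hF.isLittleO.def (show 0 < ε * ‖N‖ by positivity)
  filter_upwards [hd, hΩ] with x hx hxΩ
  rw [h0, sub_zero, innerSL_apply_apply, Real.norm_eq_abs, abs_le] at hx
  rw [hxΩ, inner_smul_left, conj_trivial]
  have key : ⟪N, x - ξ⟫_ℝ = ‖N‖ * (‖N‖⁻¹ * ⟪N, x - ξ⟫_ℝ) := by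
    rw [← mul_assoc, mul_inv_cancel₀ hNpos.ne', one_mul]
  constructor
  · intro h
    nlinarith [mul_lt_mul_of_pos_left h hNpos]
  · intro h h'
    nlinarith [mul_lt_mul_of_pos_left h hNpos]

set_option linter.unusedSectionVars false

variable [FiniteDimensional ℝ E]

/-- The parametrization of the graph of `f` over the hyperplane through `p` orthogonal to `n`. -/
def graphMap (p n : E) (f : (ℝ ∙ n)ᗮ → ℝ) (y : (ℝ ∙ n)ᗮ) : E := p + y + f y • n

/-- The signed height above the graph of `f`. -/
def graphHeight (p n : E) (f : (ℝ ∙ n)ᗮ → ℝ) (x : E) : ℝ :=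
  ⟪n, x - p⟫_ℝ - f ((ℝ ∙ n)ᗮ.orthogonalProjectionOnto (x - p))

/-- The upward normal `n - ∇f` of the graph of `f`. -/
def graphNormal (n : E) (f : (ℝ ∙ n)ᗮ → ℝ) (y : (ℝ ∙ n)ᗮ) : E :=
  n - ((InnerProductSpace.toDual ℝ (ℝ ∙ n)ᗮ).symm (fderiv ℝ f y) : (ℝ ∙ n)ᗮ)

variable {p n : E} {f : (ℝ ∙ n)ᗮ → ℝ}

theorem inner_orthogonal_span (y : (ℝ ∙ n)ᗮ) : ⟪n, (y : E)⟫_ℝ = 0 :=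
  Submodule.mem_orthogonal_singleton_iff_inner_right.1 y.2

theorem orthogonalProjectionOnto_add_smul (y : (ℝ ∙ n)ᗮ) (s : ℝ) :
    (ℝ ∙ n)ᗮ.orthogonalProjectionOnto ((y : E) + s • n) = y := by
  have h1 : (ℝ ∙ n)ᗮ.orthogonalProjectionOnto (s • n) = 0 := by
    rw [map_smul, Submodule.orthogonalProjectionOnto_orthogonalComplement_singleton_eq_zero,
      smul_zero]
  rw [map_add, h1, add_zero, Submodule.orthogonalProjectionOnto_mem_subspace_eq_self]

theorem inner_add_smul_unit (hn : ‖n‖ = 1) (y : (ℝ ∙ n)ᗮ) (s : ℝ) :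
    ⟪n, (y : E) + s • n⟫_ℝ = s := by
  rw [inner_add_right, inner_orthogonal_span, inner_smul_right, real_inner_self_eq_norm_sq, hn]
  ring

theorem eq_orthogonalProjectionOnto_add_smul (hn : ‖n‖ = 1) (x : E) :
    ((ℝ ∙ n)ᗮ.orthogonalProjectionOnto x : E) + ⟪n, x⟫_ℝ • n = x := by
  have h := Submodule.starProjection_add_starProjection_orthogonal (K := ℝ ∙ n) x
  rw [Submodule.starProjection_unit_singleton ℝ hn x, add_comm] at h
  exact h

theorem graphHeight_eq_zero_iff (hn : ‖n‖ = 1) (x : E) :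
    graphHeight p n f x = 0 ↔
      graphMap p n f ((ℝ ∙ n)ᗮ.orthogonalProjectionOnto (x - p)) = x := by
  have h := eq_orthogonalProjectionOnto_add_smul hn (x - p)
  constructor
  · intro h0
    rw [graphHeight, sub_eq_zero] at h0
    rw [graphMap, ← h0, add_assoc, h]; abel
  · intro h0
    have h1 := inner_add_smul_unit hn ((ℝ ∙ n)ᗮ.orthogonalProjectionOnto (x - p))
      (f ((ℝ ∙ n)ᗮ.orthogonalProjectionOnto (x - p)))
    rw [graphMap, add_assoc] at h0
    rw [← eq_sub_iff_add_eq'] at h0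
    rw [h0] at h1
    rw [graphHeight, h1, sub_self]

theorem orthogonalProjectionOnto_graphMap (y : (ℝ ∙ n)ᗮ) :
    (ℝ ∙ n)ᗮ.orthogonalProjectionOnto (graphMap p n f y - p) = y := by
  rw [graphMap, add_assoc, add_sub_cancel_left, orthogonalProjectionOnto_add_smul]

theorem graphHeight_graphMap (hn : ‖n‖ = 1) (y : (ℝ ∙ n)ᗮ) :
    graphHeight p n f (graphMap p n f y) = 0 := by
  rw [graphHeight_eq_zero_iff hn, orthogonalProjectionOnto_graphMap]

theorem continuous_graphMap (hf : ContDiff ℝ 1 f) : Continuous (graphMap p n f) := by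
  have := hf.continuous
  unfold graphMap
  fun_prop

theorem isClosedEmbedding_graphMap (hf : ContDiff ℝ 1 f) :
    IsClosedEmbedding (graphMap p n f) := by
  have hc : Continuous fun x : E => (ℝ ∙ n)ᗮ.orthogonalProjectionOnto (x - p) := by fun_prop
  have h := hf.continuous
  exact Function.LeftInverse.isClosedEmbedding (g := graphMap p n f)
    (f := fun x : E => (ℝ ∙ n)ᗮ.orthogonalProjectionOnto (x - p))
    orthogonalProjectionOnto_graphMap hc (by unfold graphMap; fun_prop)

theorem inner_graphNormal (y : (ℝ ∙ n)ᗮ) (v : E) :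
    ⟪graphNormal n f y, v⟫_ℝ =
      ⟪n, v⟫_ℝ - fderiv ℝ f y ((ℝ ∙ n)ᗮ.orthogonalProjectionOnto v) := by
  rw [graphNormal, inner_sub_left]
  congr 1
  set g := (InnerProductSpace.toDual ℝ (ℝ ∙ n)ᗮ).symm (fderiv ℝ f y)
  have h1 : ⟪(g : E), v⟫_ℝ = ⟪g, (ℝ ∙ n)ᗮ.orthogonalProjectionOnto v⟫_ℝ := by
    rw [Submodule.inner_orthogonalProjectionOnto_eq_of_mem_left]
  rw [h1, InnerProductSpace.toDual_symm_apply]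

theorem norm_graphNormal_sq (hn : ‖n‖ = 1) (y : (ℝ ∙ n)ᗮ) :
    ‖graphNormal n f y‖ ^ 2 = 1 + ‖fderiv ℝ f y‖ ^ 2 := by
  rw [graphNormal, norm_sub_sq_real, inner_orthogonal_span, hn, ← Submodule.coe_norm,
    LinearIsometryEquiv.norm_map]
  ring

theorem norm_graphNormal_pos (hn : ‖n‖ = 1) (y : (ℝ ∙ n)ᗮ) : 0 < ‖graphNormal n f y‖ := by
  have := norm_graphNormal_sq (f := f) hn y
  refine lt_of_le_of_ne (norm_nonneg _) fun h => ?_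
  rw [← h] at this
  nlinarith [sq_nonneg ‖fderiv ℝ f y‖]

theorem continuous_graphNormal (hf : ContDiff ℝ 1 f) : Continuous (graphNormal n f) := by
  have := hf.continuous_fderiv one_ne_zero
  unfold graphNormal
  fun_prop

theorem hasFDerivAt_graphHeight (hf : ContDiff ℝ 1 f) (x : E) :
    HasFDerivAt (graphHeight p n f)
      (innerSL ℝ (graphNormal n f ((ℝ ∙ n)ᗮ.orthogonalProjectionOnto (x - p)))) x := by
  have h1 : HasFDerivAt (fun x : E => ⟪n, x - p⟫_ℝ) (innerSL ℝ n) x := by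
    have := (innerSL ℝ n).hasFDerivAt (x := x - p)
    exact this.comp x ((hasFDerivAt_id x).sub_const p)
  have h2 : HasFDerivAt (fun x : E => (ℝ ∙ n)ᗮ.orthogonalProjectionOnto (x - p))
      ((ℝ ∙ n)ᗮ.orthogonalProjectionOnto) x := by
    have := ((ℝ ∙ n)ᗮ.orthogonalProjectionOnto).hasFDerivAt (x := x - p)
    exact this.comp x ((hasFDerivAt_id x).sub_const p)
  have h3 := (hf.differentiable one_ne_zero
    ((ℝ ∙ n)ᗮ.orthogonalProjectionOnto (x - p))).hasFDerivAt.comp x h2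
  refine (h1.sub h3).congr_fderiv ?_
  ext v
  rw [innerSL_apply_apply, inner_graphNormal]
  rfl

/-- The derivative of the graph parametrization. -/
def graphDeriv (n : E) (f : (ℝ ∙ n)ᗮ → ℝ) (y : (ℝ ∙ n)ᗮ) : (ℝ ∙ n)ᗮ →L[ℝ] E :=
  (ℝ ∙ n)ᗮ.subtypeL + (fderiv ℝ f y).smulRight n

theorem hasStrictFDerivAt_graphMap (hf : ContDiff ℝ 1 f) (y : (ℝ ∙ n)ᗮ) :
    HasStrictFDerivAt (graphMap p n f) (graphDeriv n f y) y := by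
  have h1 := (hf.contDiffAt (x := y)).hasStrictFDerivAt one_ne_zero
  have h2 := ((ℝ ∙ n)ᗮ.subtypeL).hasStrictFDerivAt (x := y)
  exact (h2.const_add p).add (h1.smul_const n)

theorem norm_le_graphDeriv (hn : ‖n‖ = 1) (y v : (ℝ ∙ n)ᗮ) : ‖v‖ ≤ ‖graphDeriv n f y v‖ := by
  have h : ‖graphDeriv n f y v‖ ^ 2 = ‖v‖ ^ 2 + (fderiv ℝ f y v) ^ 2 := by
    have : graphDeriv n f y v = (v : E) + (fderiv ℝ f y v) • n := rfl
    rw [this, norm_add_sq_real, inner_smul_right, real_inner_comm, inner_orthogonal_span,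
      norm_smul, hn, Real.norm_eq_abs, mul_one, sq_abs, Submodule.coe_norm]
    ring
  exact le_of_sq_le_sq (by rw [h]; nlinarith [sq_nonneg (fderiv ℝ f y v)]) (norm_nonneg _)

/-- The Gram matrix of the derivative is 1 + u uᵀ with u the coordinates of ∇f, and its determinant
is 1 + |u|². -/
theorem normDet_graphDeriv (hn : ‖n‖ = 1) (y : (ℝ ∙ n)ᗮ) :
    (graphDeriv n f y).toLinearMap.normDet = ‖graphNormal n f y‖ := by
  rw [← sq_eq_sq₀ (LinearMap.normDet_nonneg _) (norm_nonneg _), norm_graphNormal_sq hn]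
  set b := stdOrthonormalBasis ℝ (ℝ ∙ n)ᗮ
  have h := LinearMap.normDet_sq_eq_det_gram (graphDeriv n f y).toLinearMap b
  rw [show ((((graphDeriv n f y).toLinearMap.normDet ^ 2 : ℝ)) : ℝ) = _ from h]
  set u : Fin (Module.finrank ℝ (ℝ ∙ n)ᗮ) → ℝ := fun i => fderiv ℝ f y (b i)
  have hg : Matrix.gram ℝ (fun i => (graphDeriv n f y).toLinearMap (b i)) =
      1 + Matrix.replicateCol Unit u * Matrix.replicateRow Unit u := by
    ext i j
    have hi : ∀ i, (graphDeriv n f y).toLinearMap (b i) = (b i : E) + u i • n := fun _ => rfl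
    rw [Matrix.gram_apply, hi, hi, inner_add_left, inner_add_right, inner_add_right,
      inner_smul_left, inner_smul_right, inner_smul_left, inner_smul_right, inner_orthogonal_span,
      real_inner_comm n, inner_orthogonal_span, real_inner_self_eq_norm_sq, hn,
      ← Submodule.coe_inner, b.inner_eq_ite]
    simp [Matrix.one_apply, Matrix.mul_apply]
  rw [hg, Matrix.det_one_add_replicateCol_mul_replicateRow]
  congr 1
  have h2 := b.sum_sq_norm_inner_right ((InnerProductSpace.toDual ℝ (ℝ ∙ n)ᗮ).symm (fderiv ℝ f y))
  rw [LinearIsometryEquiv.norm_map] at h2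
  rw [← h2, dotProduct]
  refine Finset.sum_congr rfl fun i _ => ?_
  rw [real_inner_comm, InnerProductSpace.toDual_symm_apply, Real.norm_eq_abs, sq_abs, sq]

variable [MeasurableSpace E] [BorelSpace E]

theorem comap_graphMap_euclideanHausdorffMeasure (hn : ‖n‖ = 1) (hf : ContDiff ℝ 1 f) :
    Measure.comap (graphMap p n f) μHE[Module.finrank ℝ E - 1] =
      volume.withDensity fun y => ENNReal.ofReal ‖graphNormal n f y‖ := by
  have hfin : Module.finrank ℝ E - 1 = Module.finrank ℝ (ℝ ∙ n)ᗮ := by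
    have h1 := Submodule.finrank_add_finrank_orthogonal (ℝ ∙ n)
    rw [finrank_span_singleton (by rintro rfl; simp at hn)] at h1
    omega
  have h := comap_euclideanHausdorffMeasure (hasStrictFDerivAt_graphMap (p := p) (n := n) hf)
    (fun y v => norm_le_graphDeriv hn y v)
    (by simp_rw [normDet_graphDeriv hn]; exact (continuous_graphNormal hf).norm)
    (isClosedEmbedding_graphMap hf).measurableEmbedding
  simp_rw [normDet_graphDeriv hn] at h
  rw [hfin, h]

/-- Integration over a piece of a graph. -/
theorem setIntegral_graphMap_image (hn : ‖n‖ = 1) (hf : ContDiff ℝ 1 f) {A : Set (ℝ ∙ n)ᗮ}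
    (hA : MeasurableSet A) (g : E → ℝ) :
    ∫ ξ in graphMap p n f '' A, g ξ ∂μHE[Module.finrank ℝ E - 1] =
      ∫ y in A, ‖graphNormal n f y‖ * g (graphMap p n f y) := by
  have hemb := (isClosedEmbedding_graphMap (p := p) hf).measurableEmbedding
  have h1 : (μHE[Module.finrank ℝ E - 1] : Measure E).restrict (graphMap p n f '' A) =
      Measure.map (graphMap p n f) ((Measure.comap (graphMap p n f)
        μHE[Module.finrank ℝ E - 1]).restrict A) := by
    rw [← hemb.injective.preimage_image A, ← hemb.restrict_map, hemb.map_comap,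
      hemb.injective.preimage_image A,
      Measure.restrict_restrict (hemb.measurableSet_image.2 hA),
      inter_eq_left.2 (image_subset_range _ _)]
  rw [h1, hemb.integral_map, comap_graphMap_euclideanHausdorffMeasure hn hf,
    restrict_withDensity hA, integral_withDensity_eq_integral_toReal_smul]
  · simp
  · exact (continuous_graphNormal hf).norm.measurable.ennreal_ofReal
  · exact Eventually.of_forall fun _ => ENNReal.ofReal_lt_top

theorem integrableOn_graphMap_image (hn : ‖n‖ = 1) (hf : ContDiff ℝ 1 f) {A : Set (ℝ ∙ n)ᗮ}
    (hA : MeasurableSet A) (g : E → ℝ) :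
    IntegrableOn g (graphMap p n f '' A) μHE[Module.finrank ℝ E - 1] ↔
      IntegrableOn (fun y => ‖graphNormal n f y‖ * g (graphMap p n f y)) A := by
  have hemb := (isClosedEmbedding_graphMap (p := p) hf).measurableEmbedding
  have h1 : (μHE[Module.finrank ℝ E - 1] : Measure E).restrict (graphMap p n f '' A) =
      Measure.map (graphMap p n f) ((Measure.comap (graphMap p n f)
        μHE[Module.finrank ℝ E - 1]).restrict A) := by
    rw [← hemb.injective.preimage_image A, ← hemb.restrict_map, hemb.map_comap,
      hemb.injective.preimage_image A,
      Measure.restrict_restrict (hemb.measurableSet_image.2 hA),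
      inter_eq_left.2 (image_subset_range _ _)]
  rw [IntegrableOn, h1, hemb.integrable_map_iff, comap_graphMap_euclideanHausdorffMeasure hn hf,
    restrict_withDensity hA, integrable_withDensity_iff_integrable_smul']
  · simp [IntegrableOn]
  · exact (continuous_graphNormal hf).norm.measurable.ennreal_ofReal
  · exact Eventually.of_forall fun _ => ENNReal.ofReal_lt_top

end Graph


/-! ### The divergence theorem below a graph -/

section Subgraph

set_option linter.unusedSectionVars false

variable {E : Type*} [NormedAddCommGroup E] [InnerProductSpace ℝ E] [FiniteDimensional ℝ E]
  [MeasurableSpace E] [BorelSpace E]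

/-- Integration by parts against the constant 1. -/
theorem integral_fderiv_apply_eq_zero {F : Type*} [NormedAddCommGroup F] [NormedSpace ℝ F]
    [FiniteDimensional ℝ F] [MeasurableSpace F] [BorelSpace F] (μ : Measure F) [μ.IsAddHaarMeasure]
    {g : F → ℝ} (hg : ContDiff ℝ 1 g) (hc : HasCompactSupport g) (v : F) :
    ∫ y, fderiv ℝ g y v ∂μ = 0 := by
  have hcont : Continuous fun y => fderiv ℝ g y v :=
    (hg.continuous_fderiv one_ne_zero).clm_apply continuous_const
  have h := integral_mul_fderiv_eq_neg_fderiv_mul_of_integrable (μ := μ) (f := fun _ => (1 : ℝ))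
    (g := g) (v := v) (by simp)
    (by simpa using hcont.integrable_of_hasCompactSupport (hc.fderiv_apply ℝ v))
    (by simpa using hg.continuous.integrable_of_hasCompactSupport hc)
    (fun x _ => differentiableAt_const _) (fun x _ => hg.differentiable one_ne_zero x)
  simpa using h

/-- Coordinates straightening the graph of `f`. -/
def graphStraighten (p n : E) (hn : ‖n‖ = 1) (f : (ℝ ∙ n)ᗮ → ℝ) (hf : Continuous f) :
    (ℝ ∙ n)ᗮ × ℝ ≃ₜ E where
  toFun z := p + z.1 + (f z.1 + z.2) • n
  invFun x := ((ℝ ∙ n)ᗮ.orthogonalProjectionOnto (x - p), graphHeight p n f x)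
  left_inv z := by
    have h1 : p + (z.1 : E) + (f z.1 + z.2) • n - p = (z.1 : E) + (f z.1 + z.2) • n := by abel
    refine Prod.ext ?_ ?_
    · simp only [h1, orthogonalProjectionOnto_add_smul]
    · simp only [graphHeight, h1, orthogonalProjectionOnto_add_smul, inner_add_smul_unit hn]
      ring
  right_inv x := by
    have h := eq_orthogonalProjectionOnto_add_smul hn (x - p)
    simp only [graphHeight, add_sub_cancel]
    rw [add_assoc, h]; abel
  continuous_toFun := by fun_prop
  continuous_invFun := by unfold graphHeight; fun_prop

theorem graphHeight_graphStraighten {p n : E} (hn : ‖n‖ = 1) {f : (ℝ ∙ n)ᗮ → ℝ}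
    (hf : Continuous f) (z : (ℝ ∙ n)ᗮ × ℝ) :
    graphHeight p n f (graphStraighten p n hn f hf z) = z.2 :=
  congrArg Prod.snd ((graphStraighten p n hn f hf).left_inv z)

/-- The map is the shear (y, s) ↦ (y, f y + s), which translates each fibre, followed by the
isometric identification of n^⊥ × ℝ with E. -/
theorem measurePreserving_graphStraighten (p n : E) (hn : ‖n‖ = 1) (f : (ℝ ∙ n)ᗮ → ℝ)
    (hf : Continuous f) : MeasurePreserving (graphStraighten p n hn f hf) volume volume := by
  have h1 := ((ℝ ∙ n).measurePreserving_measurableEquivProd p).symm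
  rw [InnerProductSpace.euclideanHausdorffMeasure_eq_volume] at h1
  have h2 := (LinearIsometryEquiv.toSpanUnitSingleton (𝕜 := ℝ) n hn).measurePreserving
  have h3 : MeasurePreserving (fun z : (ℝ ∙ n)ᗮ × ℝ => (z.1, f z.1 + z.2))
      (volume.prod volume) (volume.prod volume) := by
    refine (MeasurePreserving.id volume).skew_product (g := fun y s => f y + s) ?_ ?_
    · exact (by fun_prop : Continuous fun z : (ℝ ∙ n)ᗮ × ℝ => f z.1 + z.2).measurable
    · exact Eventually.of_forall fun y => (measurePreserving_add_left volume (f y)).map_eq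
  have h4 := (h2.prod (MeasurePreserving.id (volume : Measure (ℝ ∙ n)ᗮ)))
  have h5 := h1.comp (h4.comp ((Measure.measurePreserving_swap
    (μ := (volume : Measure (ℝ ∙ n)ᗮ)) (ν := (volume : Measure ℝ))).comp h3))
  refine Eq.subst (motive := fun F => MeasurePreserving F volume volume) (funext fun z => ?_) h5
  simp only [Function.comp, Prod.map, Prod.swap, id, Submodule.measurableEquivProd_symm_apply,
    LinearIsometryEquiv.toSpanUnitSingleton_apply, vadd_eq_add]
  show _ = p + (z.1 : E) + (f z.1 + z.2) • n
  abel

/-- The divergence theorem for the region below a graph, for compactly supported fields of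
constant direction. -/
theorem setIntegral_fderiv_subgraph {p n : E} (hn : ‖n‖ = 1) {f : (ℝ ∙ n)ᗮ → ℝ}
    (hf : ContDiff ℝ 1 f) {g : E → ℝ} (hg : ContDiff ℝ 1 g) (hc : HasCompactSupport g) (v : E) :
    ∫ x in {x | graphHeight p n f x < 0}, fderiv ℝ g x v =
      ∫ y, g (graphMap p n f y) * ⟪graphNormal n f y, v⟫_ℝ := by
  set Φ := graphStraighten p n hn f hf.continuous with hΦ
  set u := (ℝ ∙ n)ᗮ.orthogonalProjectionOnto v with hu
  set τ : (ℝ ∙ n)ᗮ → ℝ := fun y => ⟪graphNormal n f y, v⟫_ℝ with hτ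
  have hτc : Continuous τ := (continuous_graphNormal hf).inner continuous_const
  have hΦd : ContDiff ℝ 1 Φ := by
    show ContDiff ℝ 1 fun z : (ℝ ∙ n)ᗮ × ℝ => p + (z.1 : E) + (f z.1 + z.2) • n
    have h1 : ContDiff ℝ 1 fun z : (ℝ ∙ n)ᗮ × ℝ => (z.1 : E) :=
      ((ℝ ∙ n)ᗮ.subtypeL.contDiff).comp contDiff_fst
    have h2 : ContDiff ℝ 1 fun z : (ℝ ∙ n)ᗮ × ℝ => f z.1 := hf.comp contDiff_fst
    fun_prop
  set G : (ℝ ∙ n)ᗮ × ℝ → ℝ := g ∘ Φ with hG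
  have hGd : ContDiff ℝ 1 G := hg.comp hΦd
  have hGc : HasCompactSupport G := hc.comp_homeomorph Φ
  have hGdiff : Differentiable ℝ G := hGd.differentiable one_ne_zero
  -- In straightened coordinates the constant vector v becomes (u, τ), and τ = ⟪graphNormal, v⟫
  -- depends on the base point y alone.
  have hderiv : ∀ z, fderiv ℝ g (Φ z) v = fderiv ℝ G z (u, 0) + τ z.1 * fderiv ℝ G z (0, 1) := by
    intro z
    have hΦ' : HasFDerivAt Φ ((ℝ ∙ n)ᗮ.subtypeL ∘L ContinuousLinearMap.fst ℝ _ ℝ +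
        ((fderiv ℝ f z.1) ∘L ContinuousLinearMap.fst ℝ _ ℝ +
          ContinuousLinearMap.snd ℝ (ℝ ∙ n)ᗮ ℝ).smulRight n) z := by
      have h1 : HasFDerivAt (fun z : (ℝ ∙ n)ᗮ × ℝ => (z.1 : E))
          ((ℝ ∙ n)ᗮ.subtypeL ∘L ContinuousLinearMap.fst ℝ _ ℝ) z :=
        ((ℝ ∙ n)ᗮ.subtypeL ∘L ContinuousLinearMap.fst ℝ _ ℝ).hasFDerivAt
      have h2 : HasFDerivAt (fun z : (ℝ ∙ n)ᗮ × ℝ => f z.1)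
          ((fderiv ℝ f z.1) ∘L ContinuousLinearMap.fst ℝ _ ℝ) z :=
        (hf.differentiable one_ne_zero z.1).hasFDerivAt.comp z hasFDerivAt_fst
      exact (h1.const_add p).add ((h2.add hasFDerivAt_snd).smul_const n)
    have hG' := ((hg.differentiable one_ne_zero (Φ z)).hasFDerivAt.comp z hΦ').fderiv
    have e1 : fderiv ℝ G z (u, 0) = fderiv ℝ g (Φ z) ((u : E) + fderiv ℝ f z.1 u • n) := by
      rw [hG, hG']; simp
    have e2 : fderiv ℝ G z (0, 1) = fderiv ℝ g (Φ z) n := by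
      rw [hG, hG']; simp
    rw [e1, e2, ← smul_eq_mul, ← map_smul, ← map_add, hτ]
    congr 1
    simp only [inner_graphNormal]
    have := eq_orthogonalProjectionOnto_add_smul hn v
    rw [add_assoc, ← add_smul, add_sub_cancel]
    exact this.symm
  have hset : Φ ⁻¹' {x | graphHeight p n f x < 0} = univ ×ˢ Iio 0 := by
    ext z
    simp [hΦ, graphHeight_graphStraighten]
  have hcont1 : ∀ w, Continuous fun z => fderiv ℝ G z w := fun w =>
    (hGd.continuous_fderiv one_ne_zero).clm_apply continuous_const
  have hi1 : Integrable (fun z => fderiv ℝ G z (u, 0)) (volume.prod volume) :=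
    (hcont1 _).integrable_of_hasCompactSupport (hGc.fderiv_apply ℝ _)
  have hi2 : Integrable (fun z : (ℝ ∙ n)ᗮ × ℝ => τ z.1 * fderiv ℝ G z (0, 1))
      (volume.prod volume) :=
    ((hτc.comp continuous_fst).mul (hcont1 _)).integrable_of_hasCompactSupport
      ((hGc.fderiv_apply ℝ _).mul_left)
  have hmp := measurePreserving_graphStraighten p n hn f hf.continuous
  rw [← hmp.setIntegral_preimage_emb Φ.measurableEmbedding, hset]
  simp_rw [← hΦ, hderiv]
  rw [show (volume : Measure ((ℝ ∙ n)ᗮ × ℝ)) = volume.prod volume from rfl,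
    integral_add hi1.integrableOn hi2.integrableOn]
  -- On every slice of constant height the horizontal derivative has integral zero.
  have hz1 : ∫ z in univ ×ˢ Iio 0, fderiv ℝ G z (u, 0) ∂(volume.prod volume) = 0 := by
    rw [← Measure.prod_restrict, Measure.restrict_univ, integral_prod_symm]
    · refine integral_eq_zero_of_ae (Eventually.of_forall fun s => ?_)
      have hsl : ∀ y, fderiv ℝ G (y, s) (u, 0) = fderiv ℝ (fun y => G (y, s)) y u := by
        intro y
        have := ((hGdiff (y, s)).hasFDerivAt.comp y (hasFDerivAt_prodMk_left (𝕜 := ℝ) y s)).fderiv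
        have h' : fderiv ℝ (fun y => G (y, s)) y = _ := this
        rw [h']; simp
      simp_rw [hsl]
      refine integral_fderiv_apply_eq_zero _ (hGd.comp (contDiff_prodMk_left s)) ?_ u
      exact hGc.comp_isClosedEmbedding (Function.LeftInverse.isClosedEmbedding (f := Prod.fst) (fun _ => rfl) continuous_fst (by fun_prop))
    · have := hi1.integrableOn (s := univ ×ˢ Iio (0 : ℝ))
      rwa [IntegrableOn, ← Measure.prod_restrict, Measure.restrict_univ] at this
  rw [hz1, zero_add, ← Measure.prod_restrict, Measure.restrict_univ, integral_prod]
  · refine integral_congr_ae (Eventually.of_forall fun y => ?_)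
    simp only
    rw [integral_const_mul, mul_comm]
    congr 1
    -- Integrating the vertical derivative over s < 0 leaves the value at s = 0, that is, on the
    -- graph.
    have hd : ∀ s, HasDerivAt (fun s => G (y, s)) (fderiv ℝ G (y, s) (0, 1)) s := by
      intro s
      have := (hGdiff (y, s)).hasFDerivAt.comp_hasDerivAt s
        ((hasDerivAt_const s y).prodMk (hasDerivAt_id s))
      exact this
    have hcs : HasCompactSupport fun s => G (y, s) :=
      hGc.comp_isClosedEmbedding (Function.LeftInverse.isClosedEmbedding (f := Prod.snd) (fun _ => rfl) continuous_snd (by fun_prop))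
    rw [← integral_Iic_eq_integral_Iio, integral_Iic_of_hasDerivAt_of_tendsto' (m := 0)
      (fun s _ => hd s)]
    · simp [hG, hΦ, graphStraighten, graphMap]
    · refine Integrable.integrableOn ?_
      refine Continuous.integrable_of_hasCompactSupport ?_ ?_
      · exact (hcont1 _).comp (by fun_prop)
      · exact (hGc.fderiv_apply ℝ ((0, 1) : (ℝ ∙ n)ᗮ × ℝ)).comp_isClosedEmbedding
          (Function.LeftInverse.isClosedEmbedding (f := Prod.snd) (fun _ => rfl) continuous_snd (by fun_prop))
    · exact hcs.is_zero_at_infty.mono_left atBot_le_cocompact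
  · have := hi2.integrableOn (s := univ ×ˢ Iio (0 : ℝ))
    rwa [IntegrableOn, ← Measure.prod_restrict, Measure.restrict_univ] at this

end Subgraph


/-! ### Charts of the lateral boundary -/

section Charts

variable {m : ℕ} [NeZero m] {Ω : Set (EuclideanSpace ℝ (Fin m))}

/-- Near `p`, inside the half-space, `Ω` is the region below the graph of `f`. -/
structure IsGraphChart (Ω : Set (EuclideanSpace ℝ (Fin m))) (p n : EuclideanSpace ℝ (Fin m))
    (d : ℝ) (f : (ℝ ∙ n)ᗮ → ℝ) : Prop where
  norm_eq : ‖n‖ = 1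
  pos : 0 < d
  contDiff : ContDiff ℝ 1 f
  mem_iff : ∀ x ∈ Metric.ball p d, 0 < x 0 → (x ∈ Ω ↔ graphHeight p n f x < 0)

theorem IsLyapunovDomain.exists_isGraphChart (hΩ : IsLyapunovDomain Ω)
    {p : EuclideanSpace ℝ (Fin m)} (hp : p ∈ closure (lateralBoundary Ω)) :
    ∃ (n : EuclideanSpace ℝ (Fin m)) (d : ℝ) (f : (ℝ ∙ n)ᗮ → ℝ), IsGraphChart Ω p n d f ∧
      f 0 = 0 ∧ fderiv ℝ f 0 = 0 := by
  obtain ⟨n, hn, -, d, hd, f, hf, hf0, hf1, h⟩ := hΩ.exists_graph p hp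
  refine ⟨n, d, f, ⟨hn, hd, hf, fun x hx hx0 => ?_⟩, hf0, hf1⟩
  rw [h x hx hx0, graphHeight, sub_neg]

theorem isOpen_halfSpace : IsOpen {x : EuclideanSpace ℝ (Fin m) | 0 < x 0} :=
  isOpen_lt continuous_const (by fun_prop)

variable {p n : EuclideanSpace ℝ (Fin m)} {d : ℝ} {f : (ℝ ∙ n)ᗮ → ℝ}

namespace IsGraphChart

theorem continuous_graphHeight (h : IsGraphChart Ω p n d f) : Continuous (graphHeight p n f) := by
  have := h.contDiff.continuous
  unfold graphHeight
  fun_prop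

theorem eventually_mem_iff (h : IsGraphChart Ω p n d f) {ξ : EuclideanSpace ℝ (Fin m)}
    (hξ : ξ ∈ Metric.ball p d) (hξ0 : 0 < ξ 0) :
    ∀ᶠ x in 𝓝 ξ, (x ∈ Ω ↔ graphHeight p n f x < 0) := by
  filter_upwards [Metric.isOpen_ball.mem_nhds hξ, isOpen_halfSpace.mem_nhds hξ0] with x hx hx0
  exact h.mem_iff x hx hx0

theorem isOuterUnitNormal (h : IsGraphChart Ω p n d f) {ξ : EuclideanSpace ℝ (Fin m)}
    (hξ : ξ ∈ Metric.ball p d) (hξ0 : 0 < ξ 0) (hF : graphHeight p n f ξ = 0) :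
    IsOuterUnitNormal Ω ξ
      (‖graphNormal n f ((ℝ ∙ n)ᗮ.orthogonalProjectionOnto (ξ - p))‖⁻¹ •
        graphNormal n f ((ℝ ∙ n)ᗮ.orthogonalProjectionOnto (ξ - p))) :=
  IsOuterUnitNormal.of_hasFDerivAt (norm_pos_iff.1 (norm_graphNormal_pos h.norm_eq _))
    (hasFDerivAt_graphHeight h.contDiff ξ) hF (h.eventually_mem_iff hξ hξ0)

/-- Negative height means membership in the open set Ω, and positive height persists near ξ, so both
exclude the frontier. Points of height zero are limits of points of Ω along -n. -/
theorem mem_lateralBoundary_iff (h : IsGraphChart Ω p n d f) (hΩo : IsOpen Ω)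
    {ξ : EuclideanSpace ℝ (Fin m)}
    (hξ : ξ ∈ Metric.ball p d) (hξ0 : 0 < ξ 0) :
    ξ ∈ lateralBoundary Ω ↔ graphHeight p n f ξ = 0 := by
  have hiff := h.mem_iff ξ hξ hξ0
  constructor
  · rintro ⟨hfr, -⟩
    rw [hΩo.frontier_eq] at hfr
    have h1 : 0 ≤ graphHeight p n f ξ := not_lt.1 fun hlt => hfr.2 (hiff.2 hlt)
    refine le_antisymm (not_lt.1 fun hlt => ?_) h1
    have h2 : ∀ᶠ x in 𝓝 ξ, x ∉ Ω := by
      filter_upwards [h.eventually_mem_iff hξ hξ0,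
        (isOpen_lt continuous_const h.continuous_graphHeight).mem_nhds hlt] with x hx hx'
      rw [hx, not_lt]
      exact le_of_lt hx'
    exact mem_closure_iff_frequently.1 hfr.1 h2
  · intro h0
    refine ⟨?_, hξ0⟩
    rw [hΩo.frontier_eq]
    refine ⟨?_, fun hmem => by have := hiff.1 hmem; linarith⟩
    have ht : Tendsto (fun s : ℝ => ξ - s • n) (𝓝[>] 0) (𝓝 ξ) := by
      have : Continuous fun s : ℝ => ξ - s • n := by fun_prop
      simpa using (this.tendsto 0).mono_left nhdsWithin_le_nhds
    refine mem_closure_of_tendsto ht ?_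
    filter_upwards [ht.eventually (h.eventually_mem_iff hξ hξ0), self_mem_nhdsWithin] with s hs hs0
    rw [hs]
    have e : ξ - s • n - p = (ξ - p) - s • n := by abel
    have h1 : (ℝ ∙ n)ᗮ.orthogonalProjectionOnto (ξ - s • n - p) =
        (ℝ ∙ n)ᗮ.orthogonalProjectionOnto (ξ - p) := by
      rw [e, map_sub, map_smul, Submodule.orthogonalProjectionOnto_orthogonalComplement_singleton_eq_zero,
        smul_zero, sub_zero]
    have h2 : ⟪n, ξ - s • n - p⟫_ℝ = ⟪n, ξ - p⟫_ℝ - s := by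
      rw [e, inner_sub_right, inner_smul_right, real_inner_self_eq_norm_sq, h.norm_eq]; ring
    rw [graphHeight, h1, h2]
    rw [graphHeight] at h0
    have : (0 : ℝ) < s := hs0
    linarith

theorem lateralBoundary_inter (h : IsGraphChart Ω p n d f) (hΩo : IsOpen Ω) :
    lateralBoundary Ω ∩ Metric.ball p d =
      graphMap p n f '' (graphMap p n f ⁻¹' (Metric.ball p d ∩ {x | 0 < x 0})) := by
  ext ξ
  constructor
  · rintro ⟨hξ, hb⟩
    have := (h.mem_lateralBoundary_iff hΩo hb hξ.2).1 hξ
    rw [graphHeight_eq_zero_iff h.norm_eq] at this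
    exact ⟨_, by rw [mem_preimage, this]; exact ⟨hb, hξ.2⟩, this⟩
  · rintro ⟨y, ⟨hb, h0⟩, rfl⟩
    exact ⟨(h.mem_lateralBoundary_iff hΩo hb h0).2 (graphHeight_graphMap h.norm_eq y), hb⟩

theorem outerUnitNormal_graphMap (h : IsGraphChart Ω p n d f) {y : (ℝ ∙ n)ᗮ}
    (hy : graphMap p n f y ∈ Metric.ball p d) (hy0 : 0 < graphMap p n f y 0) :
    outerUnitNormal Ω (graphMap p n f y) = ‖graphNormal n f y‖⁻¹ • graphNormal n f y := by
  have := (h.isOuterUnitNormal hy hy0 (graphHeight_graphMap h.norm_eq y)).outerUnitNormal_eq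
  rwa [orthogonalProjectionOnto_graphMap] at this

theorem measure_lateralBoundary_inter_lt_top (h : IsGraphChart Ω p n d f) (hΩo : IsOpen Ω) :
    μHE[m - 1] (lateralBoundary Ω ∩ Metric.ball p d) < ⊤ := by
  have hemb := (isClosedEmbedding_graphMap (p := p) h.contDiff).measurableEmbedding
  rw [h.lateralBoundary_inter hΩo]
  -- The projection is 1-Lipschitz, so the parameters stay in a ball, on which the continuous area
  -- density is integrable.
  have hsub : graphMap p n f ⁻¹' (Metric.ball p d ∩ {x | 0 < x 0}) ⊆ Metric.closedBall 0 d := by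
    intro y hy
    have h1 : ‖graphMap p n f y - p‖ < d := by simpa [dist_eq_norm] using hy.1
    have h2 : ‖(ℝ ∙ n)ᗮ.orthogonalProjectionOnto (graphMap p n f y - p)‖ ≤ _ :=
      Submodule.norm_orthogonalProjectionOnto_apply_le _ _
    rw [orthogonalProjectionOnto_graphMap] at h2
    simpa using h2.trans h1.le
  refine (measure_mono (image_mono hsub)).trans_lt ?_
  have h3 : (μHE[m - 1] : Measure (EuclideanSpace ℝ (Fin m))) =
      μHE[Module.finrank ℝ (EuclideanSpace ℝ (Fin m)) - 1] := by rw [finrank_euclideanSpace_fin]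
  rw [h3, ← hemb.comap_apply, comap_graphMap_euclideanHausdorffMeasure h.norm_eq h.contDiff,
    withDensity_apply _ measurableSet_closedBall]
  have hInt : IntegrableOn (fun y => ‖graphNormal n f y‖) (Metric.closedBall 0 d) :=
    (continuous_graphNormal h.contDiff).norm.continuousOn.integrableOn_compact
      (isCompact_closedBall _ _)
  exact hInt.lintegral_lt_top

/-- The divergence theorem for fields supported in a chart. -/
theorem setIntegral_fderiv (h : IsGraphChart Ω p n d f) (hΩo : IsOpen Ω)
    {g : EuclideanSpace ℝ (Fin m) → ℝ}
    (hg : ContDiff ℝ 1 g) (hc : HasCompactSupport g)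
    (hsupp : tsupport g ⊆ Metric.ball p d ∩ {x | 0 < x 0}) (v : EuclideanSpace ℝ (Fin m)) :
    ∫ x in Ω, fderiv ℝ g x v =
      ∫ ξ in lateralBoundary Ω, g ξ * ⟪outerUnitNormal Ω ξ, v⟫_ℝ ∂μHE[m - 1] := by
  set B : Set (EuclideanSpace ℝ (Fin m)) := Metric.ball p d ∩ {x | 0 < x 0} with hB
  have hBo : IsOpen B := Metric.isOpen_ball.inter isOpen_halfSpace
  have hg0 : ∀ x, x ∉ B → g x = 0 := fun x hx =>
    image_eq_zero_of_notMem_tsupport fun h' => hx (hsupp h')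
  have hg1 : ∀ x, x ∉ B → fderiv ℝ g x v = 0 := fun x hx => by
    have : x ∉ tsupport (fderiv ℝ g) := fun h' => hx (hsupp (tsupport_fderiv_subset ℝ h'))
    rw [image_eq_zero_of_notMem_tsupport this]; rfl
  -- Ω and the region below the graph can differ only outside B, where the derivative of g vanishes.
  have hleft : ∫ x in Ω, fderiv ℝ g x v = ∫ x in {x | graphHeight p n f x < 0}, fderiv ℝ g x v := by
    have hm : MeasurableSet {x | graphHeight p n f x < 0} :=
      (isOpen_lt h.continuous_graphHeight continuous_const).measurableSet
    rw [← integral_indicator hΩo.measurableSet, ← integral_indicator hm]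
    congr 1
    funext x
    by_cases hx : x ∈ B
    · have := h.mem_iff x hx.1 hx.2
      by_cases hxΩ : x ∈ Ω
      · rw [indicator_of_mem hxΩ, indicator_of_mem (show x ∈ {x | graphHeight p n f x < 0} from this.1 hxΩ)]
      · rw [indicator_of_notMem hxΩ, indicator_of_notMem
          (show x ∉ {x | graphHeight p n f x < 0} from fun h' => hxΩ (this.2 h'))]
    · simp [indicator, hg1 x hx]
  have hright : ∫ ξ in lateralBoundary Ω, g ξ * ⟪outerUnitNormal Ω ξ, v⟫_ℝ ∂μHE[m - 1] =
      ∫ ξ in lateralBoundary Ω ∩ Metric.ball p d,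
        g ξ * ⟪outerUnitNormal Ω ξ, v⟫_ℝ ∂μHE[m - 1] := by
    refine setIntegral_eq_of_subset_of_forall_sdiff_eq_zero ?_ inter_subset_left ?_
    · exact isClosed_frontier.measurableSet.inter isOpen_halfSpace.measurableSet
    · rintro ξ ⟨hξ, hξ'⟩
      rw [hg0 ξ fun hξB => hξ' ⟨hξ, hξB.1⟩, zero_mul]
  have hA : MeasurableSet (graphMap p n f ⁻¹' B) :=
    (isClosedEmbedding_graphMap (p := p) h.contDiff).continuous.measurable hBo.measurableSet
  have h3 : (μHE[m - 1] : Measure (EuclideanSpace ℝ (Fin m))) =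
      μHE[Module.finrank ℝ (EuclideanSpace ℝ (Fin m)) - 1] := by rw [finrank_euclideanSpace_fin]
  rw [hleft, setIntegral_fderiv_subgraph h.norm_eq h.contDiff hg hc, hright,
    h.lateralBoundary_inter hΩo, h3, setIntegral_graphMap_image h.norm_eq h.contDiff hA,
    ← integral_indicator hA]
  congr 1
  funext y
  by_cases hy : graphMap p n f y ∈ B
  -- The area density ‖N‖ cancels the normalisation of the unit normal N/‖N‖.
  · have hN := norm_graphNormal_pos (f := f) h.norm_eq y
    rw [indicator_of_mem (show y ∈ graphMap p n f ⁻¹' B from hy),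
      h.outerUnitNormal_graphMap hy.1 hy.2, inner_smul_left, conj_trivial]
    field_simp
  · rw [indicator_of_notMem (show y ∉ graphMap p n f ⁻¹' B from hy), hg0 _ hy, zero_mul]

end IsGraphChart

theorem measurableSet_lateralBoundary : MeasurableSet (lateralBoundary Ω) :=
  isClosed_frontier.measurableSet.inter isOpen_halfSpace.measurableSet

/-! ### Finite area of Γ, Hölder continuity of the normal, and the divergence theorem on Ω. -/

namespace IsLyapunovDomain

theorem isCompact_closure_lateralBoundary (hΩ : IsLyapunovDomain Ω) :
    IsCompact (closure (lateralBoundary Ω)) := by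
  refine Metric.isCompact_of_isClosed_isBounded isClosed_closure ?_
  exact (hΩ.isBounded.closure.subset
    (fun x hx => frontier_subset_closure hx.1)).closure

/-- Compactness of the closure of Γ leaves finitely many charts, each of finite area. Charts centred
at points of the edge are needed here: without them the area could blow up towards x₁ = 0. -/
theorem measure_lateralBoundary_lt_top (hΩ : IsLyapunovDomain Ω) :
    μHE[m - 1] (lateralBoundary Ω) < ⊤ := by
  choose! n d f hch _ _ using fun p (hp : p ∈ closure (lateralBoundary Ω)) =>
    hΩ.exists_isGraphChart hp
  obtain ⟨t, ht, hcov⟩ := hΩ.isCompact_closure_lateralBoundary.elim_nhds_subcover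
    (fun p => Metric.ball p (d p)) fun p hp => Metric.ball_mem_nhds p (hch p hp).pos
  have hsub : lateralBoundary Ω ⊆ ⋃ p ∈ t, lateralBoundary Ω ∩ Metric.ball p (d p) := by
    intro ξ hξ
    have := hcov (subset_closure hξ)
    simp only [mem_iUnion] at this ⊢
    obtain ⟨p, hp, hb⟩ := this
    exact ⟨p, hp, hξ, hb⟩
  refine (measure_mono hsub).trans_lt ?_
  refine (measure_biUnion_finset_le t _).trans_lt ?_
  exact ENNReal.sum_lt_top.2 fun p hp =>
    (hch p (ht p hp)).measure_lateralBoundary_inter_lt_top hΩ.isOpen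

theorem norm_outerUnitNormal (hΩ : IsLyapunovDomain Ω) {ξ : EuclideanSpace ℝ (Fin m)}
    (hξ : ξ ∈ lateralBoundary Ω) : ‖outerUnitNormal Ω ξ‖ = 1 := by
  obtain ⟨n, hn⟩ := hΩ.exists_normal ξ hξ
  rw [hn.outerUnitNormal_eq]; exact hn.1

/-- The normal field of a Lyapunov surface is Hölder continuous. -/
theorem exists_norm_outerUnitNormal_sub_le (hΩ : IsLyapunovDomain Ω) :
    ∃ a lam : ℝ, 0 < a ∧ 0 < lam ∧ ∀ x ∈ lateralBoundary Ω, ∀ y ∈ lateralBoundary Ω,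
      ‖outerUnitNormal Ω x - outerUnitNormal Ω y‖ ≤ a * ‖x - y‖ ^ lam := by
  obtain ⟨a, lam, ha, hlam, h⟩ := hΩ.angle_le
  refine ⟨a, lam, ha, hlam, fun x hx y hy => le_trans ?_ (h x hx y hy)⟩
  set u := outerUnitNormal Ω x
  set w := outerUnitNormal Ω y
  have hu : ‖u‖ = 1 := hΩ.norm_outerUnitNormal hx
  have hw : ‖w‖ = 1 := hΩ.norm_outerUnitNormal hy
  -- With θ the angle between the unit vectors, ‖u - w‖² = 2 - 2 cos θ ≤ θ².
  refine le_of_sq_le_sq ?_ (InnerProductGeometry.angle_nonneg _ _)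
  have hcos := InnerProductGeometry.cos_angle u w
  rw [hu, hw, mul_one, div_one] at hcos
  rw [norm_sub_sq_real, hu, hw, ← hcos]
  have := Real.one_sub_sq_div_two_le_cos (x := InnerProductGeometry.angle u w)
  linarith

theorem continuousOn_outerUnitNormal (hΩ : IsLyapunovDomain Ω) :
    ContinuousOn (outerUnitNormal Ω) (lateralBoundary Ω) := by
  obtain ⟨a, lam, ha, hlam, h⟩ := hΩ.exists_norm_outerUnitNormal_sub_le
  intro x hx
  rw [ContinuousWithinAt, tendsto_iff_norm_sub_tendsto_zero]
  have hlim : Tendsto (fun y => a * ‖y - x‖ ^ lam) (𝓝[lateralBoundary Ω] x) (𝓝 0) := by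
    have hc : Continuous fun y : EuclideanSpace ℝ (Fin m) => a * ‖y - x‖ ^ lam := by
      refine continuous_const.mul (Continuous.rpow_const (by fun_prop) fun _ => Or.inr hlam.le)
    have := (hc.tendsto x).mono_left (nhdsWithin_le_nhds (s := lateralBoundary Ω))
    simpa [Real.zero_rpow hlam.ne'] using this
  refine squeeze_zero' (Eventually.of_forall fun _ => norm_nonneg _) ?_ hlim
  filter_upwards [self_mem_nhdsWithin] with y hy
  exact h y hy x hx

theorem integrableOn_lateralBoundary (hΩ : IsLyapunovDomain Ω)
    {g : EuclideanSpace ℝ (Fin m) → ℝ} (hg : ContinuousOn g (lateralBoundary Ω)) {M : ℝ}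
    (hM : ∀ ξ ∈ lateralBoundary Ω, |g ξ| ≤ M) :
    IntegrableOn g (lateralBoundary Ω) μHE[m - 1] := by
  have hmeas : AEStronglyMeasurable g (μHE[m - 1].restrict (lateralBoundary Ω)) :=
    hg.aestronglyMeasurable measurableSet_lateralBoundary
  exact IntegrableOn.of_bound hΩ.measure_lateralBoundary_lt_top hmeas M
    ((ae_restrict_iff' measurableSet_lateralBoundary).2 (Eventually.of_forall hM))

theorem integrableOn_mul_inner_outerUnitNormal (hΩ : IsLyapunovDomain Ω)
    {g : EuclideanSpace ℝ (Fin m) → ℝ} (hg : Continuous g) (hc : HasCompactSupport g)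
    (v : EuclideanSpace ℝ (Fin m)) :
    IntegrableOn (fun ξ => g ξ * ⟪outerUnitNormal Ω ξ, v⟫_ℝ) (lateralBoundary Ω) μHE[m - 1] := by
  obtain ⟨M, hM⟩ := hg.bounded_above_of_compact_support hc
  refine hΩ.integrableOn_lateralBoundary (M := M * ‖v‖)
    (hg.continuousOn.mul (hΩ.continuousOn_outerUnitNormal.inner continuousOn_const)) fun ξ hξ => ?_
  rw [abs_mul]
  have h1 := abs_real_inner_le_norm (outerUnitNormal Ω ξ) v
  rw [hΩ.norm_outerUnitNormal hξ, one_mul] at h1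
  have h2 := hM ξ
  rw [Real.norm_eq_abs] at h2
  exact mul_le_mul h2 h1 (abs_nonneg _) ((abs_nonneg _).trans h2)

/-- The divergence theorem holds for fields supported near any given point. -/
theorem exists_isOpen_setIntegral_fderiv (hΩ : IsLyapunovDomain Ω)
    {p : EuclideanSpace ℝ (Fin m)} (hp : p ∈ closure Ω) (hp0 : 0 < p 0) :
    ∃ U, IsOpen U ∧ p ∈ U ∧ Bornology.IsBounded U ∧
      ∀ (g : EuclideanSpace ℝ (Fin m) → ℝ), ContDiff ℝ 1 g → HasCompactSupport g → tsupport g ⊆ U →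
        ∀ v, ∫ x in Ω, fderiv ℝ g x v =
          ∫ ξ in lateralBoundary Ω, g ξ * ⟪outerUnitNormal Ω ξ, v⟫_ℝ ∂μHE[m - 1] := by
  by_cases hpΩ : p ∈ Ω
  -- At an interior point U = Ω works, as both sides are then zero.
  · refine ⟨Ω, hΩ.isOpen, hpΩ, hΩ.isBounded, fun g hg hc hsupp v => ?_⟩
    rw [setIntegral_eq_integral_of_forall_compl_eq_zero, integral_fderiv_apply_eq_zero _ hg hc,
      setIntegral_eq_zero_of_forall_eq_zero]
    · intro ξ hξ
      have : ξ ∉ Ω := by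
        have := hξ.1
        rw [hΩ.isOpen.frontier_eq] at this
        exact this.2
      rw [image_eq_zero_of_notMem_tsupport fun h => this (hsupp h), zero_mul]
    · intro x hx
      have : x ∉ tsupport (fderiv ℝ g) := fun h' => hx (hsupp (tsupport_fderiv_subset ℝ h'))
      rw [image_eq_zero_of_notMem_tsupport this]; rfl
  · have hpΓ : p ∈ lateralBoundary Ω := ⟨by rw [hΩ.isOpen.frontier_eq]; exact ⟨hp, hpΩ⟩, hp0⟩
    obtain ⟨n, d, f, hch, -, -⟩ := hΩ.exists_isGraphChart (subset_closure hpΓ)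
    exact ⟨Metric.ball p d ∩ {x | 0 < x 0}, Metric.isOpen_ball.inter isOpen_halfSpace,
      ⟨Metric.mem_ball_self hch.pos, hp0⟩, Metric.isBounded_ball.subset inter_subset_left,
      fun g hg hc hsupp v => hch.setIntegral_fderiv hΩ.isOpen hg hc hsupp v⟩

/-- The divergence theorem for fields vanishing near the hyperplane `x₁ = 0`. -/
theorem setIntegral_fderiv (hΩ : IsLyapunovDomain Ω) {g : EuclideanSpace ℝ (Fin m) → ℝ}
    (hg : ContDiff ℝ 1 g) {δ : ℝ} (hδ : 0 < δ) (hgδ : ∀ x, x 0 < δ → g x = 0)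
    (v : EuclideanSpace ℝ (Fin m)) :
    ∫ x in Ω, fderiv ℝ g x v =
      ∫ ξ in lateralBoundary Ω, g ξ * ⟪outerUnitNormal Ω ξ, v⟫_ℝ ∂μHE[m - 1] := by
  have hc0 : Continuous fun x : EuclideanSpace ℝ (Fin m) => x 0 := by fun_prop
  -- With δ/2 in place of δ the partition of unity sums to 1 in a whole neighbourhood of each point
  -- of Ω with x₁ ≥ δ, so it may be differentiated there.
  set K : Set (EuclideanSpace ℝ (Fin m)) := closure Ω ∩ {x | δ / 2 ≤ x 0} with hK
  have hKcl : IsClosed K := isClosed_closure.inter (isClosed_le continuous_const hc0)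
  have hKc : IsCompact K :=
    Metric.isCompact_of_isClosed_isBounded hKcl (hΩ.isBounded.closure.subset inter_subset_left)
  choose! U hUo hpU hUb hU using fun p (hp : p ∈ K) =>
    hΩ.exists_isOpen_setIntegral_fderiv hp.1 (lt_of_lt_of_le (half_pos hδ) hp.2)
  obtain ⟨t, ht, hcov⟩ := hKc.elim_nhds_subcover U fun p hp => (hUo p hp).mem_nhds (hpU p hp)
  obtain ⟨ρ, hρ⟩ := SmoothPartitionOfUnity.exists_isSubordinate
    (modelWithCornersSelf ℝ (EuclideanSpace ℝ (Fin m))) hKcl (fun i : t => U i)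
    (fun i => hUo i (ht i i.2)) (fun x hx => by simpa using hcov hx)
  set G : t → EuclideanSpace ℝ (Fin m) → ℝ := fun i x => ρ i x * g x with hG
  have hGd : ∀ i, ContDiff ℝ 1 (G i) := fun i =>
    (((ρ i).contMDiff.contDiff).of_le (by exact_mod_cast le_top)).mul hg
  have hGs : ∀ i, tsupport (G i) ⊆ U i := fun i => (tsupport_mul_subset_left).trans (hρ i)
  have hGc : ∀ i, HasCompactSupport (G i) := fun i =>
    Metric.isCompact_of_isClosed_isBounded (isClosed_tsupport _)
      ((hUb i (ht i i.2)).subset (hGs i))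
  have hsum : ∀ x ∈ K, g x = ∑ i, G i x := by
    intro x hx
    have h1 := ρ.sum_eq_one hx
    rw [finsum_eq_sum_of_fintype] at h1
    rw [← Finset.sum_mul, h1, one_mul]
  have hderiv : ∀ x ∈ Ω, fderiv ℝ g x v = ∑ i, fderiv ℝ (G i) x v := by
    intro x hx
    rcases lt_or_ge (x 0) δ with hlt | hge
    · have hev : ∀ᶠ z in 𝓝 x, z 0 < δ := (isOpen_lt hc0 continuous_const).mem_nhds hlt
      have h1 : g =ᶠ[𝓝 x] fun _ => 0 := hev.mono hgδ
      have h2 : ∀ i, G i =ᶠ[𝓝 x] fun _ => 0 := fun i => hev.mono fun z hz => by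
        simp [hG, hgδ z hz]
      rw [h1.fderiv_eq]
      have h3 : ∀ i, fderiv ℝ (G i) x = 0 := fun i => by rw [(h2 i).fderiv_eq]; simp
      simp only [h3]
      simp
    · have hev : g =ᶠ[𝓝 x] fun z => ∑ i, G i z := by
        filter_upwards [hΩ.isOpen.mem_nhds hx,
          (isOpen_lt continuous_const hc0).mem_nhds (show δ / 2 < x 0 by linarith)] with z hz hz'
        exact hsum z ⟨subset_closure hz, le_of_lt hz'⟩
      rw [hev.fderiv_eq, fderiv_fun_sum fun i _ => (hGd i).differentiable one_ne_zero x]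
      simp
  have hbd : ∀ ξ ∈ lateralBoundary Ω, g ξ * ⟪outerUnitNormal Ω ξ, v⟫_ℝ =
      ∑ i, G i ξ * ⟪outerUnitNormal Ω ξ, v⟫_ℝ := by
    intro ξ hξ
    rw [← Finset.sum_mul]
    congr 1
    rcases lt_or_ge (ξ 0) δ with hlt | hge
    · simp [hG, hgδ ξ hlt]
    · exact hsum ξ ⟨frontier_subset_closure hξ.1, by show δ / 2 ≤ ξ 0; linarith⟩
  rw [setIntegral_congr_fun hΩ.isOpen.measurableSet hderiv,
    setIntegral_congr_fun measurableSet_lateralBoundary hbd, integral_finsetSum, integral_finsetSum]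
  · exact Finset.sum_congr rfl fun i _ => hU i (ht i i.2) (G i) (hGd i) (hGc i) (hGs i) v
  · exact fun i _ => hΩ.integrableOn_mul_inner_outerUnitNormal (hGd i).continuous (hGc i) v
  · intro i _
    have hcont : Continuous fun y => fderiv ℝ (G i) y v :=
      ((hGd i).continuous_fderiv one_ne_zero).clm_apply continuous_const
    exact (hcont.integrable_of_hasCompactSupport ((hGc i).fderiv_apply ℝ v)).integrableOn

/-- The divergence theorem for a field `h(ξ) (ξ - c)`. -/
theorem setIntegral_fderiv_sub_add (hΩ : IsLyapunovDomain Ω) {h : EuclideanSpace ℝ (Fin m) → ℝ}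
    (hh : ContDiff ℝ 1 h) {δ : ℝ} (hδ : 0 < δ) (hhδ : ∀ x, x 0 < δ → h x = 0)
    (c : EuclideanSpace ℝ (Fin m)) :
    ∫ x in Ω, (fderiv ℝ h x (x - c) + m * h x) =
      ∫ ξ in lateralBoundary Ω, h ξ * ⟪outerUnitNormal Ω ξ, ξ - c⟫_ℝ ∂μHE[m - 1] := by
  set e : Fin m → EuclideanSpace ℝ (Fin m) := fun i => EuclideanSpace.single i 1 with he
  -- Components of the field h(x)(x - c). The term m h below is h times the divergence of x - c.
  set g : Fin m → EuclideanSpace ℝ (Fin m) → ℝ := fun i x => h x * (x i - c i) with hg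
  have hsumE : ∀ x : EuclideanSpace ℝ (Fin m), ∑ i, x i • e i = x := by
    intro x
    ext j
    simp [he, Pi.single_apply]
  have hgd : ∀ i, ContDiff ℝ 1 (g i) := fun i => hh.mul (by fun_prop)
  have hgδ : ∀ i x, x 0 < δ → g i x = 0 := fun i x hx => by simp [hg, hhδ x hx]
  have hbdd : ∀ {F : EuclideanSpace ℝ (Fin m) → ℝ}, Continuous F →
      ∃ M, ∀ x ∈ closure Ω, ‖F x‖ ≤ M := fun hF =>
    (Metric.isCompact_of_isClosed_isBounded isClosed_closure
      hΩ.isBounded.closure).exists_bound_of_continuousOn hF.continuousOn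
  have hderiv : ∀ x, fderiv ℝ h x (x - c) + m * h x = ∑ i, fderiv ℝ (g i) x (e i) := by
    intro x
    have h1 : ∀ i, fderiv ℝ (g i) x (e i) = (x i - c i) * fderiv ℝ h x (e i) + h x := by
      intro i
      have hd : HasFDerivAt (fun x : EuclideanSpace ℝ (Fin m) => x i - c i)
          (EuclideanSpace.proj i : EuclideanSpace ℝ (Fin m) →L[ℝ] ℝ) x :=
        ((EuclideanSpace.proj i : EuclideanSpace ℝ (Fin m) →L[ℝ] ℝ).hasFDerivAt).sub_const (c i)
      have := ((hh.differentiable one_ne_zero x).hasFDerivAt.mul hd).fderiv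
      have h' : fderiv ℝ (g i) x = _ := this
      rw [h']
      simp [he]
      ring
    simp_rw [h1]
    rw [Finset.sum_add_distrib]
    congr 1
    · conv_lhs => rw [← hsumE (x - c), map_sum]
      simp
    · simp
  have hbd : ∀ ξ, h ξ * ⟪outerUnitNormal Ω ξ, ξ - c⟫_ℝ =
      ∑ i, g i ξ * ⟪outerUnitNormal Ω ξ, e i⟫_ℝ := by
    intro ξ
    conv_lhs => rw [← hsumE (ξ - c), inner_sum, Finset.mul_sum]
    refine Finset.sum_congr rfl fun i _ => ?_
    rw [inner_smul_right]
    simp [hg]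
    ring
  simp_rw [hderiv, hbd]
  rw [integral_finsetSum, integral_finsetSum]
  · exact Finset.sum_congr rfl fun i _ => hΩ.setIntegral_fderiv (hgd i) hδ (hgδ i) (e i)
  · intro i _
    obtain ⟨M, hM⟩ := hbdd (hgd i).continuous
    refine hΩ.integrableOn_lateralBoundary (M := M * ‖e i‖) ((hgd i).continuous.continuousOn.mul
      (hΩ.continuousOn_outerUnitNormal.inner continuousOn_const)) fun ξ hξ => ?_
    rw [abs_mul]
    have h1 := abs_real_inner_le_norm (outerUnitNormal Ω ξ) (e i)
    rw [hΩ.norm_outerUnitNormal hξ, one_mul] at h1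
    have h2 := hM ξ (frontier_subset_closure hξ.1)
    rw [Real.norm_eq_abs] at h2
    exact mul_le_mul h2 h1 (abs_nonneg _) ((abs_nonneg _).trans h2)
  · intro i _
    have hcont : Continuous fun y => fderiv ℝ (g i) y (e i) :=
      ((hgd i).continuous_fderiv one_ne_zero).clm_apply continuous_const
    exact (hcont.continuousOn.integrableOn_compact (Metric.isCompact_of_isClosed_isBounded
      isClosed_closure hΩ.isBounded.closure)).mono_set subset_closure

end IsLyapunovDomain

end Charts


/-! ### Integral representation of the fundamental solution -/

section Kernel

variable {m : ℕ} [NeZero m] {α : ℝ}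

/-- The weight `t^(α-1) (1-t)^(α-1)` of Euler's integral. -/
def betaWeight (α t : ℝ) : ℝ := t ^ (α - 1) * (1 - t) ^ (α - 1)

/-- The interpolation `(1-t) r² + t r₁²`. -/
def kernelDen (x ξ : EuclideanSpace ℝ (Fin m)) (t : ℝ) : ℝ := ‖ξ - x‖ ^ 2 + 4 * t * x 0 * ξ 0

/-- The integral `∫ t^j w(t) D_t^(-α-m/2)` over `(0, 1)`. -/
def kernelMoment (α : ℝ) (j : ℕ) (x ξ : EuclideanSpace ℝ (Fin m)) : ℝ :=
  ∫ t in Ioo (0 : ℝ) 1, betaWeight α t * (t ^ j * kernelDen x ξ t ^ (-(α + m / 2)))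

/-- The gradient of the fundamental solution, up to the constant `-fluxConst`. -/
def kernelField (α : ℝ) (x ξ : EuclideanSpace ℝ (Fin m)) : EuclideanSpace ℝ (Fin m) :=
  kernelMoment α 0 x ξ • (ξ - x) + (2 * x 0 * kernelMoment α 1 x ξ) • EuclideanSpace.single 0 1

/-- The factor of `kernelField` in the gradient of the fundamental solution. -/
def fluxConst (m : ℕ) (α : ℝ) : ℝ :=
  2 * Real.Gamma (α + m / 2) / ((4 : ℝ) ^ (1 - α) * Real.pi ^ ((m : ℝ) / 2) * Real.Gamma α)

theorem reflDistSq_eq (x ξ : EuclideanSpace ℝ (Fin m)) :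
    reflDistSq ξ x = ‖ξ - x‖ ^ 2 + 4 * x 0 * ξ 0 := by
  rw [reflDistSq, EuclideanSpace.real_norm_sq_eq,
    ← Finset.add_sum_erase _ _ (Finset.mem_univ (0 : Fin m))]
  simp only [PiLp.sub_apply]
  ring

theorem integrableOn_betaWeight (hα : 0 < α) : IntegrableOn (betaWeight α) (Ioo 0 1) := by
  have := (gaussF_beta_integral hα hα).1
  rw [intervalIntegrable_iff_integrableOn_Ioo_of_le zero_le_one] at this
  exact this

theorem betaWeight_nonneg {t : ℝ} (ht : t ∈ Ioo (0 : ℝ) 1) : 0 ≤ betaWeight α t :=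
  mul_nonneg (Real.rpow_nonneg ht.1.le _) (Real.rpow_nonneg (by linarith [ht.2]) _)

theorem continuousOn_betaWeight : ContinuousOn (betaWeight α) (Ioo 0 1) := by
  refine ContinuousOn.mul ?_ ?_
  · exact continuousOn_id.rpow_const fun t ht => Or.inl ht.1.ne'
  · exact (continuousOn_const.sub continuousOn_id).rpow_const fun t ht =>
      Or.inl (sub_pos.2 ht.2).ne'

theorem integrableOn_betaWeight_mul (hα : 0 < α) {F : ℝ → ℝ} (hF : ContinuousOn F (Ioo 0 1))
    {M : ℝ} (hM : ∀ t ∈ Ioo (0 : ℝ) 1, |F t| ≤ M) :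
    IntegrableOn (fun t => betaWeight α t * F t) (Ioo 0 1) := by
  refine Integrable.mono' ((integrableOn_betaWeight hα).mul_const M)
    ((continuousOn_betaWeight.mul hF).aestronglyMeasurable measurableSet_Ioo) ?_
  refine (ae_restrict_iff' measurableSet_Ioo).2 (Eventually.of_forall fun t ht => ?_)
  rw [norm_mul, Real.norm_eq_abs, Real.norm_eq_abs, abs_of_nonneg (betaWeight_nonneg ht)]
  exact mul_le_mul_of_nonneg_left (hM t ht) (betaWeight_nonneg ht)

theorem norm_sq_le_kernelDen {x ξ : EuclideanSpace ℝ (Fin m)} (hx : 0 ≤ x 0) (hξ : 0 ≤ ξ 0)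
    {t : ℝ} (ht : 0 ≤ t) : ‖ξ - x‖ ^ 2 ≤ kernelDen x ξ t := by
  unfold kernelDen
  have : 0 ≤ 4 * t * x 0 * ξ 0 := by positivity
  linarith

theorem kernelDen_pos {x ξ : EuclideanSpace ℝ (Fin m)} (hx : 0 ≤ x 0) (hξ : 0 ≤ ξ 0)
    (hne : ξ ≠ x) {t : ℝ} (ht : 0 ≤ t) : 0 < kernelDen x ξ t :=
  lt_of_lt_of_le (pow_pos (norm_pos_iff.2 (sub_ne_zero.2 hne)) 2) (norm_sq_le_kernelDen hx hξ ht)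

theorem continuous_kernelDen (x : EuclideanSpace ℝ (Fin m)) :
    Continuous fun z : EuclideanSpace ℝ (Fin m) × ℝ => kernelDen x z.1 z.2 := by
  unfold kernelDen
  fun_prop

theorem integrableOn_kernelMoment (hα : 0 < α) (j : ℕ) {x ξ : EuclideanSpace ℝ (Fin m)}
    (hx : 0 ≤ x 0) (hξ : 0 ≤ ξ 0) (hne : ξ ≠ x) :
    IntegrableOn (fun t => betaWeight α t * (t ^ j * kernelDen x ξ t ^ (-(α + m / 2)))) (Ioo 0 1) := by
  have hpos := fun t (ht : 0 ≤ t) => kernelDen_pos hx hξ hne ht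
  have hc : Continuous fun t => kernelDen x ξ t := by unfold kernelDen; fun_prop
  have hr : 0 < ‖ξ - x‖ ^ 2 := pow_pos (norm_pos_iff.2 (sub_ne_zero.2 hne)) 2
  refine integrableOn_betaWeight_mul hα (M := (‖ξ - x‖ ^ 2) ^ (-(α + m / 2))) ?_ fun t ht => ?_
  · refine ContinuousOn.mul (by fun_prop) (hc.continuousOn.rpow_const fun t ht => ?_)
    exact Or.inl (hpos t ht.1.le).ne'
  · have h1 : 0 ≤ t ^ j := pow_nonneg ht.1.le _
    have h2 : 0 ≤ kernelDen x ξ t ^ (-(α + m / 2)) := Real.rpow_nonneg (hpos t ht.1.le).le _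
    rw [abs_of_nonneg (mul_nonneg h1 h2)]
    calc t ^ j * kernelDen x ξ t ^ (-(α + m / 2)) ≤ 1 * kernelDen x ξ t ^ (-(α + m / 2)) :=
          mul_le_mul_of_nonneg_right (pow_le_one₀ ht.1.le ht.2.le) h2
      _ ≤ _ := by
          rw [one_mul]
          exact Real.rpow_le_rpow_of_nonpos hr (norm_sq_le_kernelDen hx hξ ht.1.le)
            (by have : (0 : ℝ) ≤ m := Nat.cast_nonneg _
                linarith)

/-- Since r₁² = r² + 4x₁ξ₁, the factor 1 - t(1 - r₁²/r²) of Euler's integral equals D_t / r², and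
the prefactor is exactly the power of r² that clears the denominator. -/
theorem fundSol_eq_integral {x ξ : EuclideanSpace ℝ (Fin m)}
    (hx : 0 ≤ x 0) (hξ : 0 ≤ ξ 0) (hne : ξ ≠ x) :
    fundSol α ξ x = fundConst m α * (Real.Gamma (2 * α) / (Real.Gamma α * Real.Gamma α)) *
      ∫ t in Ioo (0 : ℝ) 1, betaWeight α t * kernelDen x ξ t ^ (-(α + (m - 2) / 2)) := by
  have hr : 0 < ‖ξ - x‖ ^ 2 := pow_pos (norm_pos_iff.2 (sub_ne_zero.2 hne)) 2
  rw [fundSol, gaussF, intervalIntegral.integral_of_le zero_le_one, integral_Ioc_eq_integral_Ioo,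
    show 2 * α - α = α by ring]
  have e : ∫ t in Ioo (0 : ℝ) 1, betaWeight α t * kernelDen x ξ t ^ (-(α + ((m : ℝ) - 2) / 2)) =
      (‖ξ - x‖ ^ 2) ^ (-α - ((m : ℝ) - 2) / 2) * ∫ t in Ioo (0 : ℝ) 1, t ^ (α - 1) *
        (1 - t) ^ (α - 1) * (1 - t * (1 - reflDistSq ξ x / ‖ξ - x‖ ^ 2)) ^
          (-(α + ((m : ℝ) - 2) / 2)) := by
    rw [← integral_const_mul]
    refine setIntegral_congr_fun measurableSet_Ioo fun t ht => ?_
    have hD : kernelDen x ξ t =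
        ‖ξ - x‖ ^ 2 * (1 - t * (1 - reflDistSq ξ x / ‖ξ - x‖ ^ 2)) := by
      have hr' := hr.ne'
      rw [reflDistSq_eq, kernelDen]
      generalize ‖ξ - x‖ ^ 2 = R at hr'
      field_simp
      ring
    have hq : 0 ≤ 1 - t * (1 - reflDistSq ξ x / ‖ξ - x‖ ^ 2) := by
      have h1 := kernelDen_pos hx hξ hne ht.1.le
      rw [hD] at h1
      exact (pos_of_mul_pos_right h1 hr.le).le
    simp only [betaWeight]
    rw [hD, Real.mul_rpow hr.le hq, show -α - ((m : ℝ) - 2) / 2 = -(α + ((m : ℝ) - 2) / 2) by ring]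
    ring
  rw [e]
  ring

theorem hasFDerivAt_kernelDen (x ξ : EuclideanSpace ℝ (Fin m)) (t : ℝ) :
    HasFDerivAt (fun η => kernelDen x η t)
      ((2 : ℝ) • innerSL ℝ (ξ - x) + (4 * t * x 0) • (EuclideanSpace.proj 0 :
        EuclideanSpace ℝ (Fin m) →L[ℝ] ℝ)) ξ := by
  have h1 : HasFDerivAt (fun η : EuclideanSpace ℝ (Fin m) => ‖η - x‖ ^ 2)
      ((2 : ℝ) • innerSL ℝ (ξ - x)) ξ := by
    have := ((hasFDerivAt_id ξ).sub_const x).norm_sq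
    refine this.congr_fderiv ?_
    ext v
    simp
  have h2 : HasFDerivAt (fun η : EuclideanSpace ℝ (Fin m) => 4 * t * x 0 * η 0)
      ((4 * t * x 0) • (EuclideanSpace.proj 0 : EuclideanSpace ℝ (Fin m) →L[ℝ] ℝ)) ξ :=
    ((EuclideanSpace.proj 0 : EuclideanSpace ℝ (Fin m) →L[ℝ] ℝ).hasFDerivAt).const_mul _
  exact h1.add h2

set_option linter.unusedSectionVars false in
-- Differentiating D_t^{-a}, a = α + (m-2)/2, along ∇D_t = 2 `kernelDir` produces the factor 2a;
-- then a Γ(a) = Γ(a + 1) = Γ(α + m/2).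
theorem fluxConst_eq (hα : 0 < α) (hm : 2 < m) :
    fundConst m α * (Real.Gamma (2 * α) / (Real.Gamma α * Real.Gamma α)) *
      (2 * (α + ((m : ℝ) - 2) / 2)) = fluxConst m α := by
  have hm' : (2 : ℝ) < m := by exact_mod_cast hm
  have ha : 0 < α + ((m : ℝ) - 2) / 2 := by linarith
  have h1 : Real.Gamma (α + m / 2) =
      (α + ((m : ℝ) - 2) / 2) * Real.Gamma (α + ((m : ℝ) - 2) / 2) := by
    rw [← Real.Gamma_add_one ha.ne']
    congr 1
    ring
  have h2 := (Real.Gamma_pos_of_pos hα).ne'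
  have h3 := (Real.Gamma_pos_of_pos (show 0 < 2 * α by linarith)).ne'
  rw [fundConst, fluxConst, h1]
  field_simp

/-- Differentiation under Euler's integral. The condition ξ₁ > 0 keeps a neighbourhood of ξ inside
the half-space, where D_t stays positive. -/
theorem fderiv_fundSol (hα : 0 < α) (hm : 2 < m) {x ξ : EuclideanSpace ℝ (Fin m)}
    (hx : 0 ≤ x 0) (hξ : 0 < ξ 0) (hne : ξ ≠ x) (v : EuclideanSpace ℝ (Fin m)) :
    fderiv ℝ (fun η => fundSol α η x) ξ v = -fluxConst m α * ⟪kernelField α x ξ, v⟫_ℝ := by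
  have hm' : (2 : ℝ) < m := by exact_mod_cast hm
  set a : ℝ := α + ((m : ℝ) - 2) / 2 with ha
  have hapos : 0 < a := by rw [ha]; linarith
  have hA : -a - 1 = -(α + m / 2) := by rw [ha]; ring
  set L : EuclideanSpace ℝ (Fin m) → ℝ → EuclideanSpace ℝ (Fin m) →L[ℝ] ℝ := fun η t =>
    (2 : ℝ) • innerSL ℝ (η - x) + (4 * t * x 0) • (EuclideanSpace.proj 0 :
        EuclideanSpace ℝ (Fin m) →L[ℝ] ℝ) with hL
  set F : EuclideanSpace ℝ (Fin m) → ℝ → ℝ := fun η t =>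
    betaWeight α t * kernelDen x η t ^ (-a) with hF
  set F' : EuclideanSpace ℝ (Fin m) → ℝ → EuclideanSpace ℝ (Fin m) →L[ℝ] ℝ := fun η t =>
    (betaWeight α t * (-a * kernelDen x η t ^ (-a - 1))) • L η t with hF'
  have hr : 0 < ‖ξ - x‖ := norm_pos_iff.2 (sub_ne_zero.2 hne)
  -- On this neighbourhood D_t ≥ (r/2)² and ‖∇D_t‖ is bounded, which gives the integrable majorant M
  -- times the weight.
  set s : Set (EuclideanSpace ℝ (Fin m)) :=
    {η | 0 < η 0} ∩ ({η | ‖ξ - x‖ / 2 < ‖η - x‖} ∩ {η | ‖η - x‖ < ‖ξ - x‖ + 1}) with hs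
  have hsn : s ∈ 𝓝 ξ := by
    refine inter_mem (isOpen_halfSpace.mem_nhds hξ) (inter_mem ?_ ?_)
    · exact (isOpen_lt continuous_const (by fun_prop)).mem_nhds (show ‖ξ - x‖ / 2 < ‖ξ - x‖ by linarith)
    · exact (isOpen_lt (by fun_prop) continuous_const).mem_nhds (show ‖ξ - x‖ < ‖ξ - x‖ + 1 by linarith)
  have hsne : ∀ η ∈ s, η ≠ x := by
    rintro η hη rfl
    have := hη.2.1
    simp only [mem_ofPred_eq, sub_self, norm_zero] at this
    linarith
  have hDc : ∀ η, Continuous fun t => kernelDen x η t := fun η => by unfold kernelDen; fun_prop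
  have hrpc : ∀ η ∈ s, ∀ b : ℝ, ContinuousOn (fun t => kernelDen x η t ^ b) (Ioo 0 1) :=
    fun η hη b => (hDc η).continuousOn.rpow_const fun t ht =>
      Or.inl (kernelDen_pos hx (le_of_lt hη.1) (hsne η hη) ht.1.le).ne'
  have hξs : ξ ∈ s := mem_of_mem_nhds hsn
  have hLc : ∀ η, Continuous (L η) := fun η => by rw [hL]; fun_prop
  set M : ℝ := a * ((‖ξ - x‖ / 2) ^ 2) ^ (-a - 1) * (2 * (‖ξ - x‖ + 1) + 4 * x 0) with hM
  have hbound : ∀ t ∈ Ioo (0 : ℝ) 1, ∀ η ∈ s, ‖F' η t‖ ≤ betaWeight α t * M := by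
    intro t ht η hη
    have hD := kernelDen_pos hx (le_of_lt hη.1) (hsne η hη) ht.1.le
    have h1 : (‖ξ - x‖ / 2) ^ 2 ≤ kernelDen x η t :=
      le_trans (pow_le_pow_left₀ (by positivity) (le_of_lt hη.2.1) 2)
        (norm_sq_le_kernelDen hx (le_of_lt hη.1) ht.1.le)
    have h2 : kernelDen x η t ^ (-a - 1) ≤ ((‖ξ - x‖ / 2) ^ 2) ^ (-a - 1) :=
      Real.rpow_le_rpow_of_nonpos (by positivity) h1 (by linarith)
    have h3 : ‖L η t‖ ≤ 2 * (‖ξ - x‖ + 1) + 4 * x 0 := by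
      refine ContinuousLinearMap.opNorm_le_bound _ (by positivity) fun w => ?_
      have h4 := abs_real_inner_le_norm (η - x) w
      have h5 : ‖w 0‖ ≤ ‖w‖ := PiLp.norm_apply_le w 0
      have h6 : ‖η - x‖ ≤ ‖ξ - x‖ + 1 := le_of_lt hη.2.2
      simp only [hL, smul_apply, add_apply, innerSL_apply_apply, smul_eq_mul, PiLp.proj_apply]
      refine (norm_add_le _ _).trans ?_
      rw [norm_mul, norm_mul, Real.norm_eq_abs ⟪η - x, w⟫_ℝ, add_mul]
      refine add_le_add ?_ ?_
      · rw [Real.norm_two, mul_assoc]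
        refine mul_le_mul_of_nonneg_left (h4.trans ?_) zero_le_two
        exact mul_le_mul_of_nonneg_right h6 (norm_nonneg _)
      · refine mul_le_mul ?_ h5 (norm_nonneg _) (by positivity)
        rw [Real.norm_eq_abs, abs_of_nonneg (by have := ht.1; positivity)]
        have := ht.2
        nlinarith
    have h7 : 0 ≤ kernelDen x η t ^ (-a - 1) := Real.rpow_nonneg hD.le _
    simp only [hF']
    rw [norm_smul, norm_mul, norm_mul, norm_neg, Real.norm_of_nonneg (betaWeight_nonneg ht),
      Real.norm_of_nonneg hapos.le, Real.norm_of_nonneg h7, hM, mul_assoc]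
    refine mul_le_mul_of_nonneg_left ?_ (betaWeight_nonneg ht)
    refine mul_le_mul (mul_le_mul_of_nonneg_left h2 hapos.le) h3 (norm_nonneg _) (by positivity)
  have hder := hasFDerivAt_integral_of_dominated_of_fderiv_le (𝕜 := ℝ)
    (μ := volume.restrict (Ioo (0 : ℝ) 1)) (F := F) (F' := F') (x₀ := ξ) (s := s)
    (bound := fun t => betaWeight α t * M) hsn ?_ ?_ ?_ ?_ ?_ ?_
  · have heq : (fun η => fundSol α η x) =ᶠ[𝓝 ξ] fun η =>
        fundConst m α * (Real.Gamma (2 * α) / (Real.Gamma α * Real.Gamma α)) *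
          ∫ t in Ioo (0 : ℝ) 1, F η t := by
      filter_upwards [hsn] with η hη
      exact fundSol_eq_integral hx (le_of_lt hη.1) (hsne η hη)
    rw [heq.fderiv_eq, (hder.const_mul _).fderiv]
    have hInt : Integrable (F' ξ) (volume.restrict (Ioo (0 : ℝ) 1)) := by
      refine Integrable.mono' ((integrableOn_betaWeight hα).mul_const M) ?_ ?_
      · refine ContinuousOn.aestronglyMeasurable ?_ measurableSet_Ioo
        exact (continuousOn_betaWeight.mul (continuousOn_const.mul (hrpc ξ hξs _))).smul
          (hLc ξ).continuousOn
      · exact (ae_restrict_iff' measurableSet_Ioo).2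
          (Eventually.of_forall fun t ht => hbound t ht ξ hξs)
    have happ : (∫ t in Ioo (0 : ℝ) 1, F' ξ t) v = ∫ t in Ioo (0 : ℝ) 1, F' ξ t v :=
      ContinuousLinearMap.integral_apply hInt v
    have hv : ∫ t in Ioo (0 : ℝ) 1, F' ξ t v =
        -(2 * a) * (kernelMoment α 0 x ξ * ⟪ξ - x, v⟫_ℝ + 2 * x 0 * kernelMoment α 1 x ξ * v 0) := by
      have h0 := integrableOn_kernelMoment hα 0 hx hξ.le hne
      have h1 := integrableOn_kernelMoment hα 1 hx hξ.le hne
      have : ∀ t, F' ξ t v = (-(2 * a) * ⟪ξ - x, v⟫_ℝ) *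
            (betaWeight α t * (t ^ 0 * kernelDen x ξ t ^ (-(α + m / 2)))) +
          (-(2 * a) * (2 * x 0 * v 0)) *
            (betaWeight α t * (t ^ 1 * kernelDen x ξ t ^ (-(α + m / 2)))) := by
        intro t
        simp only [hF', hL, hA, smul_apply, add_apply, innerSL_apply_apply, smul_eq_mul,
          PiLp.proj_apply, pow_zero, pow_one]
        ring
      simp_rw [this]
      rw [integral_add (h0.const_mul _) (h1.const_mul _), integral_const_mul, integral_const_mul,
        kernelMoment, kernelMoment]
      ring
    rw [smul_apply, happ, hv, smul_eq_mul, ← fluxConst_eq hα hm, ← ha,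
      kernelField, inner_add_left, inner_smul_left, inner_smul_left, EuclideanSpace.inner_single_left]
    simp
    ring
  · filter_upwards [hsn] with η hη
    exact (continuousOn_betaWeight.mul (hrpc η hη _)).aestronglyMeasurable measurableSet_Ioo
  · refine integrableOn_betaWeight_mul hα (hrpc ξ hξs _) (M := (‖ξ - x‖ ^ 2) ^ (-a)) fun t ht => ?_
    rw [abs_of_nonneg (Real.rpow_nonneg (kernelDen_pos hx hξ.le hne ht.1.le).le _)]
    exact Real.rpow_le_rpow_of_nonpos (by positivity) (norm_sq_le_kernelDen hx hξ.le ht.1.le)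
      (by linarith)
  · refine ContinuousOn.aestronglyMeasurable ?_ measurableSet_Ioo
    exact (continuousOn_betaWeight.mul (continuousOn_const.mul (hrpc ξ hξs _))).smul
      (hLc ξ).continuousOn
  · exact (ae_restrict_iff' measurableSet_Ioo).2 (Eventually.of_forall hbound)
  · exact (integrableOn_betaWeight hα).mul_const M
  · refine (ae_restrict_iff' measurableSet_Ioo).2 (Eventually.of_forall fun t ht η hη => ?_)
    have h1 := (hasFDerivAt_kernelDen x η t).rpow_const (p := -a)
      (Or.inl (kernelDen_pos hx (le_of_lt hη.1) (hsne η hη) ht.1.le).ne')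
    refine (h1.const_mul (betaWeight α t)).congr_fderiv ?_
    simp only [hF', smul_smul]
    rfl

end Kernel


/-! ### Green's identity for the fundamental solution -/

section Green

variable {m : ℕ} [NeZero m] {α : ℝ}

/-- The vector `½ ∇_ξ D_t`. -/
def kernelDir (x ξ : EuclideanSpace ℝ (Fin m)) (t : ℝ) : EuclideanSpace ℝ (Fin m) :=
  ξ - x + (2 * t * x 0) • EuclideanSpace.single 0 1

theorem inner_kernelDir (x ξ v : EuclideanSpace ℝ (Fin m)) (t : ℝ) :
    ⟪kernelDir x ξ t, v⟫_ℝ = ⟪ξ - x, v⟫_ℝ + 2 * t * x 0 * v 0 := by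
  rw [kernelDir, inner_add_left, inner_smul_left, EuclideanSpace.inner_single_left]
  simp

theorem kernelDir_apply_zero (x ξ : EuclideanSpace ℝ (Fin m)) (t : ℝ) :
    kernelDir x ξ t 0 = ξ 0 - (1 - 2 * t) * x 0 := by
  simp [kernelDir]
  ring

/-- Completing the square: D_t is the squared distance from ξ to x - 2t x₁e₁, a point between x and
its mirror image, plus 4t(1-t)x₁². -/
theorem norm_sq_kernelDir (x ξ : EuclideanSpace ℝ (Fin m)) (t : ℝ) :
    ‖kernelDir x ξ t‖ ^ 2 = kernelDen x ξ t - 4 * t * (1 - t) * x 0 ^ 2 := by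
  rw [← real_inner_self_eq_norm_sq, inner_kernelDir, kernelDir_apply_zero, real_inner_comm,
    inner_kernelDir, real_inner_self_eq_norm_sq, kernelDen, PiLp.sub_apply]
  ring

theorem continuous_kernelDir (x : EuclideanSpace ℝ (Fin m)) :
    Continuous fun z : EuclideanSpace ℝ (Fin m) × ℝ => kernelDir x z.1 z.2 := by
  unfold kernelDir
  fun_prop

/-- `kernelField` is the integral of D_t^{-A} `kernelDir` against the weight. The form with a
functional ℓ serves both the unit normal and the differential of a cut-off. -/
theorem integral_betaWeight_mul_linear (hα : 0 < α) {x ξ : EuclideanSpace ℝ (Fin m)}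
    (hx : 0 ≤ x 0) (hξ : 0 ≤ ξ 0) (hne : ξ ≠ x)
    (ℓ : EuclideanSpace ℝ (Fin m) →L[ℝ] ℝ) :
    ∫ t in Ioo (0 : ℝ) 1, betaWeight α t *
      (kernelDen x ξ t ^ (-(α + m / 2)) * ℓ (kernelDir x ξ t)) = ℓ (kernelField α x ξ) := by
  have h0 := integrableOn_kernelMoment hα 0 hx hξ hne
  have h1 := integrableOn_kernelMoment hα 1 hx hξ hne
  have : ∀ t, betaWeight α t * (kernelDen x ξ t ^ (-(α + m / 2)) * ℓ (kernelDir x ξ t)) =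
      ℓ (ξ - x) * (betaWeight α t * (t ^ 0 * kernelDen x ξ t ^ (-(α + m / 2)))) +
      (2 * x 0 * ℓ (EuclideanSpace.single 0 1)) *
        (betaWeight α t * (t ^ 1 * kernelDen x ξ t ^ (-(α + m / 2)))) := by
    intro t
    rw [kernelDir, map_add, map_smul, smul_eq_mul]
    ring
  simp_rw [this]
  rw [integral_add (h0.const_mul _) (h1.const_mul _), integral_const_mul, integral_const_mul,
    kernelField, map_add, map_smul, map_smul, kernelMoment, kernelMoment, smul_eq_mul, smul_eq_mul]
  ring

/-- The factor in the divergence of `ξ₁^(2α) D_t^(-α-m/2) kernelDir`. -/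
def kernelDiv (α : ℝ) (x ξ : EuclideanSpace ℝ (Fin m)) (t : ℝ) : ℝ :=
  -(2 * α) * (1 - 2 * t) * (x 0 / ξ 0) * kernelDen x ξ t ^ (-(α + m / 2)) +
    8 * (α + m / 2) * (t * (1 - t)) * x 0 ^ 2 * kernelDen x ξ t ^ (-(α + m / 2) - 1)

/-- The integrand is the t-derivative of -2(x₁/ξ₁) t^α (1-t)^α D_t^{-A}, which vanishes at both
endpoints since α > 0. This is the differential equation of q₁ in integrated form. -/
theorem integral_betaWeight_mul_kernelDiv (hα : 0 < α) {x ξ : EuclideanSpace ℝ (Fin m)}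
    (hx : 0 ≤ x 0) (hξ : 0 < ξ 0) (hne : ξ ≠ x) :
    ∫ t in Ioo (0 : ℝ) 1, betaWeight α t * kernelDiv α x ξ t = 0 := by
  have hpos := fun t (ht : 0 ≤ t) => kernelDen_pos hx hξ.le hne ht
  have hDc : Continuous fun t => kernelDen x ξ t := by unfold kernelDen; fun_prop
  set A : ℝ := α + m / 2 with hA
  set f : ℝ → ℝ := fun t => -2 * (x 0 / ξ 0) * (t ^ α * (1 - t) ^ α * kernelDen x ξ t ^ (-A)) with hf
  have hder : ∀ t ∈ Ioo (0 : ℝ) 1, HasDerivAt f (betaWeight α t * kernelDiv α x ξ t) t := by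
    intro t ht
    have ht1 : 0 < 1 - t := by linarith [ht.2]
    have h1 : HasDerivAt (fun t : ℝ => t ^ α) (α * t ^ (α - 1)) t :=
      Real.hasDerivAt_rpow_const (Or.inl ht.1.ne')
    have h2 : HasDerivAt (fun t : ℝ => (1 - t) ^ α) (-1 * α * (1 - t) ^ (α - 1)) t :=
      ((hasDerivAt_id t).const_sub 1).rpow_const (Or.inl ht1.ne')
    have h3 : HasDerivAt (fun t : ℝ => kernelDen x ξ t) (4 * x 0 * ξ 0) t := by
      have := (((hasDerivAt_id t).const_mul (4 * x 0 * ξ 0))).const_add (‖ξ - x‖ ^ 2)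
      simp only [id, mul_one] at this
      refine this.congr_of_eventuallyEq (Eventually.of_forall fun s => ?_)
      simp only [kernelDen]; ring
    have h4 := h3.rpow_const (p := -A) (Or.inl (hpos t ht.1.le).ne')
    refine (((h1.mul h2).mul h4).const_mul (-2 * (x 0 / ξ 0))).congr_deriv ?_
    have e1 : t ^ α = t * t ^ (α - 1) := by
      rw [← Real.rpow_one_add' ht.1.le (by linarith)]; ring_nf
    have e2 : (1 - t) ^ α = (1 - t) * (1 - t) ^ (α - 1) := by
      rw [← Real.rpow_one_add' ht1.le (by linarith)]; ring_nf
    simp only [Pi.mul_apply, kernelDiv, betaWeight, ← hA]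
    rw [e1, e2]
    have := hξ.ne'
    field_simp
    ring
  have hcont : ContinuousOn f (Icc 0 1) := by
    refine continuousOn_const.mul (ContinuousOn.mul (ContinuousOn.mul ?_ ?_) ?_)
    · exact continuousOn_id.rpow_const fun _ _ => Or.inr hα.le
    · exact (continuousOn_const.sub continuousOn_id).rpow_const fun _ _ => Or.inr hα.le
    · exact hDc.continuousOn.rpow_const fun t ht => Or.inl (hpos t ht.1).ne'
  have hInt : IntervalIntegrable (fun t => betaWeight α t * kernelDiv α x ξ t) volume 0 1 := by
    rw [intervalIntegrable_iff_integrableOn_Ioo_of_le zero_le_one]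
    have hc : ContinuousOn (kernelDiv α x ξ) (Icc 0 1) := by
      unfold kernelDiv
      refine ContinuousOn.add (ContinuousOn.mul (by fun_prop) ?_) (ContinuousOn.mul (by fun_prop) ?_)
      · exact hDc.continuousOn.rpow_const fun t ht => Or.inl (hpos t ht.1).ne'
      · exact hDc.continuousOn.rpow_const fun t ht => Or.inl (hpos t ht.1).ne'
    obtain ⟨M, hM⟩ := isCompact_Icc.exists_bound_of_continuousOn hc
    exact integrableOn_betaWeight_mul hα (hc.mono Ioo_subset_Icc_self)
      fun t ht => hM t (Ioo_subset_Icc_self ht)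
  have := intervalIntegral.integral_eq_sub_of_hasDerivAt_of_le zero_le_one hcont hder hInt
  rw [intervalIntegral.integral_of_le zero_le_one, integral_Ioc_eq_integral_Ioo] at this
  rw [this, hf]
  simp [Real.zero_rpow hα.ne']

/-- Fubini: a bounded F on a set of finite measure is dominated by a multiple of the integrable
weight. -/
theorem setIntegral_betaWeight_swap (hα : 0 < α) {X : Type*} [TopologicalSpace X]
    [SecondCountableTopology X]
    [MeasurableSpace X] [BorelSpace X] {μ : Measure X} {S : Set X} (hS : MeasurableSet S)
    (hμ : μ S < ⊤) {F : X × ℝ → ℝ} (hF : ContinuousOn F (S ×ˢ Ioo 0 1)) {M : ℝ}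
    (hM : ∀ z ∈ S ×ˢ Ioo (0 : ℝ) 1, |F z| ≤ M) :
    ∫ ξ in S, (∫ t in Ioo (0 : ℝ) 1, betaWeight α t * F (ξ, t)) ∂μ =
      ∫ t in Ioo (0 : ℝ) 1, betaWeight α t * ∫ ξ in S, F (ξ, t) ∂μ := by
  set ν := μ.restrict S with hν
  have : IsFiniteMeasure ν := ⟨by simpa [hν] using hμ⟩
  have hνS : ν.restrict S = ν := by rw [hν, Measure.restrict_restrict hS, inter_self]
  have hprod : ν.prod (volume.restrict (Ioo (0 : ℝ) 1)) = (ν.prod volume).restrict (S ×ˢ Ioo 0 1) := by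
    rw [← Measure.prod_restrict, hνS]
  have hwm : ContinuousOn (fun z : X × ℝ => betaWeight α z.2) (S ×ˢ Ioo 0 1) :=
    continuousOn_betaWeight.comp continuousOn_snd fun z hz => hz.2
  have hInt : Integrable (Function.uncurry fun ξ t => betaWeight α t * F (ξ, t))
      (ν.prod (volume.restrict (Ioo (0 : ℝ) 1))) := by
    have hdom : Integrable (fun z : X × ℝ => M * betaWeight α z.2)
        (ν.prod (volume.restrict (Ioo (0 : ℝ) 1))) :=
      Integrable.mul_prod (integrable_const M) (integrableOn_betaWeight hα)
    refine Integrable.mono' hdom ?_ ?_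
    · rw [hprod]
      exact (hwm.mul hF).aestronglyMeasurable (hS.prod measurableSet_Ioo)
    · rw [hprod]
      refine (ae_restrict_iff' (hS.prod measurableSet_Ioo)).2 (Eventually.of_forall fun z hz => ?_)
      have h0 := betaWeight_nonneg (α := α) hz.2
      simp only [Function.uncurry, norm_mul]
      rw [Real.norm_of_nonneg h0, mul_comm]
      exact mul_le_mul_of_nonneg_right (hM z hz) h0
  rw [integral_integral_swap hInt]
  simp_rw [integral_const_mul]

/-- The left side is the divergence of φ ξ₁^{2α} D_t^{-A} `kernelDir`, as `kernelDir` is ξ minus a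
fixed point. The leading coefficient 2α - 2A + m is zero; what remains comes from the shift (1-2t)x₁
in the first component and the defect 4t(1-t)x₁² in |`kernelDir`|². -/
theorem fderiv_kernel_add {x ξ : EuclideanSpace ℝ (Fin m)} (hξ : 0 < ξ 0) {t : ℝ}
    (hD : 0 < kernelDen x ξ t) {φ : EuclideanSpace ℝ (Fin m) → ℝ} (hφ : DifferentiableAt ℝ φ ξ) :
    fderiv ℝ (fun η => φ η * (η 0 ^ (2 * α) * kernelDen x η t ^ (-(α + m / 2)))) ξ (kernelDir x ξ t) +
        m * (φ ξ * (ξ 0 ^ (2 * α) * kernelDen x ξ t ^ (-(α + m / 2)))) =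
      ξ 0 ^ (2 * α) * (kernelDen x ξ t ^ (-(α + m / 2)) * fderiv ℝ φ ξ (kernelDir x ξ t)) +
        φ ξ * ξ 0 ^ (2 * α) * kernelDiv α x ξ t := by
  set A : ℝ := α + m / 2 with hA
  have h1 : HasFDerivAt (fun η : EuclideanSpace ℝ (Fin m) => η 0 ^ (2 * α))
      ((2 * α * ξ 0 ^ (2 * α - 1)) • (EuclideanSpace.proj 0 : EuclideanSpace ℝ (Fin m) →L[ℝ] ℝ)) ξ :=
    ((EuclideanSpace.proj 0 : EuclideanSpace ℝ (Fin m) →L[ℝ] ℝ).hasFDerivAt).rpow_const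
      (Or.inl hξ.ne')
  have h2 := (hasFDerivAt_kernelDen x ξ t).rpow_const (p := -A) (Or.inl hD.ne')
  have h3 := (hφ.hasFDerivAt.mul (h1.mul h2)).fderiv
  have h3' : fderiv ℝ (fun η => φ η * (η 0 ^ (2 * α) * kernelDen x η t ^ (-A))) ξ = _ := h3
  rw [h3']
  have e1 : ⟪ξ - x, kernelDir x ξ t⟫_ℝ + 2 * t * x 0 * kernelDir x ξ t 0 =
      kernelDen x ξ t - 4 * t * (1 - t) * x 0 ^ 2 := by
    rw [← inner_kernelDir, real_inner_self_eq_norm_sq, norm_sq_kernelDir]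
  have e2 : kernelDen x ξ t ^ (-A) = kernelDen x ξ t * kernelDen x ξ t ^ (-A - 1) := by
    rw [Real.rpow_sub_one hD.ne', mul_div_cancel₀ _ hD.ne']
  have e3 : ξ 0 ^ (2 * α) = ξ 0 * ξ 0 ^ (2 * α - 1) := by
    rw [Real.rpow_sub_one hξ.ne', mul_div_cancel₀ _ hξ.ne']
  simp only [add_apply, smul_apply, smul_eq_mul, PiLp.proj_apply, innerSL_apply_apply,
    kernelDiv, ← hA, Pi.mul_apply]
  rw [e2, e3, kernelDir_apply_zero]
  rw [kernelDir_apply_zero] at e1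
  have e4 : ⟪ξ - x, kernelDir x ξ t⟫_ℝ = kernelDen x ξ t - 4 * t * (1 - t) * x 0 ^ 2 -
    2 * t * x 0 * (ξ 0 - (1 - 2 * t) * x 0) := by linarith
  rw [e4]
  have hm2 : (m : ℝ) = 2 * A - 2 * α := by rw [hA]; ring
  rw [hm2]
  have := hξ.ne'
  field_simp
  ring

theorem eventually_eq_zero_of_vanish {x ξ : EuclideanSpace ℝ (Fin m)}
    {φ : EuclideanSpace ℝ (Fin m) → ℝ} {δ ρ : ℝ} (hφδ : ∀ ξ, ξ 0 < δ → φ ξ = 0)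
    (hφρ : ∀ ξ, ‖ξ - x‖ < ρ → φ ξ = 0) (h : ξ 0 < δ ∨ ‖ξ - x‖ < ρ) : ∀ᶠ η in 𝓝 ξ, φ η = 0 := by
  have h1 : IsOpen {η : EuclideanSpace ℝ (Fin m) | η 0 < δ} :=
    isOpen_lt (by fun_prop) continuous_const
  have h2 : IsOpen {η : EuclideanSpace ℝ (Fin m) | ‖η - x‖ < ρ} :=
    isOpen_lt (by fun_prop) continuous_const
  filter_upwards [(h1.union h2).mem_nhds h] with η hη
  exact hη.elim (hφδ η) (hφρ η)

/-- φ vanishes near both singular sets: the region ξ₁ ≤ 0 and the pole. -/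
theorem contDiff_mul_kernel {x : EuclideanSpace ℝ (Fin m)} (hx : 0 ≤ x 0)
    {φ : EuclideanSpace ℝ (Fin m) → ℝ} (hφ : ContDiff ℝ 1 φ) {δ ρ : ℝ} (hδ : 0 < δ) (hρ : 0 < ρ)
    (hφδ : ∀ ξ, ξ 0 < δ → φ ξ = 0) (hφρ : ∀ ξ, ‖ξ - x‖ < ρ → φ ξ = 0) {t : ℝ} (ht : 0 ≤ t) :
    ContDiff ℝ 1 fun η => φ η * (η 0 ^ (2 * α) * kernelDen x η t ^ (-(α + m / 2))) := by
  rw [contDiff_iff_contDiffAt]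
  intro ξ
  have hzero : (∀ᶠ η in 𝓝 ξ, φ η = 0) → ContDiffAt ℝ 1
      (fun η => φ η * (η 0 ^ (2 * α) * kernelDen x η t ^ (-(α + m / 2)))) ξ := by
    intro h
    refine (contDiffAt_const (c := (0 : ℝ))).congr_of_eventuallyEq ?_
    filter_upwards [h] with η hη
    rw [hη, zero_mul]
  rcases lt_or_ge (ξ 0) δ with hlt | hge
  · exact hzero (eventually_eq_zero_of_vanish hφδ hφρ (Or.inl hlt))
  rcases lt_or_ge ‖ξ - x‖ ρ with hlt | hge'
  · exact hzero (eventually_eq_zero_of_vanish hφδ hφρ (Or.inr hlt))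
  have hξ : 0 < ξ 0 := hδ.trans_le hge
  have hne : ξ ≠ x := by
    rintro rfl
    rw [sub_self, norm_zero] at hge'
    linarith
  refine hφ.contDiffAt.mul (ContDiffAt.mul ?_ ?_)
  · exact ContDiffAt.rpow_const_of_ne (by fun_prop) hξ.ne'
  · refine ContDiffAt.rpow_const_of_ne ?_ (kernelDen_pos hx hξ.le hne ht).ne'
    have : ContDiff ℝ 1 fun η => kernelDen x η t := by
      unfold kernelDen
      exact ((contDiff_id.sub contDiff_const).norm_sq ℝ).add (by fun_prop)
    exact this.contDiffAt

/-- The kernel of Green's identity, integrated against the surface measure. -/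
theorem IsLyapunovDomain.integral_kernelField (hα : 0 < α) {Ω : Set (EuclideanSpace ℝ (Fin m))}
    (hΩ : IsLyapunovDomain Ω) {x : EuclideanSpace ℝ (Fin m)} (hx : 0 ≤ x 0)
    {φ : EuclideanSpace ℝ (Fin m) → ℝ} (hφ : ContDiff ℝ 1 φ) {δ ρ : ℝ} (hδ : 0 < δ) (hρ : 0 < ρ)
    (hφδ : ∀ ξ, ξ 0 < δ → φ ξ = 0) (hφρ : ∀ ξ, ‖ξ - x‖ < ρ → φ ξ = 0) :
    ∫ ξ in lateralBoundary Ω, φ ξ * (ξ 0 ^ (2 * α) *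
        ⟪kernelField α x ξ, outerUnitNormal Ω ξ⟫_ℝ) ∂μHE[m - 1] =
      ∫ ξ in Ω, ξ 0 ^ (2 * α) * fderiv ℝ φ ξ (kernelField α x ξ) := by
  set A : ℝ := α + m / 2 with hA
  have hc0 : Continuous fun z : EuclideanSpace ℝ (Fin m) × ℝ => z.1 0 := by fun_prop
  set T : Set (EuclideanSpace ℝ (Fin m) × ℝ) := {z | 0 < z.1 0 ∧ 0 < kernelDen x z.1 z.2} with hT
  set H : EuclideanSpace ℝ (Fin m) × ℝ → ℝ := fun z =>
    φ z.1 * (z.1 0 ^ (2 * α) * kernelDen x z.1 z.2 ^ (-A)) with hH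
  set FΩ : EuclideanSpace ℝ (Fin m) × ℝ → ℝ := fun z =>
    z.1 0 ^ (2 * α) * (kernelDen x z.1 z.2 ^ (-A) * fderiv ℝ φ z.1 (kernelDir x z.1 z.2)) +
        φ z.1 * z.1 0 ^ (2 * α) * kernelDiv α x z.1 z.2 with hFΩ
  set FΓ : EuclideanSpace ℝ (Fin m) × ℝ → ℝ := fun z =>
    H z * ⟪outerUnitNormal Ω z.1, kernelDir x z.1 z.2⟫_ℝ with hFΓ
  have hφ1 : ∀ ξ, ξ 0 < δ ∨ ‖ξ - x‖ < ρ → φ ξ = 0 ∧ fderiv ℝ φ ξ = 0 := by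
    intro ξ h
    have hev : φ =ᶠ[𝓝 ξ] fun _ => 0 := eventually_eq_zero_of_vanish hφδ hφρ h
    exact ⟨hev.self_of_nhds, by rw [hev.fderiv_eq]; simp⟩
  have hmemT : ∀ ξ : EuclideanSpace ℝ (Fin m), 0 < ξ 0 → ∀ t ∈ Ioo (0 : ℝ) 1, (ξ, t) ∈ T := by
    intro ξ hξ t ht
    refine ⟨hξ, ?_⟩
    -- Even at the pole D_t = 4t x₁² is positive, because t > 0 and ξ₁ > 0.
    rcases eq_or_ne ξ x with rfl | hne
    · have := ht.1
      simp only [kernelDen]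
      positivity
    · exact kernelDen_pos hx hξ.le hne ht.1.le
  have hrc : ContinuousOn (fun z : EuclideanSpace ℝ (Fin m) × ℝ => z.1 0 ^ (2 * α)) T :=
    hc0.continuousOn.rpow_const fun z hz => Or.inl hz.1.ne'
  have hDc : ∀ b : ℝ, ContinuousOn
      (fun z : EuclideanSpace ℝ (Fin m) × ℝ => kernelDen x z.1 z.2 ^ b) T := fun b =>
    (continuous_kernelDen x).continuousOn.rpow_const fun z hz => Or.inl hz.2.ne'
  have hφc : Continuous fun z : EuclideanSpace ℝ (Fin m) × ℝ => φ z.1 :=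
    hφ.continuous.comp continuous_fst
  have hHc : ContinuousOn H T := hφc.continuousOn.mul (hrc.mul (hDc _))
  have hdφ : Continuous fun z : EuclideanSpace ℝ (Fin m) × ℝ =>
      fderiv ℝ φ z.1 (kernelDir x z.1 z.2) :=
    ((hφ.continuous_fderiv one_ne_zero).comp continuous_fst).clm_apply (continuous_kernelDir x)
  have hdivc : ContinuousOn
      (fun z : EuclideanSpace ℝ (Fin m) × ℝ => kernelDiv α x z.1 z.2) T := by
    unfold kernelDiv
    refine ContinuousOn.add (ContinuousOn.mul (ContinuousOn.mul (by fun_prop) ?_) (hDc _))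
      (ContinuousOn.mul (by fun_prop) (hDc _))
    exact continuousOn_const.div hc0.continuousOn fun z hz => hz.1.ne'
  have hFΩc : ContinuousOn FΩ T :=
    (hrc.mul ((hDc _).mul hdφ.continuousOn)).add ((hφc.continuousOn.mul hrc).mul hdivc)
  -- Over the closure of Ω the integrands vanish outside this compact set, and they are continuous
  -- on it; this yields the bounds for Fubini.
  set C : Set (EuclideanSpace ℝ (Fin m) × ℝ) :=
    (closure Ω ∩ ({ξ | δ ≤ ξ 0} ∩ {ξ | ρ ≤ ‖ξ - x‖})) ×ˢ Icc 0 1 with hC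
  have hCc : IsCompact C := by
    refine IsCompact.prod (Metric.isCompact_of_isClosed_isBounded ?_
      (hΩ.isBounded.closure.subset inter_subset_left)) isCompact_Icc
    exact isClosed_closure.inter ((isClosed_le continuous_const (by fun_prop)).inter
      (isClosed_le continuous_const (by fun_prop)))
  have hCT : C ⊆ T := by
    rintro ⟨ξ, t⟩ ⟨⟨-, h1, h2⟩, ht⟩
    have hξ : 0 < ξ 0 := hδ.trans_le h1
    have hne : ξ ≠ x := by
      rintro rfl
      simp only [mem_ofPred_eq, sub_self, norm_zero] at h2
      linarith
    exact ⟨hξ, kernelDen_pos hx hξ.le hne ht.1⟩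
  have hclC : ∀ ξ ∈ closure Ω, ∀ t ∈ Ioo (0 : ℝ) 1, (ξ, t) ∈ C ∨ (ξ 0 < δ ∨ ‖ξ - x‖ < ρ) := by
    intro ξ hξ t ht
    by_cases h : ξ 0 < δ ∨ ‖ξ - x‖ < ρ
    · exact Or.inr h
    · push Not at h
      exact Or.inl ⟨⟨hξ, h.1, h.2⟩, ht.1.le, ht.2.le⟩
  obtain ⟨M1, hM1⟩ := hCc.exists_bound_of_continuousOn (hFΩc.mono hCT)
  obtain ⟨M2, hM2⟩ := hCc.exists_bound_of_continuousOn
    ((hHc.mono hCT).mul (continuous_kernelDir x).norm.continuousOn)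
  -- For fixed t the direction is ξ - c with c = x - 2t x₁e₁, so the divergence theorem for fields
  -- h(ξ)(ξ - c) applies.
  have hstep : ∀ t ∈ Ioo (0 : ℝ) 1, ∫ ξ in lateralBoundary Ω, FΓ (ξ, t) ∂μHE[m - 1] =
      ∫ ξ in Ω, FΩ (ξ, t) := by
    intro t ht
    have hdir : ∀ ξ, ξ - (x - (2 * t * x 0) • EuclideanSpace.single 0 1) = kernelDir x ξ t := by
      intro ξ; rw [kernelDir]; abel
    have h := hΩ.setIntegral_fderiv_sub_add
      (contDiff_mul_kernel (α := α) hx hφ hδ hρ hφδ hφρ ht.1.le) hδ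
      (fun ξ hξ => by rw [hφδ ξ hξ, zero_mul]) (x - (2 * t * x 0) • EuclideanSpace.single 0 1)
    simp_rw [hdir] at h
    refine h.symm.trans (setIntegral_congr_fun hΩ.isOpen.measurableSet fun ξ hξ => ?_)
    have hξ0 := hΩ.subset_halfSpace hξ
    exact fderiv_kernel_add hξ0 (hmemT ξ hξ0 t ht).2 (hφ.differentiable one_ne_zero ξ)
  have hswΓ := setIntegral_betaWeight_swap hα (μ := μHE[m - 1]) (S := lateralBoundary Ω) (F := FΓ)
    (M := max M2 0) measurableSet_lateralBoundary hΩ.measure_lateralBoundary_lt_top ?_ ?_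
  rotate_left
  · refine (hHc.mono fun z hz => hmemT z.1 hz.1.2 z.2 hz.2).mul ?_
    exact (hΩ.continuousOn_outerUnitNormal.comp continuousOn_fst fun z hz => hz.1).inner
      (continuous_kernelDir x).continuousOn
  · rintro ⟨ξ, t⟩ ⟨hξ, ht⟩
    rcases hclC ξ (frontier_subset_closure hξ.1) t ht with h | h
    · refine le_trans ?_ (le_max_left _ _)
      have h1 := abs_real_inner_le_norm (outerUnitNormal Ω ξ) (kernelDir x ξ t)
      rw [hΩ.norm_outerUnitNormal hξ, one_mul] at h1
      have h2 : ‖H (ξ, t) * ‖kernelDir x ξ t‖‖ ≤ M2 := hM2 _ h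
      rw [norm_mul, norm_norm, Real.norm_eq_abs] at h2
      simp only [hFΓ, abs_mul]
      exact (mul_le_mul_of_nonneg_left h1 (abs_nonneg _)).trans h2
    · simp [hFΓ, hH, (hφ1 ξ h).1]
  have hswΩ := setIntegral_betaWeight_swap hα (μ := volume) (S := Ω) (F := FΩ)
    (M := max M1 0) hΩ.isOpen.measurableSet hΩ.isBounded.measure_lt_top ?_ ?_
  rotate_left
  · exact hFΩc.mono fun z hz => hmemT z.1 (hΩ.subset_halfSpace hz.1) z.2 hz.2
  · rintro ⟨ξ, t⟩ ⟨hξ, ht⟩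
    rcases hclC ξ (subset_closure hξ) t ht with h | h
    · exact (hM1 _ h).trans (le_max_left _ _)
    · simp [hFΩ, (hφ1 ξ h).1, (hφ1 ξ h).2]
  have hleft : ∀ ξ ∈ lateralBoundary Ω, φ ξ * (ξ 0 ^ (2 * α) *
        ⟪kernelField α x ξ, outerUnitNormal Ω ξ⟫_ℝ) =
      ∫ t in Ioo (0 : ℝ) 1, betaWeight α t * FΓ (ξ, t) := by
    intro ξ hξ
    by_cases h : ξ 0 < δ ∨ ‖ξ - x‖ < ρ
    · simp [hFΓ, hH, (hφ1 ξ h).1]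
    · push Not at h
      have hne : ξ ≠ x := by
        rintro rfl
        have := h.2
        rw [sub_self, norm_zero] at this
        linarith
      have h1 := integral_betaWeight_mul_linear hα hx (le_of_lt hξ.2) hne
        (innerSL ℝ (outerUnitNormal Ω ξ))
      simp only [innerSL_apply_apply] at h1
      rw [real_inner_comm, ← h1, ← mul_assoc, ← integral_const_mul]
      congr 1
      funext t
      simp only [hFΓ, hH]
      ring
  have hright : ∀ ξ ∈ Ω, ξ 0 ^ (2 * α) * fderiv ℝ φ ξ (kernelField α x ξ) =
      ∫ t in Ioo (0 : ℝ) 1, betaWeight α t * FΩ (ξ, t) := by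
    intro ξ hξ
    have hξ0 : 0 < ξ 0 := hΩ.subset_halfSpace hξ
    by_cases h : ξ 0 < δ ∨ ‖ξ - x‖ < ρ
    · simp [hFΩ, (hφ1 ξ h).1, (hφ1 ξ h).2]
    · push Not at h
      have hne : ξ ≠ x := by
        rintro rfl
        have := h.2
        rw [sub_self, norm_zero] at this
        linarith
      have hsl : ∀ t ∈ Icc (0 : ℝ) 1, (ξ, t) ∈ C := fun t ht =>
        ⟨⟨subset_closure hξ, h.1, h.2⟩, ht⟩
      have hcs : ContinuousOn (fun t : ℝ => (ξ, t)) (Icc 0 1) := by fun_prop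
      have hi : ∀ G : EuclideanSpace ℝ (Fin m) × ℝ → ℝ, ContinuousOn G T →
          IntegrableOn (fun t => betaWeight α t * G (ξ, t)) (Ioo 0 1) := by
        intro G hG
        obtain ⟨M, hM⟩ := hCc.exists_bound_of_continuousOn (hG.mono hCT)
        refine integrableOn_betaWeight_mul hα (M := M) ?_ fun t ht =>
          hM _ (hsl t (Ioo_subset_Icc_self ht))
        exact (hG.comp hcs fun t ht => hCT (hsl t ht)).mono Ioo_subset_Icc_self
      rw [← integral_betaWeight_mul_linear hα hx hξ0.le hne (fderiv ℝ φ ξ)]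
      have e : ∀ t, betaWeight α t * FΩ (ξ, t) = ξ 0 ^ (2 * α) * (betaWeight α t *
          (kernelDen x ξ t ^ (-A) * fderiv ℝ φ ξ (kernelDir x ξ t))) +
          φ ξ * ξ 0 ^ (2 * α) * (betaWeight α t * kernelDiv α x ξ t) := by
        intro t; simp only [hFΩ]; ring
      simp_rw [e]
      have hi1 : IntegrableOn (fun t => betaWeight α t *
          (kernelDen x ξ t ^ (-A) * fderiv ℝ φ ξ (kernelDir x ξ t))) (Ioo 0 1) :=
        hi _ ((hDc _).mul hdφ.continuousOn)
      have hi2 : IntegrableOn (fun t => betaWeight α t * kernelDiv α x ξ t) (Ioo 0 1) :=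
        hi _ hdivc
      -- The divergence of the field itself disappears after integration in t; only the term with ∇φ
      -- is left.
      rw [integral_add (hi1.const_mul _) (hi2.const_mul _), integral_const_mul, integral_const_mul,
        integral_betaWeight_mul_kernelDiv hα hx hξ0 hne, mul_zero, add_zero]
  rw [setIntegral_congr_fun measurableSet_lateralBoundary hleft,
    setIntegral_congr_fun hΩ.isOpen.measurableSet hright, hswΓ, hswΩ]
  exact setIntegral_congr_fun measurableSet_Ioo fun t ht => by simp only [hstep t ht]

end Green


/-! ### Asymptotics of the kernel at its singularity -/

section Asymptotics

theorem hasDerivAt_mul_div_one_add_mul {ρ u : ℝ} (h : 1 + ρ * u ≠ 0) :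
    HasDerivAt (fun u : ℝ => ρ * u / (1 + ρ * u)) (ρ / (1 + ρ * u) ^ 2) u := by
  have h1 : HasDerivAt (fun u : ℝ => ρ * u) ρ u := by
    simpa using (hasDerivAt_id u).const_mul ρ
  refine (h1.div (h1.const_add 1) h).congr_deriv ?_
  field_simp
  ring

theorem injOn_mul_div_one_add_mul {ρ : ℝ} (hρ : 0 < ρ) :
    InjOn (fun u : ℝ => ρ * u / (1 + ρ * u)) (Ioi 0) := by
  intro u hu v hv h
  have hu' : 0 < 1 + ρ * u := by have : 0 < u := hu; positivity
  have hv' : 0 < 1 + ρ * v := by have : 0 < v := hv; positivity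
  simp only at h
  rw [div_eq_div_iff hu'.ne' hv'.ne'] at h
  have : ρ * (u - v) = 0 := by linarith
  rcases mul_eq_zero.1 this with h0 | h0
  · exact absurd h0 hρ.ne'
  · linarith

theorem image_mul_div_one_add_mul {ρ : ℝ} (hρ : 0 < ρ) :
    (fun u : ℝ => ρ * u / (1 + ρ * u)) '' Ioi 0 = Ioo 0 1 := by
  ext t
  constructor
  · rintro ⟨u, hu, rfl⟩
    have hu' : 0 < u := hu
    exact ⟨by positivity, by rw [div_lt_one (by positivity)]; linarith⟩
  · rintro ⟨h0, h1⟩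
    have : 0 < 1 - t := by linarith
    refine ⟨t / (ρ * (1 - t)), by rw [mem_Ioi]; positivity, ?_⟩
    simp only
    field_simp
    ring

/-- The substitution t = ρu/(1 + ρu) stretches the layer t ~ ρ, where Euler's integral concentrates,
to unit scale. -/
theorem integral_Ioo_eq_integral_Ioi {ρ : ℝ} (hρ : 0 < ρ) (g : ℝ → ℝ) :
    ∫ t in Ioo (0 : ℝ) 1, g t =
      ∫ u in Ioi (0 : ℝ), ρ / (1 + ρ * u) ^ 2 * g (ρ * u / (1 + ρ * u)) := by
  have hpos : ∀ u ∈ Ioi (0 : ℝ), 0 < 1 + ρ * u := fun u hu => by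
    have : 0 < u := hu
    positivity
  rw [← image_mul_div_one_add_mul hρ, integral_image_eq_integral_abs_deriv_smul measurableSet_Ioi
    (fun u hu => (hasDerivAt_mul_div_one_add_mul (hpos u hu).ne').hasDerivWithinAt)
    (injOn_mul_div_one_add_mul hρ)]
  refine setIntegral_congr_fun measurableSet_Ioi fun u hu => ?_
  have := hpos u hu
  simp only [smul_eq_mul]
  rw [abs_of_pos (by positivity)]

theorem integrableOn_Ioo_iff_integrableOn_Ioi {ρ : ℝ} (hρ : 0 < ρ) (g : ℝ → ℝ) :
    IntegrableOn g (Ioo 0 1) ↔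
      IntegrableOn (fun u => ρ / (1 + ρ * u) ^ 2 * g (ρ * u / (1 + ρ * u))) (Ioi 0) := by
  have hpos : ∀ u ∈ Ioi (0 : ℝ), 0 < 1 + ρ * u := fun u hu => by
    have : 0 < u := hu
    positivity
  rw [← image_mul_div_one_add_mul hρ, integrableOn_image_iff_integrableOn_abs_deriv_smul
    measurableSet_Ioi
    (fun u hu => (hasDerivAt_mul_div_one_add_mul (hpos u hu).ne').hasDerivWithinAt)
    (injOn_mul_div_one_add_mul hρ)]
  refine integrableOn_congr_fun (fun u hu => ?_) measurableSet_Ioi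
  have := hpos u hu
  simp only [smul_eq_mul]
  rw [abs_of_pos (by positivity)]

theorem beta_integrand_subst (α β : ℝ) {ρ u : ℝ} (hρ : 0 < ρ) (hu : 0 < u) :
    ρ / (1 + ρ * u) ^ 2 * ((ρ * u / (1 + ρ * u)) ^ (β - 1) *
        (1 - ρ * u / (1 + ρ * u)) ^ (α - 1)) =
      ρ ^ β * (u ^ (β - 1) * (1 + ρ * u) ^ (-(α + β))) := by
  have h : 0 < 1 + ρ * u := by positivity
  have e1 : 1 - ρ * u / (1 + ρ * u) = (1 + ρ * u)⁻¹ := by field_simp; ring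
  rw [e1, Real.div_rpow (by positivity) h.le, Real.mul_rpow hρ.le hu.le, Real.inv_rpow h.le,
    ← Real.rpow_natCast (1 + ρ * u) 2]
  have e2 : (1 + ρ * u) ^ (-(α + β)) = ((1 + ρ * u) ^ ((2 : ℕ) : ℝ))⁻¹ *
      ((1 + ρ * u) ^ (β - 1))⁻¹ * ((1 + ρ * u) ^ (α - 1))⁻¹ := by
    rw [← Real.rpow_neg h.le, ← Real.rpow_neg h.le, ← Real.rpow_neg h.le, ← Real.rpow_add h,
      ← Real.rpow_add h]
    congr 1
    push_cast
    ring
  have e3 : ρ ^ β = ρ * ρ ^ (β - 1) := by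
    rw [Real.rpow_sub_one hρ.ne', mul_div_cancel₀ _ hρ.ne']
  rw [e2, e3]
  field_simp

/-- The same substitution with ρ = c turns the Beta integral B(β, γ - β) into this one. -/
theorem integral_rpow_mul_one_add_rpow {β γ c : ℝ} (hβ : 0 < β) (hγ : β < γ) (hc : 0 < c) :
    IntegrableOn (fun u : ℝ => u ^ (β - 1) * (1 + c * u) ^ (-γ)) (Ioi 0) ∧
      ∫ u in Ioi (0 : ℝ), u ^ (β - 1) * (1 + c * u) ^ (-γ) =
        c ^ (-β) * (Real.Gamma β * Real.Gamma (γ - β) / Real.Gamma γ) := by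
  have hb := gaussF_beta_integral hβ (sub_pos.2 hγ)
  rw [intervalIntegrable_iff_integrableOn_Ioo_of_le zero_le_one, integrableOn_Ioo_iff_integrableOn_Ioi hc,
    intervalIntegral.integral_of_le zero_le_one, integral_Ioc_eq_integral_Ioo,
    integral_Ioo_eq_integral_Ioi hc] at hb
  have e : ∀ u ∈ Ioi (0 : ℝ), c / (1 + c * u) ^ 2 * ((c * u / (1 + c * u)) ^ (β - 1) *
        (1 - c * u / (1 + c * u)) ^ (γ - β - 1)) =
      c ^ β * (u ^ (β - 1) * (1 + c * u) ^ (-γ)) := by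
    intro u hu
    rw [beta_integrand_subst (γ - β) β hc hu]
    ring_nf
  rw [integrableOn_congr_fun e measurableSet_Ioi, setIntegral_congr_fun measurableSet_Ioi e,
    integral_const_mul] at hb
  have hcβ : 0 < c ^ β := Real.rpow_pos_of_pos hc β
  constructor
  · have := hb.1.const_mul (c ^ β)⁻¹
    refine this.congr (Eventually.of_forall fun u => ?_)
    simp only
    rw [inv_mul_cancel_left₀ hcβ.ne']
  · rw [Real.rpow_neg hc.le]
    rw [show β + (γ - β) = γ by ring] at hb
    rw [← hb.2, inv_mul_cancel_left₀ hcβ.ne']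

/-- Under the substitution ρ + kt = ρ(1 + (ρ+k)u)/(1 + ρu), and the powers of ρ cancel since (A - β)
+ β - A = 0. The right side has a limit as ρ → 0. -/
theorem rescaled_euler_integral {α β A ρ k : ℝ} (hρ : 0 < ρ) (hk : 0 ≤ k) :
    ρ ^ (A - β) * ∫ t in Ioo (0 : ℝ) 1, t ^ (β - 1) * (1 - t) ^ (α - 1) * (ρ + k * t) ^ (-A) =
      ∫ u in Ioi (0 : ℝ), u ^ (β - 1) * (1 + ρ * u) ^ (A - α - β) * (1 + (ρ + k) * u) ^ (-A) := by
  rw [integral_Ioo_eq_integral_Ioi hρ, ← integral_const_mul]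
  refine setIntegral_congr_fun measurableSet_Ioi fun u hu => ?_
  have hu' : 0 < u := hu
  have h : 0 < 1 + ρ * u := by positivity
  have h2 : 0 < 1 + (ρ + k) * u := by positivity
  have e1 : ρ + k * (ρ * u / (1 + ρ * u)) = ρ * ((1 + (ρ + k) * u) / (1 + ρ * u)) := by
    field_simp
    ring
  rw [← mul_assoc (ρ / (1 + ρ * u) ^ 2), beta_integrand_subst α β hρ hu', e1,
    Real.mul_rpow hρ.le (by positivity), Real.div_rpow h2.le h.le]
  have e2 : ρ ^ (A - β) * ρ ^ β * ρ ^ (-A) = 1 := by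
    rw [← Real.rpow_add hρ, ← Real.rpow_add hρ]
    ring_nf
    simp
  have e3 : (1 + ρ * u) ^ (A - α - β) = (1 + ρ * u) ^ (-(α + β)) / (1 + ρ * u) ^ (-A) := by
    rw [← Real.rpow_sub h]
    ring_nf
  rw [e3]
  calc _ = (ρ ^ (A - β) * ρ ^ β * ρ ^ (-A)) * (u ^ (β - 1) * (1 + ρ * u) ^ (-(α + β)) *
        ((1 + (ρ + k) * u) ^ (-A) / (1 + ρ * u) ^ (-A))) := by ring
    _ = _ := by rw [e2]; ring

theorem tendsto_rescaled_euler_integral {α β A k₀ : ℝ} (hα : 0 < α) (hβ : 0 < β) (hβA : β < A)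
    (hk₀ : 0 < k₀) :
    Tendsto (fun z : ℝ × ℝ => z.1 ^ (A - β) *
      ∫ t in Ioo (0 : ℝ) 1, t ^ (β - 1) * (1 - t) ^ (α - 1) * (z.1 + z.2 * t) ^ (-A))
      (𝓝[>] 0 ×ˢ 𝓝 k₀) (𝓝 (∫ u in Ioi (0 : ℝ), u ^ (β - 1) * (1 + k₀ * u) ^ (-A))) := by
  have hA : 0 < A := hβ.trans hβA
  have hev1 : ∀ᶠ z : ℝ × ℝ in 𝓝[>] 0 ×ˢ 𝓝 k₀, 0 < z.1 :=
    tendsto_fst.eventually self_mem_nhdsWithin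
  have hev2 : ∀ᶠ z : ℝ × ℝ in 𝓝[>] 0 ×ˢ 𝓝 k₀, k₀ / 2 < z.2 :=
    tendsto_snd.eventually (lt_mem_nhds (half_lt_self hk₀))
  have hcongr : ∀ᶠ z : ℝ × ℝ in 𝓝[>] 0 ×ˢ 𝓝 k₀, ∫ u in Ioi (0 : ℝ),
      u ^ (β - 1) * (1 + z.1 * u) ^ (A - α - β) * (1 + (z.1 + z.2) * u) ^ (-A) =
      z.1 ^ (A - β) *
        ∫ t in Ioo (0 : ℝ) 1, t ^ (β - 1) * (1 - t) ^ (α - 1) * (z.1 + z.2 * t) ^ (-A) := by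
    filter_upwards [hev1, hev2] with z h1 h2
    exact (rescaled_euler_integral h1 (by linarith)).symm
  refine Tendsto.congr' hcongr ?_
  -- The factor (1 + ρu)^{A-α-β} may grow or decay in u. In either case it is at most (1 +
  -- (ρ+k)u)^{A-γ}, and β < γ keeps the resulting majorant integrable.
  set γ : ℝ := min A (α + β) with hγ
  have hγβ : β < γ := lt_min hβA (by linarith)
  refine tendsto_integral_filter_of_dominated_convergence
    (fun u => u ^ (β - 1) * (1 + k₀ / 2 * u) ^ (-γ)) ?_ ?_
    (integral_rpow_mul_one_add_rpow hβ hγβ (half_pos hk₀)).1 ?_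
  · filter_upwards [hev1, hev2] with z h1 h2
    refine ContinuousOn.aestronglyMeasurable ?_ measurableSet_Ioi
    refine ContinuousOn.mul (ContinuousOn.mul ?_ ?_) ?_
    · exact continuousOn_id.rpow_const fun u hu => Or.inl (ne_of_gt hu)
    · refine ContinuousOn.rpow_const (by fun_prop) fun u hu => Or.inl ?_
      have : 0 < u := hu
      positivity
    · refine ContinuousOn.rpow_const (by fun_prop) fun u hu => Or.inl ?_
      have : 0 < u := hu
      have : 0 < z.2 := by linarith
      positivity
  · filter_upwards [hev1, hev2] with z h1 h2
    refine (ae_restrict_iff' measurableSet_Ioi).2 (Eventually.of_forall fun u hu => ?_)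
    have hu' : 0 < u := hu
    have hz2 : 0 < z.2 := by linarith
    have p1 : 0 < 1 + z.1 * u := by positivity
    have p2 : 0 < 1 + (z.1 + z.2) * u := by positivity
    have p3 : 0 < 1 + k₀ / 2 * u := by positivity
    rw [Real.norm_of_nonneg (by positivity), mul_assoc]
    refine mul_le_mul_of_nonneg_left ?_ (by positivity)
    have hle : 1 + z.1 * u ≤ 1 + (z.1 + z.2) * u := by nlinarith
    have hle2 : 1 + k₀ / 2 * u ≤ 1 + (z.1 + z.2) * u := by nlinarith
    have q1 : (1 + z.1 * u) ^ (A - α - β) ≤ (1 + (z.1 + z.2) * u) ^ (A - γ) := by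
      calc (1 + z.1 * u) ^ (A - α - β) ≤ (1 + z.1 * u) ^ (A - γ) :=
            Real.rpow_le_rpow_of_exponent_le (by nlinarith) (by
              have := min_le_right A (α + β)
              rw [hγ]; linarith)
        _ ≤ _ := Real.rpow_le_rpow p1.le hle (by
              have := min_le_left A (α + β)
              rw [hγ]; linarith)
    calc (1 + z.1 * u) ^ (A - α - β) * (1 + (z.1 + z.2) * u) ^ (-A) ≤
          (1 + (z.1 + z.2) * u) ^ (A - γ) * (1 + (z.1 + z.2) * u) ^ (-A) :=
          mul_le_mul_of_nonneg_right q1 (by positivity)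
      _ = (1 + (z.1 + z.2) * u) ^ (-γ) := by rw [← Real.rpow_add p2]; ring_nf
      _ ≤ _ := Real.rpow_le_rpow_of_nonpos p3 hle2 (by linarith)
  · refine (ae_restrict_iff' measurableSet_Ioi).2 (Eventually.of_forall fun u hu => ?_)
    have hu' : 0 < u := hu
    have h1 : Tendsto (fun z : ℝ × ℝ => z.1) (𝓝[>] 0 ×ˢ 𝓝 k₀) (𝓝 0) :=
      (tendsto_nhds_of_tendsto_nhdsWithin tendsto_fst)
    have h2 : Tendsto (fun z : ℝ × ℝ => z.2) (𝓝[>] 0 ×ˢ 𝓝 k₀) (𝓝 k₀) := tendsto_snd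
    have h3 : Tendsto (fun z : ℝ × ℝ => (1 + z.1 * u) ^ (A - α - β)) (𝓝[>] 0 ×ˢ 𝓝 k₀) (𝓝 1) := by
      have := ((h1.mul_const u).const_add 1).rpow_const (p := A - α - β) (Or.inl (by simp))
      simpa using this
    have h4 : Tendsto (fun z : ℝ × ℝ => (1 + (z.1 + z.2) * u) ^ (-A)) (𝓝[>] 0 ×ˢ 𝓝 k₀)
        (𝓝 ((1 + k₀ * u) ^ (-A))) := by
      have := (((h1.add h2).mul_const u).const_add 1).rpow_const (p := -A)
        (Or.inl (by rw [zero_add]; positivity))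
      simpa using this
    simpa using (h3.const_mul (u ^ (β - 1))).mul h4

/-! ### Growth of the kernel moments at the pole. -/

variable {m : ℕ} [NeZero m] {α : ℝ}

theorem kernelMoment_eq (j : ℕ) (x ξ : EuclideanSpace ℝ (Fin m)) :
    kernelMoment α j x ξ = ∫ t in Ioo (0 : ℝ) 1, t ^ (α + j - 1) * (1 - t) ^ (α - 1) *
      (‖ξ - x‖ ^ 2 + 4 * x 0 * ξ 0 * t) ^ (-(α + (m : ℝ) / 2)) := by
  refine setIntegral_congr_fun measurableSet_Ioo fun t ht => ?_
  have e : t ^ (α + j - 1) = t ^ (α - 1) * t ^ j := by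
    rw [← Real.rpow_natCast, ← Real.rpow_add ht.1]
    ring_nf
  have e2 : kernelDen x ξ t = ‖ξ - x‖ ^ 2 + 4 * x 0 * ξ 0 * t := by rw [kernelDen]; ring
  simp only [betaWeight]
  rw [e, e2]
  ring

/-- The rescaled Euler integral with ρ = r², β = α + j and A = α + m/2: the power ρ^{A-β} is
r^{m-2j}, and 2j < m says β < A. -/
theorem tendsto_kernelMoment (hα : 0 < α) {j : ℕ} (hj : 2 * j < m) {x : EuclideanSpace ℝ (Fin m)}
    (hx : 0 < x 0) :
    Tendsto (fun ξ => ‖ξ - x‖ ^ (m - 2 * j) * kernelMoment α j x ξ) (𝓝[≠] x)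
      (𝓝 (∫ u in Ioi (0 : ℝ), u ^ (α + j - 1) * (1 + 4 * x 0 * x 0 * u) ^ (-(α + (m : ℝ) / 2)))) := by
  have hj' : 2 * (j : ℝ) < m := by exact_mod_cast hj
  have h := tendsto_rescaled_euler_integral (α := α) (β := α + j) (A := α + (m : ℝ) / 2)
    (k₀ := 4 * x 0 * x 0) hα (by positivity) (by linarith) (by positivity)
  have ht : Tendsto (fun ξ : EuclideanSpace ℝ (Fin m) => (‖ξ - x‖ ^ 2, 4 * x 0 * ξ 0)) (𝓝[≠] x)
      (𝓝[>] 0 ×ˢ 𝓝 (4 * x 0 * x 0)) := by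
    refine Tendsto.prodMk (tendsto_nhdsWithin_iff.2 ⟨?_, ?_⟩) ?_
    · have : Continuous fun ξ : EuclideanSpace ℝ (Fin m) => ‖ξ - x‖ ^ 2 := by fun_prop
      simpa using (this.tendsto x).mono_left (nhdsWithin_le_nhds (s := {x}ᶜ))
    · filter_upwards [self_mem_nhdsWithin] with ξ hξ
      exact pow_pos (norm_pos_iff.2 (sub_ne_zero.2 hξ)) 2
    · have : Continuous fun ξ : EuclideanSpace ℝ (Fin m) => 4 * x 0 * ξ 0 := by fun_prop
      exact (this.tendsto x).mono_left nhdsWithin_le_nhds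
  refine (h.comp ht).congr fun ξ => ?_
  simp only [Function.comp]
  rw [kernelMoment_eq]
  congr 1
  rw [← Real.rpow_natCast, ← Real.rpow_mul (norm_nonneg _), ← Real.rpow_natCast]
  congr 1
  rw [Nat.cast_sub hj.le]
  push_cast
  ring

end Asymptotics


/-! ### Absolute convergence of the double-layer potential -/

section Integrability

variable {m : ℕ} [NeZero m] {α : ℝ}

theorem measurable_kernelMoment (α : ℝ) (j : ℕ) (x : EuclideanSpace ℝ (Fin m)) :
    Measurable (kernelMoment α j x) := by
  have hm : Measurable fun z : EuclideanSpace ℝ (Fin m) × ℝ =>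
      betaWeight α z.2 * (z.2 ^ j * kernelDen x z.1 z.2 ^ (-(α + (m : ℝ) / 2))) := by
    have h1 := (continuous_kernelDen x).measurable
    unfold betaWeight
    fun_prop
  exact (hm.stronglyMeasurable.integral_prod_right' (ν := volume.restrict (Ioo (0 : ℝ) 1))).measurable

theorem measurable_kernelField (α : ℝ) (x : EuclideanSpace ℝ (Fin m)) :
    Measurable (kernelField α x) := by
  have h0 := measurable_kernelMoment α 0 x
  have h1 := measurable_kernelMoment α 1 x
  unfold kernelField
  fun_prop

theorem kernelMoment_nonneg (j : ℕ) {x ξ : EuclideanSpace ℝ (Fin m)} (hx : 0 ≤ x 0) (hξ : 0 ≤ ξ 0) :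
    0 ≤ kernelMoment α j x ξ := by
  refine setIntegral_nonneg measurableSet_Ioo fun t ht => ?_
  have h1 := betaWeight_nonneg (α := α) ht
  have h2 := ht.1
  have h3 : 0 ≤ kernelDen x ξ t := (sq_nonneg _).trans (norm_sq_le_kernelDen hx hξ ht.1.le)
  positivity

theorem kernelMoment_le (hα : 0 < α) (j : ℕ) {x ξ : EuclideanSpace ℝ (Fin m)} (hx : 0 ≤ x 0)
    (hξ : 0 ≤ ξ 0) {c : ℝ} (hc : 0 < c) (hcξ : c ≤ ‖ξ - x‖) :
    kernelMoment α j x ξ ≤ (c ^ 2) ^ (-(α + (m : ℝ) / 2)) * ∫ t in Ioo (0 : ℝ) 1, betaWeight α t := by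
  have hne : ξ ≠ x := by
    rintro rfl
    rw [sub_self, norm_zero] at hcξ
    linarith
  rw [← integral_const_mul]
  refine setIntegral_mono_on (integrableOn_kernelMoment hα j hx hξ hne)
    ((integrableOn_betaWeight hα).const_mul _) measurableSet_Ioo fun t ht => ?_
  have h1 := betaWeight_nonneg (α := α) ht
  have hD := kernelDen_pos hx hξ hne ht.1.le
  rw [mul_comm]
  refine mul_le_mul_of_nonneg_right ?_ h1
  calc t ^ j * kernelDen x ξ t ^ (-(α + (m : ℝ) / 2))
      ≤ 1 * kernelDen x ξ t ^ (-(α + (m : ℝ) / 2)) :=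
        mul_le_mul_of_nonneg_right (pow_le_one₀ ht.1.le ht.2.le) (Real.rpow_nonneg hD.le _)
    _ ≤ _ := by
        rw [one_mul]
        refine Real.rpow_le_rpow_of_nonpos (by positivity) ?_ ?_
        · exact (pow_le_pow_left₀ hc.le hcξ 2).trans (norm_sq_le_kernelDen hx hξ ht.1.le)
        · have : (0 : ℝ) ≤ m := Nat.cast_nonneg _
          linarith

/-- Away from the pole the kernel is bounded. -/
theorem exists_norm_kernelField_le (hα : 0 < α) {x : EuclideanSpace ℝ (Fin m)} (hx : 0 ≤ x 0)
    {c : ℝ} (hc : 0 < c) {S : Set (EuclideanSpace ℝ (Fin m))} (hS : Bornology.IsBounded S)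
    (hS0 : ∀ ξ ∈ S, 0 ≤ ξ 0) :
    ∃ M, 0 ≤ M ∧ ∀ ξ ∈ S, c ≤ ‖ξ - x‖ → ‖kernelField α x ξ‖ ≤ M := by
  obtain ⟨R, hR⟩ := hS.exists_norm_le
  set B : ℝ := (c ^ 2) ^ (-(α + (m : ℝ) / 2)) * ∫ t in Ioo (0 : ℝ) 1, betaWeight α t with hB
  refine ⟨max (B * (R + ‖x‖) + 2 * x 0 * B) 0, le_max_right _ _, fun ξ hξ hcξ =>
    le_max_of_le_left ?_⟩
  have h0 := kernelMoment_le hα 0 hx (hS0 ξ hξ) hc hcξ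
  have h1 := kernelMoment_le hα 1 hx (hS0 ξ hξ) hc hcξ
  have p0 := kernelMoment_nonneg (α := α) 0 hx (hS0 ξ hξ)
  have p1 := kernelMoment_nonneg (α := α) 1 hx (hS0 ξ hξ)
  rw [← hB] at h0 h1
  have hr : ‖ξ - x‖ ≤ R + ‖x‖ := (norm_sub_le _ _).trans (by linarith [hR ξ hξ])
  rw [kernelField]
  refine (norm_add_le _ _).trans ?_
  rw [norm_smul, norm_smul, Real.norm_of_nonneg p0, Real.norm_of_nonneg (by positivity)]
  have hs : ‖(EuclideanSpace.single 0 1 : EuclideanSpace ℝ (Fin m))‖ = 1 := by simp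
  rw [hs, mul_one]
  refine add_le_add (mul_le_mul h0 hr (norm_nonneg _) (p0.trans h0)) ?_
  exact mul_le_mul_of_nonneg_left h1 (by positivity)

variable {Ω : Set (EuclideanSpace ℝ (Fin m))}

namespace IsLyapunovDomain

theorem isBounded_lateralBoundary (hΩ : IsLyapunovDomain Ω) :
    Bornology.IsBounded (lateralBoundary Ω) :=
  hΩ.isBounded.closure.subset fun _ hx => frontier_subset_closure hx.1

theorem aestronglyMeasurable_flux (hΩ : IsLyapunovDomain Ω) (α : ℝ)
    (x : EuclideanSpace ℝ (Fin m)) :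
    AEStronglyMeasurable (fun ξ => ξ 0 ^ (2 * α) * ⟪kernelField α x ξ, outerUnitNormal Ω ξ⟫_ℝ)
      (μHE[m - 1].restrict (lateralBoundary Ω)) := by
  have h1 : AEStronglyMeasurable (outerUnitNormal Ω) (μHE[m - 1].restrict (lateralBoundary Ω)) :=
    hΩ.continuousOn_outerUnitNormal.aestronglyMeasurable measurableSet_lateralBoundary
  have h2 : Measurable fun ξ : EuclideanSpace ℝ (Fin m) => ξ 0 ^ (2 * α) := by fun_prop
  exact h2.aestronglyMeasurable.mul
    ((measurable_kernelField α x).aestronglyMeasurable.inner h1)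

theorem integrableOn_flux_far (hΩ : IsLyapunovDomain Ω) (hα : 0 < α)
    {x : EuclideanSpace ℝ (Fin m)} (hx : 0 ≤ x 0) {c : ℝ} (hc : 0 < c) :
    IntegrableOn (fun ξ => ξ 0 ^ (2 * α) * ⟪kernelField α x ξ, outerUnitNormal Ω ξ⟫_ℝ)
      (lateralBoundary Ω \ Metric.ball x c) μHE[m - 1] := by
  obtain ⟨R, hR⟩ := hΩ.isBounded_lateralBoundary.exists_norm_le
  obtain ⟨M, hM0, hM⟩ := exists_norm_kernelField_le hα hx hc hΩ.isBounded_lateralBoundary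
    fun ξ hξ => le_of_lt hξ.2
  refine IntegrableOn.of_bound ((measure_mono sdiff_subset).trans_lt hΩ.measure_lateralBoundary_lt_top)
    ((hΩ.aestronglyMeasurable_flux α x).mono_measure (Measure.restrict_mono sdiff_subset le_rfl))
    (R ^ (2 * α) * M) ?_
  refine (ae_restrict_iff' (measurableSet_lateralBoundary.diff measurableSet_ball)).2
    (Eventually.of_forall fun ξ hξ => ?_)
  have h1 : c ≤ ‖ξ - x‖ := by
    have := hξ.2
    rwa [Metric.mem_ball, dist_eq_norm, not_lt] at this
  have hξ0 : 0 < ξ 0 := hξ.1.2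
  have h2 : ξ 0 ≤ R := (le_abs_self _).trans ((PiLp.norm_apply_le ξ 0).trans (hR ξ hξ.1))
  have h3 := abs_real_inner_le_norm (kernelField α x ξ) (outerUnitNormal Ω ξ)
  rw [hΩ.norm_outerUnitNormal hξ.1, mul_one] at h3
  rw [norm_mul, Real.norm_of_nonneg (by positivity), Real.norm_eq_abs]
  exact mul_le_mul (Real.rpow_le_rpow hξ0.le h2 (by positivity)) (h3.trans (hM ξ hξ.1 h1))
    (abs_nonneg _) (Real.rpow_nonneg (hξ0.le.trans h2) _)

/-- On a Lyapunov surface the chord from a fixed point is almost tangent. -/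
theorem exists_abs_inner_sub_normal_le (hΩ : IsLyapunovDomain Ω) {x : EuclideanSpace ℝ (Fin m)}
    (hx : x ∈ lateralBoundary Ω) :
    ∃ ε C lam : ℝ, 0 < ε ∧ 0 ≤ C ∧ 0 < lam ∧ ∀ ξ ∈ lateralBoundary Ω, ‖ξ - x‖ < ε →
      |⟪ξ - x, outerUnitNormal Ω ξ⟫_ℝ| ≤ C * ‖ξ - x‖ ^ (1 + lam) := by
  obtain ⟨n, d, f, hch, hf0, hf1⟩ := hΩ.exists_isGraphChart (subset_closure hx)
  obtain ⟨a, lam, ha, hlam, hn⟩ := hΩ.exists_norm_outerUnitNormal_sub_le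
  set G := graphMap x n f with hG
  have hGc : Continuous G := continuous_graphMap hch.contDiff
  have hG0 : G 0 = x := by simp [hG, graphMap, hf0]
  have hB : G ⁻¹' (Metric.ball x d ∩ {x | 0 < x 0}) ∈ 𝓝 0 := by
    refine hGc.continuousAt.preimage_mem_nhds ?_
    rw [hG0]
    exact (Metric.isOpen_ball.inter isOpen_halfSpace).mem_nhds ⟨Metric.mem_ball_self hch.pos, hx.2⟩
  have hN0 : graphNormal n f 0 = n := by simp [graphNormal, hf1]
  have hN : {z | ‖graphNormal n f z‖ < 2} ∈ 𝓝 0 := by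
    refine (isOpen_lt (continuous_graphNormal hch.contDiff).norm continuous_const).mem_nhds ?_
    show ‖graphNormal n f 0‖ < 2
    rw [hN0, hch.norm_eq]
    norm_num
  have hfo : {z | |f z| ≤ ‖z‖} ∈ 𝓝 0 := by
    have h1 := (hch.contDiff.differentiable one_ne_zero 0).hasFDerivAt.isLittleO.def one_pos
    filter_upwards [h1] with z hz
    simpa [hf0, hf1] using hz
  obtain ⟨ε₀, hε₀, hball⟩ := Metric.mem_nhds_iff.1 (inter_mem hB (inter_mem hN hfo))
  have hnx : outerUnitNormal Ω x = n := by
    have h1 : (0 : (ℝ ∙ n)ᗮ) ∈ G ⁻¹' (Metric.ball x d ∩ {x | 0 < x 0}) := mem_of_mem_nhds hB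
    have := hch.outerUnitNormal_graphMap h1.1 h1.2
    rwa [← hG, hG0, hN0, hch.norm_eq, inv_one, one_smul] at this
  -- The factor 2 bounds ‖graphNormal‖, and 2 ^ lam comes from ‖G z - x‖ ≤ 2‖z‖.
  set K : ℝ := 2 * a * 2 ^ lam with hK
  have hKpos : 0 < K := by positivity
  have hmemΓ : ∀ z ∈ Metric.ball (0 : (ℝ ∙ n)ᗮ) ε₀, G z ∈ lateralBoundary Ω := fun z hz =>
    (hch.mem_lateralBoundary_iff hΩ.isOpen (hball hz).1.1 (hball hz).1.2).2
      (graphHeight_graphMap hch.norm_eq z)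
  -- The tangential part of n_z - n is -∇f(z)/‖graphNormal‖, so Hölder continuity of the normal
  -- passes to ∇f, which vanishes at 0.
  have hdf : ∀ z ∈ Metric.ball (0 : (ℝ ∙ n)ᗮ) ε₀, ‖fderiv ℝ f z‖ ≤ K * ‖z‖ ^ lam := by
    intro z hz
    have hzB := hball hz
    have hNz := hch.outerUnitNormal_graphMap hzB.1.1 hzB.1.2
    have hNpos := norm_graphNormal_pos (f := f) hch.norm_eq z
    have h1 := hn (G z) (hmemΓ z hz) x hx
    rw [hnx, hG, hNz, ← hG] at h1
    have h2 : ‖G z - x‖ ≤ 2 * ‖z‖ := by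
      have e : G z - x = (z : EuclideanSpace ℝ (Fin m)) + f z • n := by
        simp only [hG, graphMap]; abel
      rw [e]
      refine (norm_add_le _ _).trans ?_
      have h3 : |f z| ≤ ‖z‖ := hzB.2.2
      rw [norm_smul, hch.norm_eq, mul_one, Real.norm_eq_abs, Submodule.coe_norm]
      rw [Submodule.coe_norm] at h3
      linarith
    have h4 : ‖G z - x‖ ^ lam ≤ 2 ^ lam * ‖z‖ ^ lam := by
      rw [← Real.mul_rpow zero_le_two (norm_nonneg _)]
      exact Real.rpow_le_rpow (norm_nonneg _) h2 hlam.le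
    refine ContinuousLinearMap.opNorm_le_bound _ (by positivity) fun u => ?_
    have h5 : fderiv ℝ f z u = -(‖graphNormal n f z‖ *
        ⟪‖graphNormal n f z‖⁻¹ • graphNormal n f z - n, (u : EuclideanSpace ℝ (Fin m))⟫_ℝ) := by
      rw [inner_sub_left, inner_smul_left, conj_trivial, inner_graphNormal, inner_orthogonal_span,
        Submodule.orthogonalProjectionOnto_mem_subspace_eq_self]
      field_simp
      ring
    rw [h5, norm_neg, norm_mul, norm_norm, Real.norm_eq_abs]
    have h6 := abs_real_inner_le_norm (‖graphNormal n f z‖⁻¹ • graphNormal n f z - n)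
      (u : EuclideanSpace ℝ (Fin m))
    rw [← Submodule.coe_norm] at h6
    have h7 : ‖graphNormal n f z‖ ≤ 2 := le_of_lt hzB.2.1
    calc ‖graphNormal n f z‖ * |⟪‖graphNormal n f z‖⁻¹ • graphNormal n f z - n,
          (u : EuclideanSpace ℝ (Fin m))⟫_ℝ| ≤ 2 * (a * (2 ^ lam * ‖z‖ ^ lam) * ‖u‖) := by
          refine mul_le_mul h7 (h6.trans ?_) (abs_nonneg _) zero_le_two
          refine mul_le_mul_of_nonneg_right (h1.trans ?_) (norm_nonneg _)
          exact mul_le_mul_of_nonneg_left h4 ha.le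
      _ = K * ‖z‖ ^ lam * ‖u‖ := by rw [hK]; ring
  refine ⟨min d ε₀, 2 * K, lam, lt_min hch.pos hε₀, by positivity, hlam, fun ξ hξ hξε => ?_⟩
  have hξb : ξ ∈ Metric.ball x d := by
    rw [Metric.mem_ball, dist_eq_norm]; exact hξε.trans_le (min_le_left _ _)
  have hξeq := (graphHeight_eq_zero_iff hch.norm_eq ξ).1
    ((hch.mem_lateralBoundary_iff hΩ.isOpen hξb hξ.2).1 hξ)
  set y := (ℝ ∙ n)ᗮ.orthogonalProjectionOnto (ξ - x) with hy
  have hyle : ‖y‖ ≤ ‖ξ - x‖ := Submodule.norm_orthogonalProjectionOnto_apply_le _ _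
  have hyb : y ∈ Metric.ball (0 : (ℝ ∙ n)ᗮ) ε₀ := by
    rw [mem_ball_zero_iff]
    exact hyle.trans_lt (hξε.trans_le (min_le_right _ _))
  have hNy := hch.outerUnitNormal_graphMap (hball hyb).1.1 (hball hyb).1.2
  rw [hξeq] at hNy
  have hN1 : 1 ≤ ‖graphNormal n f y‖ := by
    have := norm_graphNormal_sq (f := f) hch.norm_eq y
    nlinarith [sq_nonneg ‖fderiv ℝ f y‖, norm_nonneg (graphNormal n f y)]
  -- For a chord from the centre of the chart the normal component is f(y) - f'(y)y. Both terms are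
  -- at most K‖y‖^{1+λ}, whence the constant 2K.
  have hinner : ⟪ξ - x, graphNormal n f y⟫_ℝ = f y - fderiv ℝ f y y := by
    rw [real_inner_comm, inner_graphNormal, ← hy]
    congr 1
    have h0 := (hch.mem_lateralBoundary_iff hΩ.isOpen hξb hξ.2).1 hξ
    rw [graphHeight, ← hy] at h0
    linarith
  have hfy : |f y| ≤ K * ‖y‖ ^ lam * ‖y‖ := by
    have hb : ∀ z ∈ Metric.closedBall (0 : (ℝ ∙ n)ᗮ) ‖y‖, ‖fderiv ℝ f z‖ ≤ K * ‖y‖ ^ lam := by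
      intro z hz
      rw [mem_closedBall_zero_iff] at hz
      refine (hdf z ?_).trans ?_
      · rw [mem_ball_zero_iff] at hyb ⊢
        exact hz.trans_lt hyb
      · exact mul_le_mul_of_nonneg_left (Real.rpow_le_rpow (norm_nonneg _) hz hlam.le) hKpos.le
    have := (convex_closedBall (0 : (ℝ ∙ n)ᗮ) ‖y‖).norm_image_sub_le_of_norm_fderiv_le (𝕜 := ℝ)
      (f := f) (fun z _ => hch.contDiff.differentiable one_ne_zero z) hb
      (mem_closedBall_zero_iff.2 (by simp : ‖(0 : (ℝ ∙ n)ᗮ)‖ ≤ ‖y‖))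
      (mem_closedBall_zero_iff.2 le_rfl)
    simpa [hf0] using this
  have hdy : |fderiv ℝ f y y| ≤ K * ‖y‖ ^ lam * ‖y‖ :=
    ((fderiv ℝ f y).le_opNorm y).trans (mul_le_mul_of_nonneg_right (hdf y hyb) (norm_nonneg _))
  rw [hNy, inner_smul_right, hinner, abs_mul, abs_of_nonneg (by positivity)]
  have hpow : ‖ξ - x‖ ^ (1 + lam) = ‖ξ - x‖ ^ lam * ‖ξ - x‖ := by
    rw [Real.rpow_add_of_nonneg (norm_nonneg _) zero_le_one hlam.le, Real.rpow_one, mul_comm]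
  calc ‖graphNormal n f y‖⁻¹ * |f y - fderiv ℝ f y y| ≤ 1 * (2 * (K * ‖y‖ ^ lam * ‖y‖)) := by
        refine mul_le_mul (inv_le_one_of_one_le₀ hN1) ?_ (abs_nonneg _) zero_le_one
        exact (abs_sub _ _).trans (by linarith)
    _ ≤ 2 * K * ‖ξ - x‖ ^ (1 + lam) := by
        rw [hpow]
        have : ‖y‖ ^ lam * ‖y‖ ≤ ‖ξ - x‖ ^ lam * ‖ξ - x‖ :=
          mul_le_mul (Real.rpow_le_rpow (norm_nonneg _) hyle hlam.le) hyle (norm_nonneg _)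
            (by positivity)
        nlinarith

end IsLyapunovDomain

end Integrability


/-! ### The direct value of the potential on the surface -/

section DirectValue

variable {m : ℕ} [NeZero m] {α : ℝ} {Ω : Set (EuclideanSpace ℝ (Fin m))}

theorem euclideanHausdorffMeasure_singleton {X : Type*} [MetricSpace X] [MeasurableSpace X]
    [BorelSpace X] {d : ℕ} (hd : 0 < d) (x : X) : μHE[d] {x} = 0 := by
  have := Measure.nullSingletonClass_hausdorff X (d := (d : ℝ)) (by exact_mod_cast hd)
  rw [Measure.euclideanHausdorffMeasure_def, Measure.smul_apply, measure_singleton, smul_zero]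

namespace IsGraphChart

variable {p n : EuclideanSpace ℝ (Fin m)} {d : ℝ} {f : (ℝ ∙ n)ᗮ → ℝ}

/-- A weak singularity at the centre of a chart is integrable over the surface. -/
theorem integrableOn_norm_sub_rpow (h : IsGraphChart Ω p n d f) (hΩo : IsOpen Ω) (hm : 1 < m)
    {s : ℝ} (hs : -((m : ℝ) - 1) < s) (hs0 : s ≤ 0) :
    IntegrableOn (fun ξ => ‖ξ - p‖ ^ s) (lateralBoundary Ω ∩ Metric.ball p d) μHE[m - 1] := by
  set A := graphMap p n f ⁻¹' (Metric.ball p d ∩ {x | 0 < x 0}) with hA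
  have hGc : Continuous (graphMap p n f) := continuous_graphMap h.contDiff
  have hAm : MeasurableSet A :=
    hGc.measurable (Metric.isOpen_ball.inter isOpen_halfSpace).measurableSet
  have hyle : ∀ y, ‖y‖ ≤ ‖graphMap p n f y - p‖ := fun y => by
    have := Submodule.norm_orthogonalProjectionOnto_apply_le (ℝ ∙ n)ᗮ (graphMap p n f y - p)
    rwa [orthogonalProjectionOnto_graphMap] at this
  have hfin : Module.finrank ℝ (ℝ ∙ n)ᗮ = m - 1 := by
    have h1 := Submodule.finrank_add_finrank_orthogonal (ℝ ∙ n)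
    rw [finrank_span_singleton (by rintro rfl; simpa using h.norm_eq),
      finrank_euclideanSpace_fin] at h1
    omega
  have hfin' : ((Module.finrank ℝ (ℝ ∙ n)ᗮ : ℕ) : ℝ) = m - 1 := by
    rw [hfin, Nat.cast_sub hm.le, Nat.cast_one]
  have hnt : Nontrivial (ℝ ∙ n)ᗮ := Module.finrank_pos_iff (R := ℝ).1 (by omega)
  -- Points of the graph are at least as far from p as their parameters are from 0, and s ≤ 0. So
  -- ‖y‖^s is a majorant, locally integrable because s > -(m-1) = -dim n^⊥.
  have hloc : LocallyIntegrable (fun y => ‖graphMap p n f y - p‖ ^ s) := by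
    refine locallyIntegrable_of_norm_le_rpow (by omega) (α := -s) (C := 1)
      (by rw [hfin']; linarith) ?_ ?_
    · filter_upwards [compl_mem_ae_iff.2 (measure_singleton (0 : (ℝ ∙ n)ᗮ))] with y hy
      have hy0 : 0 < ‖y‖ := norm_pos_iff.2 hy
      rw [Real.norm_of_nonneg (Real.rpow_nonneg (norm_nonneg _) _), neg_neg, one_mul]
      exact Real.rpow_le_rpow_of_nonpos hy0 (hyle y) hs0
    · have h1 := hGc.measurable
      exact Measurable.aestronglyMeasurable (by fun_prop)
  have key := (integrableOn_graphMap_image h.norm_eq h.contDiff hAm fun ξ => ‖ξ - p‖ ^ s).2 <| by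
    have h1 : IntegrableOn (fun y => ‖graphNormal n f y‖ * ‖graphMap p n f y - p‖ ^ s)
        (Metric.closedBall 0 d) :=
      (hloc.integrableOn_isCompact (isCompact_closedBall _ _)).continuousOn_mul
        (continuous_graphNormal h.contDiff).norm.continuousOn (isCompact_closedBall _ _)
    refine h1.mono_set fun y hy => ?_
    have h2 : ‖graphMap p n f y - p‖ < d := by simpa [dist_eq_norm] using hy.1
    exact mem_closedBall_zero_iff.2 ((hyle y).trans h2.le)
  rw [h.lateralBoundary_inter hΩo]
  rwa [finrank_euclideanSpace_fin] at key

end IsGraphChart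

namespace IsLyapunovDomain

/-- On the surface the kernel has only a weak singularity. -/
theorem eventually_abs_flux_le (hΩ : IsLyapunovDomain Ω) (hα : 0 < α) (hm : 2 < m)
    {x : EuclideanSpace ℝ (Fin m)} (hx : x ∈ lateralBoundary Ω) :
    ∃ s C : ℝ, -((m : ℝ) - 1) < s ∧ s ≤ 0 ∧ ∀ᶠ ξ in 𝓝[≠] x, ξ ∈ lateralBoundary Ω →
      |ξ 0 ^ (2 * α) * ⟪kernelField α x ξ, outerUnitNormal Ω ξ⟫_ℝ| ≤ C * ‖ξ - x‖ ^ s := by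
  obtain ⟨ε, C, lam, hε, hC, hlam, hb⟩ := hΩ.exists_abs_inner_sub_normal_le hx
  have hx0 : 0 < x 0 := hx.2
  have hm' : (2 : ℝ) < m := by exact_mod_cast hm
  -- The moment j = 0 contributes r^{-m} r^{1+λ} and the moment j = 1 contributes r^{2-m}. Capping λ
  -- at 1 bounds both by r^s for r ≤ 1.
  set s : ℝ := 1 + min lam 1 - m with hs
  have hmin : 0 < min lam 1 := lt_min hlam one_pos
  have hmin1 : min lam 1 ≤ 1 := min_le_right _ _
  have hminl : min lam 1 ≤ lam := min_le_left _ _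
  obtain ⟨A, hA⟩ := (tendsto_kernelMoment (j := 0) hα (by omega) hx0).isBoundedUnder_le
  obtain ⟨B, hB⟩ := (tendsto_kernelMoment (j := 1) hα (by omega) hx0).isBoundedUnder_le
  rw [eventually_map] at hA hB
  have hxc : ∀ᶠ ξ : EuclideanSpace ℝ (Fin m) in 𝓝[≠] x, ξ 0 < 2 * x 0 := by
    have hc : Continuous fun ξ : EuclideanSpace ℝ (Fin m) => ξ 0 := by fun_prop
    exact nhdsWithin_le_nhds ((isOpen_lt hc continuous_const).mem_nhds
      (show x 0 < 2 * x 0 by linarith))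
  have hball : ∀ᶠ ξ : EuclideanSpace ℝ (Fin m) in 𝓝[≠] x, ‖ξ - x‖ < min ε 1 := by
    refine nhdsWithin_le_nhds ?_
    filter_upwards [Metric.ball_mem_nhds x (lt_min hε one_pos)] with ξ hξ
    rwa [Metric.mem_ball, dist_eq_norm] at hξ
  refine ⟨s, (2 * x 0) ^ (2 * α) * (A * C + 2 * x 0 * B), by linarith, by linarith, ?_⟩
  filter_upwards [hA, hB, hxc, hball, self_mem_nhdsWithin] with ξ h0 h1 hξx hξε hne hξ
  have hr : 0 < ‖ξ - x‖ := norm_pos_iff.2 (sub_ne_zero.2 hne)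
  set r := ‖ξ - x‖ with hrdef
  have hr1 : r ≤ 1 := (hξε.trans_le (min_le_right _ _)).le
  have hξ0 : 0 < ξ 0 := hξ.2
  have p0 := kernelMoment_nonneg (α := α) 0 hx0.le hξ0.le
  have p1 := kernelMoment_nonneg (α := α) 1 hx0.le hξ0.le
  simp only [mul_zero, Nat.sub_zero, mul_one] at h0 h1
  have hA0 : 0 ≤ A := le_trans (by positivity) h0
  have hB0 : 0 ≤ B := le_trans (by positivity) h1
  have q0 : kernelMoment α 0 x ξ ≤ A * r ^ (-(m : ℝ)) := by
    rw [Real.rpow_neg hr.le, Real.rpow_natCast, ← div_eq_mul_inv, le_div_iff₀ (by positivity),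
      mul_comm]
    exact h0
  have q1 : kernelMoment α 1 x ξ ≤ B * r ^ (2 - (m : ℝ)) := by
    have e : (2 - (m : ℝ)) = -((m - 2 : ℕ) : ℝ) := by push_cast [hm.le]; ring
    rw [e, Real.rpow_neg hr.le, Real.rpow_natCast, ← div_eq_mul_inv, le_div_iff₀ (by positivity),
      mul_comm]
    exact h1
  have hn1 : |outerUnitNormal Ω ξ 0| ≤ 1 :=
    (PiLp.norm_apply_le (outerUnitNormal Ω ξ) 0).trans (hΩ.norm_outerUnitNormal hξ).le
  have hin := hb ξ hξ (hξε.trans_le (min_le_left _ _))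
  have e1 : ⟪kernelField α x ξ, outerUnitNormal Ω ξ⟫_ℝ =
      kernelMoment α 0 x ξ * ⟪ξ - x, outerUnitNormal Ω ξ⟫_ℝ +
        2 * x 0 * kernelMoment α 1 x ξ * outerUnitNormal Ω ξ 0 := by
    simp [kernelField, inner_add_left, inner_smul_left, EuclideanSpace.inner_single_left]
  have e2 : |⟪kernelField α x ξ, outerUnitNormal Ω ξ⟫_ℝ| ≤ (A * C + 2 * x 0 * B) * r ^ s := by
    rw [e1, add_mul]
    refine (abs_add_le _ _).trans (add_le_add ?_ ?_)
    · rw [abs_mul, abs_of_nonneg p0]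
      calc kernelMoment α 0 x ξ * |⟪ξ - x, outerUnitNormal Ω ξ⟫_ℝ|
          ≤ (A * r ^ (-(m : ℝ))) * (C * r ^ (1 + min lam 1)) := by
            refine mul_le_mul q0 (hin.trans (mul_le_mul_of_nonneg_left ?_ hC)) (abs_nonneg _)
              (by positivity)
            exact Real.rpow_le_rpow_of_exponent_ge hr hr1 (by linarith)
        _ = A * C * r ^ s := by
            have e3 : r ^ s = r ^ (-(m : ℝ)) * r ^ (1 + min lam 1) := by
              rw [← Real.rpow_add hr, hs]
              ring_nf
            rw [e3]
            ring
    · rw [abs_mul, abs_of_nonneg (by positivity)]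
      calc 2 * x 0 * kernelMoment α 1 x ξ * |outerUnitNormal Ω ξ 0|
          ≤ 2 * x 0 * (B * r ^ (2 - (m : ℝ))) * 1 := by gcongr
        _ ≤ 2 * x 0 * (B * r ^ s) * 1 := by
            gcongr 2 * x 0 * (B * ?_) * 1
            exact Real.rpow_le_rpow_of_exponent_ge hr hr1 (by linarith)
        _ = 2 * x 0 * B * r ^ s := by ring
  rw [abs_mul, abs_of_nonneg (by positivity), mul_assoc]
  exact mul_le_mul (Real.rpow_le_rpow hξ0.le hξx.le (by positivity)) e2 (abs_nonneg _)
    (by positivity)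

/-- The double-layer potential converges absolutely at the points of the surface. -/
theorem integrableOn_flux_of_mem_lateralBoundary (hΩ : IsLyapunovDomain Ω) (hα : 0 < α)
    (hm : 2 < m) {x : EuclideanSpace ℝ (Fin m)} (hx : x ∈ lateralBoundary Ω) :
    IntegrableOn (fun ξ => ξ 0 ^ (2 * α) * ⟪kernelField α x ξ, outerUnitNormal Ω ξ⟫_ℝ)
      (lateralBoundary Ω) μHE[m - 1] := by
  obtain ⟨s, C, hs, hs0, hev⟩ := hΩ.eventually_abs_flux_le hα hm hx
  obtain ⟨n, d, f, hch, -, -⟩ := hΩ.exists_isGraphChart (subset_closure hx)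
  obtain ⟨ε, hε, hεb⟩ := Metric.mem_nhdsWithin_iff.1 hev
  have hρ : 0 < min ε d := lt_min hε hch.pos
  have hnear : IntegrableOn
      (fun ξ => ξ 0 ^ (2 * α) * ⟪kernelField α x ξ, outerUnitNormal Ω ξ⟫_ℝ)
      (lateralBoundary Ω ∩ Metric.ball x (min ε d)) μHE[m - 1] := by
    have h1 := ((hch.integrableOn_norm_sub_rpow hΩ.isOpen (by omega) hs hs0).mono_set
      (inter_subset_inter_right _ (Metric.ball_subset_ball (min_le_right ε d)))).const_mul C
    refine Integrable.mono' h1 ((hΩ.aestronglyMeasurable_flux α x).mono_measure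
      (Measure.restrict_mono inter_subset_left le_rfl)) ?_
    have h2 : ∀ᵐ ξ ∂μHE[m - 1], ξ ≠ x :=
      compl_mem_ae_iff.2 (euclideanHausdorffMeasure_singleton (by omega) x)
    filter_upwards [ae_restrict_mem (measurableSet_lateralBoundary.inter measurableSet_ball),
      ae_restrict_of_ae h2] with ξ hξ hne
    exact hεb ⟨Metric.ball_subset_ball (min_le_left ε d) hξ.2, hne⟩ hξ.1
  have := hnear.union (hΩ.integrableOn_flux_far hα (le_of_lt hx.2) hρ)
  rwa [inter_union_sdiff] at this

theorem integrableOn_flux_of_notMem_closure (hΩ : IsLyapunovDomain Ω) (hα : 0 < α)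
    {x : EuclideanSpace ℝ (Fin m)} (hx0 : 0 ≤ x 0) (hx : x ∉ closure (lateralBoundary Ω)) :
    IntegrableOn (fun ξ => ξ 0 ^ (2 * α) * ⟪kernelField α x ξ, outerUnitNormal Ω ξ⟫_ℝ)
      (lateralBoundary Ω) μHE[m - 1] := by
  obtain ⟨c, hc, hcb⟩ := Metric.mem_nhds_iff.1 (isClosed_closure.isOpen_compl.mem_nhds hx)
  refine (hΩ.integrableOn_flux_far hα hx0 hc).mono_set fun ξ hξ => ⟨hξ, fun hb => ?_⟩
  exact hcb hb (subset_closure hξ)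

/-- The integrand of the double-layer potential in terms of the kernel field. -/
theorem doubleLayerIntegrand_ae_eq (Ω : Set (EuclideanSpace ℝ (Fin m))) (hα : 0 < α) (hm : 2 < m)
    {x : EuclideanSpace ℝ (Fin m)} (hx : 0 ≤ x 0) :
    doubleLayerIntegrand α Ω (fun _ => 1) x =ᵐ[μHE[m - 1].restrict (lateralBoundary Ω)]
      fun ξ => -fluxConst m α *
        (ξ 0 ^ (2 * α) * ⟪kernelField α x ξ, outerUnitNormal Ω ξ⟫_ℝ) := by
  have h2 : ∀ᵐ ξ ∂μHE[m - 1], ξ ≠ x :=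
    compl_mem_ae_iff.2 (euclideanHausdorffMeasure_singleton (by omega) x)
  filter_upwards [ae_restrict_mem measurableSet_lateralBoundary, ae_restrict_of_ae h2] with ξ hξ hne
  rw [doubleLayerIntegrand, fderiv_fundSol hα hm hx hξ.2 hne]
  ring

end IsLyapunovDomain

end DirectValue


/-! ### Removing the cut-off at the singular hyperplane -/

section Cutoff

/-- The value 1 is a maximum, so the derivative vanishes at the transition point t = 1 as well. -/
theorem deriv_smoothTransition_of_one_le {t : ℝ} (ht : 1 ≤ t) :
    deriv Real.smoothTransition t = 0 := by
  refine IsLocalMax.deriv_eq_zero (Eventually.of_forall fun s => ?_)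
  rw [Real.smoothTransition.one_of_one_le ht]
  exact Real.smoothTransition.le_one s

theorem deriv_smoothTransition_of_nonpos {t : ℝ} (ht : t ≤ 0) :
    deriv Real.smoothTransition t = 0 := by
  refine IsLocalMin.deriv_eq_zero (Eventually.of_forall fun s => ?_)
  rw [Real.smoothTransition.zero_of_nonpos ht]
  exact Real.smoothTransition.nonneg s

theorem contDiff_smoothTransition : ContDiff ℝ 1 Real.smoothTransition :=
  Real.smoothTransition.contDiff (n := 1)

theorem hasDerivAt_smoothTransition (t : ℝ) :
    HasDerivAt Real.smoothTransition (deriv Real.smoothTransition t) t :=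
  (contDiff_smoothTransition.differentiable one_ne_zero t).hasDerivAt

theorem continuous_deriv_smoothTransition : Continuous (deriv Real.smoothTransition) :=
  contDiff_smoothTransition.continuous_deriv le_rfl

theorem exists_abs_deriv_smoothTransition_le :
    ∃ D, 0 ≤ D ∧ ∀ t, |deriv Real.smoothTransition t| ≤ D := by
  obtain ⟨D, hD⟩ := (isCompact_Icc (a := (0 : ℝ)) (b := 1)).exists_bound_of_continuousOn
    continuous_deriv_smoothTransition.continuousOn
  refine ⟨D, (abs_nonneg _).trans (hD 0 (by simp)), fun t => ?_⟩
  rcases le_or_gt t 0 with h0 | h0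
  · rw [deriv_smoothTransition_of_nonpos h0, abs_zero]
    exact (abs_nonneg _).trans (hD 0 (by simp))
  rcases le_or_gt 1 t with h1 | h1
  · rw [deriv_smoothTransition_of_one_le h1, abs_zero]
    exact (abs_nonneg _).trans (hD 0 (by simp))
  exact hD t ⟨h0.le, h1.le⟩

variable {m : ℕ} [NeZero m] {α : ℝ} {Ω : Set (EuclideanSpace ℝ (Fin m))}

/-- A bounded part of a slab has volume at most proportional to the width of the slab. -/
theorem exists_volume_slab_le {S : Set (EuclideanSpace ℝ (Fin m))} (hS : Bornology.IsBounded S) :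
    ∃ V, 0 ≤ V ∧ ∀ δ, 0 ≤ δ → volume.real (S ∩ {x | x 0 ∈ Icc 0 δ}) ≤ V * δ := by
  obtain ⟨R, hR⟩ := hS.exists_norm_le
  set B : ℝ → Fin m → Set ℝ := fun δ i => if i = 0 then Icc 0 δ else Icc (-R) R with hB
  set V : ENNReal := ∏ _i ∈ Finset.univ.erase (0 : Fin m), ENNReal.ofReal (R - -R) with hV
  have hVtop : V ≠ ⊤ := ENNReal.prod_ne_top fun _ _ => ENNReal.ofReal_ne_top
  refine ⟨V.toReal, ENNReal.toReal_nonneg, fun δ hδ => ?_⟩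
  have hsub : S ∩ {x | x 0 ∈ Icc 0 δ} ⊆ (@WithLp.ofLp 2 (Fin m → ℝ)) ⁻¹' (univ.pi (B δ)) := by
    rintro x ⟨hx, hx0⟩ i -
    by_cases hi : i = 0
    · subst hi
      simpa [hB] using hx0
    · simp only [hB, hi, if_false]
      exact abs_le.1 ((PiLp.norm_apply_le x i).trans (hR x hx))
  have hvol : volume ((@WithLp.ofLp 2 (Fin m → ℝ)) ⁻¹' (univ.pi (B δ))) =
      V * ENNReal.ofReal δ := by
    have hmeas : MeasurableSet (univ.pi (B δ)) := MeasurableSet.univ_pi fun i => by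
      simp only [hB]; split_ifs <;> exact measurableSet_Icc
    rw [(PiLp.volume_preserving_ofLp (Fin m)).measure_preimage hmeas.nullMeasurableSet,
      volume_pi_pi, ← Finset.prod_erase_mul _ _ (Finset.mem_univ (0 : Fin m))]
    congr 1
    · refine Finset.prod_congr rfl fun i hi => ?_
      simp only [hB, Finset.ne_of_mem_erase hi, if_false, Real.volume_Icc]
    · simp [hB]
  have htop : V * ENNReal.ofReal δ ≠ ⊤ := ENNReal.mul_ne_top hVtop ENNReal.ofReal_ne_top
  have h := ENNReal.toReal_mono (htop) ((measure_mono hsub).trans hvol.le)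
  rwa [ENNReal.toReal_mul, ENNReal.toReal_ofReal hδ] at h

/-- A cut-off function that vanishes for `x₁ ≤ ε` and equals `1` for `x₁ ≥ 2 ε`. -/
def hyperplaneCutoff (ε : ℝ) (ξ : EuclideanSpace ℝ (Fin m)) : ℝ :=
  Real.smoothTransition (ξ 0 / ε - 1)

theorem hyperplaneCutoff_nonneg (ε : ℝ) (ξ : EuclideanSpace ℝ (Fin m)) :
    0 ≤ hyperplaneCutoff ε ξ := Real.smoothTransition.nonneg _

theorem hyperplaneCutoff_le_one (ε : ℝ) (ξ : EuclideanSpace ℝ (Fin m)) :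
    hyperplaneCutoff ε ξ ≤ 1 := Real.smoothTransition.le_one _

theorem hyperplaneCutoff_eq_zero {ε : ℝ} (hε : 0 < ε) {ξ : EuclideanSpace ℝ (Fin m)}
    (h : ξ 0 < ε) : hyperplaneCutoff ε ξ = 0 :=
  Real.smoothTransition.zero_of_nonpos (by rw [sub_nonpos, div_le_one hε]; exact h.le)

theorem contDiff_hyperplaneCutoff (ε : ℝ) :
    ContDiff ℝ 1 (hyperplaneCutoff ε : EuclideanSpace ℝ (Fin m) → ℝ) := by
  refine contDiff_smoothTransition.comp ?_
  fun_prop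

theorem fderiv_hyperplaneCutoff (ε : ℝ) (ξ v : EuclideanSpace ℝ (Fin m)) :
    fderiv ℝ (hyperplaneCutoff ε) ξ v = deriv Real.smoothTransition (ξ 0 / ε - 1) * (v 0 / ε) := by
  have h1 : HasFDerivAt (fun ξ : EuclideanSpace ℝ (Fin m) => ξ 0 / ε - 1)
      (ε⁻¹ • (EuclideanSpace.proj 0 : EuclideanSpace ℝ (Fin m) →L[ℝ] ℝ)) ξ := by
    have := ((EuclideanSpace.proj (0 : Fin m) : EuclideanSpace ℝ (Fin m) →L[ℝ] ℝ).hasFDerivAt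
      (x := ξ)).const_mul ε⁻¹
    refine (this.sub_const 1).congr_of_eventuallyEq (Eventually.of_forall fun η => ?_)
    simp [div_eq_inv_mul]
  have h2 := (hasDerivAt_smoothTransition (ξ 0 / ε - 1)).comp_hasFDerivAt ξ h1
  have h3 : fderiv ℝ (hyperplaneCutoff ε) ξ = _ := h2.fderiv
  rw [h3]
  simp [div_eq_inv_mul]

theorem tendsto_hyperplaneCutoff {ξ : EuclideanSpace ℝ (Fin m)} (hξ : 0 < ξ 0) :
    Tendsto (fun ε => hyperplaneCutoff ε ξ) (𝓝[>] 0) (𝓝 1) := by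
  refine tendsto_const_nhds.congr' ?_
  have h1 : ∀ᶠ ε : ℝ in 𝓝[>] 0, ε ≤ ξ 0 / 2 :=
    nhdsWithin_le_nhds (Iic_mem_nhds (by positivity))
  filter_upwards [h1, self_mem_nhdsWithin] with ε hε hε0
  refine (Real.smoothTransition.one_of_one_le ?_).symm
  have : 2 ≤ ξ 0 / ε := by rw [le_div_iff₀ hε0]; linarith
  linarith

namespace IsLyapunovDomain

/-- Green's formula for the kernel field, cut off near its pole only. -/
theorem setIntegral_cutoff_flux (hΩ : IsLyapunovDomain Ω) (hα : 0 < α)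
    {x : EuclideanSpace ℝ (Fin m)} (hx : 0 ≤ x 0) {η : EuclideanSpace ℝ (Fin m) → ℝ}
    (hη : ContDiff ℝ 1 η) {ρ : ℝ} (hρ : 0 < ρ) (hηρ : ∀ ξ, ‖ξ - x‖ < ρ → η ξ = 0) :
    ∫ ξ in lateralBoundary Ω,
        η ξ * (ξ 0 ^ (2 * α) * ⟪kernelField α x ξ, outerUnitNormal Ω ξ⟫_ℝ) ∂μHE[m - 1] =
      ∫ ξ in Ω, ξ 0 ^ (2 * α) * fderiv ℝ η ξ (kernelField α x ξ) := by
  have hcl : IsCompact (closure Ω) := hΩ.isBounded.isCompact_closure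
  have hcl0 : ∀ ξ ∈ closure Ω, 0 ≤ ξ 0 := fun ξ hξ => by
    have h1 : IsClosed {y : EuclideanSpace ℝ (Fin m) | 0 ≤ y 0} :=
      isClosed_le continuous_const (by fun_prop)
    have h2 : Ω ⊆ {y : EuclideanSpace ℝ (Fin m) | 0 ≤ y 0} := fun y hy =>
      (show 0 < y 0 from hΩ.subset_halfSpace hy).le
    exact closure_minimal h2 h1 hξ
  have hΓcl : lateralBoundary Ω ⊆ closure Ω := fun _ h => frontier_subset_closure h.1
  have hdη : Continuous (fderiv ℝ η) := hη.continuous_fderiv one_ne_zero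
  obtain ⟨R, hR⟩ := hcl.isBounded.exists_norm_le
  obtain ⟨H, hH⟩ := hcl.exists_bound_of_continuousOn hη.continuous.continuousOn
  obtain ⟨H', hH'⟩ := hcl.exists_bound_of_continuousOn hdη.continuousOn
  obtain ⟨M, hM0, hM⟩ := exists_norm_kernelField_le hα hx hρ hcl.isBounded hcl0
  obtain ⟨D, hD0, hD⟩ := exists_abs_deriv_smoothTransition_le
  obtain ⟨V, hV0, hV⟩ := exists_volume_slab_le hΩ.isBounded
  have hΩvol : volume Ω < ⊤ := hΩ.isBounded.measure_lt_top
  obtain ⟨ξ₀, hξ₀⟩ := hΩ.isConnected.nonempty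
  have hH0 : 0 ≤ H := (norm_nonneg _).trans (hH ξ₀ (subset_closure hξ₀))
  have hH'0 : 0 ≤ H' := (norm_nonneg _).trans (hH' ξ₀ (subset_closure hξ₀))
  have hR0 : 0 ≤ R := (norm_nonneg _).trans (hR ξ₀ (subset_closure hξ₀))
  have hpow : ∀ ξ ∈ closure Ω, ξ 0 ^ (2 * α) ≤ R ^ (2 * α) := fun ξ hξ =>
    Real.rpow_le_rpow (hcl0 ξ hξ) ((le_abs_self _).trans ((PiLp.norm_apply_le ξ 0).trans (hR ξ hξ)))
      (by positivity)
  have hpow0 : ∀ ξ ∈ closure Ω, 0 ≤ ξ 0 ^ (2 * α) := fun ξ hξ => Real.rpow_nonneg (hcl0 ξ hξ) _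
  have hηF : ∀ ξ ∈ closure Ω, |η ξ| * ‖kernelField α x ξ‖ ≤ H * M := fun ξ hξ => by
    rcases lt_or_ge ‖ξ - x‖ ρ with h | h
    · rw [hηρ ξ h, abs_zero, zero_mul]; positivity
    · exact mul_le_mul (hH ξ hξ) (hM ξ hξ h) (norm_nonneg _) hH0
  have hdηF : ∀ ξ ∈ closure Ω, |fderiv ℝ η ξ (kernelField α x ξ)| ≤ H' * M := fun ξ hξ => by
    rcases lt_or_ge ‖ξ - x‖ ρ with h | h
    · have : η =ᶠ[𝓝 ξ] fun _ => 0 := by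
        filter_upwards [(isOpen_lt (by fun_prop : Continuous fun y => ‖y - x‖)
          continuous_const).mem_nhds h] with y hy using hηρ y hy
      rw [this.fderiv_eq]
      simp only [fderiv_fun_const, Pi.zero_apply, zero_apply, abs_zero]
      positivity
    · exact ((fderiv ℝ η ξ).le_opNorm _).trans
        (mul_le_mul (hH' ξ hξ) (hM ξ hξ h) (norm_nonneg _) hH'0)
  have hFm := measurable_kernelField α x
  have hpm : Measurable fun ξ : EuclideanSpace ℝ (Fin m) => ξ 0 ^ (2 * α) := by fun_prop
  have hχm : ∀ ε, Measurable (hyperplaneCutoff ε : EuclideanSpace ℝ (Fin m) → ℝ) := fun ε =>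
    (contDiff_hyperplaneCutoff ε).continuous.measurable
  have happ : Measurable fun ξ => fderiv ℝ η ξ (kernelField α x ξ) :=
    (isBoundedBilinearMap_apply (𝕜 := ℝ) (E := EuclideanSpace ℝ (Fin m))
      (F := ℝ)).continuous.measurable.comp (hdη.measurable.prodMk hFm)
  -- the surface integrals
  have hL : Tendsto (fun ε : ℝ => ∫ ξ in lateralBoundary Ω, (hyperplaneCutoff ε ξ * η ξ) *
        (ξ 0 ^ (2 * α) * ⟪kernelField α x ξ, outerUnitNormal Ω ξ⟫_ℝ) ∂μHE[m - 1]) (𝓝[>] 0)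
      (𝓝 (∫ ξ in lateralBoundary Ω,
        η ξ * (ξ 0 ^ (2 * α) * ⟪kernelField α x ξ, outerUnitNormal Ω ξ⟫_ℝ) ∂μHE[m - 1])) := by
    refine tendsto_integral_filter_of_dominated_convergence (fun _ => R ^ (2 * α) * (H * M))
      (Eventually.of_forall fun ε => ?_) (Eventually.of_forall fun ε => ?_) ?_ ?_
    · exact ((hχm ε).mul hη.continuous.measurable).aestronglyMeasurable.mul
        (hΩ.aestronglyMeasurable_flux α x)
    · filter_upwards [ae_restrict_mem measurableSet_lateralBoundary] with ξ hξ
      have hξ' := hΓcl hξ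
      have h3 := abs_real_inner_le_norm (kernelField α x ξ) (outerUnitNormal Ω ξ)
      rw [hΩ.norm_outerUnitNormal hξ, mul_one] at h3
      rw [Real.norm_eq_abs, abs_mul, abs_mul, abs_mul, abs_of_nonneg (hyperplaneCutoff_nonneg ε ξ),
        abs_of_nonneg (hpow0 ξ hξ')]
      calc hyperplaneCutoff ε ξ * |η ξ| * (ξ 0 ^ (2 * α) *
            |⟪kernelField α x ξ, outerUnitNormal Ω ξ⟫_ℝ|)
          ≤ 1 * |η ξ| * (ξ 0 ^ (2 * α) * ‖kernelField α x ξ‖) := by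
            have := hpow0 ξ hξ'
            gcongr
            exact hyperplaneCutoff_le_one ε ξ
        _ = ξ 0 ^ (2 * α) * (|η ξ| * ‖kernelField α x ξ‖) := by ring
        _ ≤ _ := mul_le_mul (hpow ξ hξ') (hηF ξ hξ') (by positivity) (by positivity)
    · exact integrableOn_const hΩ.measure_lateralBoundary_lt_top.ne
    · filter_upwards [ae_restrict_mem measurableSet_lateralBoundary] with ξ hξ
      simpa using ((tendsto_hyperplaneCutoff hξ.2).mul_const (η ξ)).mul_const
        (ξ 0 ^ (2 * α) * ⟪kernelField α x ξ, outerUnitNormal Ω ξ⟫_ℝ)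
  -- the volume integrals
  have hboundA : ∀ ε, ∀ ξ ∈ closure Ω,
      ‖hyperplaneCutoff ε ξ * (ξ 0 ^ (2 * α) * fderiv ℝ η ξ (kernelField α x ξ))‖ ≤
        R ^ (2 * α) * (H' * M) := fun ε ξ hξ => by
    rw [Real.norm_eq_abs, abs_mul, abs_mul, abs_of_nonneg (hyperplaneCutoff_nonneg ε ξ),
        abs_of_nonneg (hpow0 ξ hξ)]
    calc hyperplaneCutoff ε ξ * (ξ 0 ^ (2 * α) * |fderiv ℝ η ξ (kernelField α x ξ)|)
        ≤ 1 * (R ^ (2 * α) * (H' * M)) := by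
          have := hpow0 ξ hξ
          have h1 := hyperplaneCutoff_le_one ε ξ
          have h2 := hpow ξ hξ
          have h3 := hdηF ξ hξ
          gcongr
      _ = _ := one_mul _
  have hmeasA : ∀ ε, Measurable fun ξ =>
      hyperplaneCutoff ε ξ * (ξ 0 ^ (2 * α) * fderiv ℝ η ξ (kernelField α x ξ)) := fun ε =>
    (hχm ε).mul (hpm.mul happ)
  have hA : Tendsto (fun ε : ℝ => ∫ ξ in Ω,
        hyperplaneCutoff ε ξ * (ξ 0 ^ (2 * α) * fderiv ℝ η ξ (kernelField α x ξ))) (𝓝[>] 0)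
      (𝓝 (∫ ξ in Ω, ξ 0 ^ (2 * α) * fderiv ℝ η ξ (kernelField α x ξ))) := by
    refine tendsto_integral_filter_of_dominated_convergence (fun _ => R ^ (2 * α) * (H' * M))
      (Eventually.of_forall fun ε => (hmeasA ε).aestronglyMeasurable)
      (Eventually.of_forall fun ε => ?_) (integrableOn_const hΩvol.ne) ?_
    · filter_upwards [ae_restrict_mem hΩ.isOpen.measurableSet] with ξ hξ
      exact hboundA ε ξ (subset_closure hξ)
    · filter_upwards [ae_restrict_mem hΩ.isOpen.measurableSet] with ξ hξ
      simpa using (tendsto_hyperplaneCutoff (hΩ.subset_halfSpace hξ)).mul_const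
        (ξ 0 ^ (2 * α) * fderiv ℝ η ξ (kernelField α x ξ))
  -- The term in which the derivative falls on the hyperplane cut-off.
  set b : ℝ → EuclideanSpace ℝ (Fin m) → ℝ := fun ε ξ => ξ 0 ^ (2 * α) *
    (η ξ * (deriv Real.smoothTransition (ξ 0 / ε - 1) * (kernelField α x ξ 0 / ε))) with hb
  have hbm : ∀ ε, Measurable (b ε) := fun ε => by
    have h1 := continuous_deriv_smoothTransition.measurable
    have h2 := hη.continuous.measurable
    simp only [hb]
    fun_prop
  have hbb : ∀ ε, 0 < ε → ∀ ξ ∈ Ω, ‖b ε ξ‖ ≤ (2 * ε) ^ (2 * α) * (H * M * D / ε) := by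
    intro ε hε ξ hξ
    have hξ0 : 0 < ξ 0 := hΩ.subset_halfSpace hξ
    have hξc := subset_closure (s := Ω) hξ
    rcases le_or_gt (2 * ε) (ξ 0) with h | h
    · have : 2 ≤ ξ 0 / ε := by rwa [le_div_iff₀ hε]
      simp only [hb, deriv_smoothTransition_of_one_le (show 1 ≤ ξ 0 / ε - 1 by linarith)]
      simp only [zero_mul, mul_zero, norm_zero]
      positivity
    · have h1 : |kernelField α x ξ 0| ≤ ‖kernelField α x ξ‖ := PiLp.norm_apply_le (kernelField α x ξ) 0
      have h2 := hηF ξ hξc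
      have h3 := hD (ξ 0 / ε - 1)
      have h4 : ξ 0 ^ (2 * α) ≤ (2 * ε) ^ (2 * α) := Real.rpow_le_rpow hξ0.le h.le (by positivity)
      simp only [hb]
      rw [Real.norm_eq_abs, abs_mul, abs_mul, abs_mul, abs_div, abs_of_pos hε,
        abs_of_nonneg (hpow0 ξ hξc)]
      refine mul_le_mul h4 ?_ (by positivity) (by positivity)
      calc |η ξ| * (|deriv Real.smoothTransition (ξ 0 / ε - 1)| * (|kernelField α x ξ 0| / ε))
          ≤ |η ξ| * (D * (‖kernelField α x ξ‖ / ε)) := by gcongr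
        _ = |η ξ| * ‖kernelField α x ξ‖ * D / ε := by ring
        _ ≤ H * M * D / ε := by gcongr
  have hbz : ∀ ε, 0 < ε → ∀ ξ, 2 * ε < ξ 0 → b ε ξ = 0 := by
    intro ε hε ξ hξ
    have : 2 ≤ ξ 0 / ε := by rw [le_div_iff₀ hε]; exact hξ.le
    simp only [hb, deriv_smoothTransition_of_one_le (show 1 ≤ ξ 0 / ε - 1 by linarith)]
    simp
  -- The slab 0 ≤ ξ₁ ≤ 2ε has volume O(ε) inside Ω, which absorbs the factor 1/ε. The weight leaves
  -- O(ε^{2α}) → 0: no flux passes through the hyperplane.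
  have hB : Tendsto (fun ε : ℝ => ∫ ξ in Ω, b ε ξ) (𝓝[>] 0) (𝓝 0) := by
    have hlim : Tendsto (fun ε : ℝ => (2 * ε) ^ (2 * α) * (2 * H * M * D * V)) (𝓝[>] 0) (𝓝 0) := by
      have hc : Continuous fun ε : ℝ => (2 * ε) ^ (2 * α) * (2 * H * M * D * V) :=
        ((by fun_prop : Continuous fun ε : ℝ => 2 * ε).rpow_const fun _ =>
          Or.inr (by positivity)).mul continuous_const
      have h0 := (hc.tendsto 0).mono_left (nhdsWithin_le_nhds (s := Ioi 0))
      have e0 : (2 * (0 : ℝ)) ^ (2 * α) * (2 * H * M * D * V) = 0 := by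
        rw [mul_zero, Real.zero_rpow (by positivity), zero_mul]
      rwa [e0] at h0
    refine squeeze_zero_norm' ?_ hlim
    filter_upwards [self_mem_nhdsWithin] with ε hε
    have hε : 0 < ε := hε
    have e1 : ∫ ξ in Ω, b ε ξ = ∫ ξ in Ω ∩ {x | x 0 ∈ Icc 0 (2 * ε)}, b ε ξ := by
      refine (setIntegral_eq_of_subset_of_forall_sdiff_eq_zero hΩ.isOpen.measurableSet
        inter_subset_left fun ξ hξ => hbz ε hε ξ ?_)
      by_contra hle
      exact hξ.2 ⟨hξ.1, (hΩ.subset_halfSpace hξ.1).le, not_lt.1 hle⟩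
    rw [e1]
    have h1 := norm_setIntegral_le_of_norm_le_const (μ := volume) (f := b ε)
      (s := Ω ∩ {x | x 0 ∈ Icc 0 (2 * ε)})
      (C := (2 * ε) ^ (2 * α) * (H * M * D / ε))
      ((measure_mono inter_subset_left).trans_lt hΩvol) fun ξ hξ => hbb ε hε ξ hξ.1
    refine h1.trans ((mul_le_mul_of_nonneg_left (hV (2 * ε) (by positivity))
      (by positivity)).trans_eq ?_)
    field_simp
  -- For each ε > 0 Green's identity holds for the doubly cut-off field; both sides converge as ε →
  -- 0.
  refine tendsto_nhds_unique hL ?_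
  have hAB := hA.add hB
  rw [add_zero] at hAB
  refine hAB.congr' ?_
  filter_upwards [self_mem_nhdsWithin] with ε hε
  have hε : 0 < ε := hε
  have hInt := hΩ.integral_kernelField hα hx (φ := fun ξ => hyperplaneCutoff ε ξ * η ξ)
    ((contDiff_hyperplaneCutoff ε).mul hη) hε hρ
    (fun ξ hξ => by rw [hyperplaneCutoff_eq_zero hε hξ, zero_mul])
    (fun ξ hξ => by rw [hηρ ξ hξ, mul_zero])
  rw [hInt, ← integral_add]
  · refine setIntegral_congr_fun hΩ.isOpen.measurableSet fun ξ _ => ?_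
    have hd := ((contDiff_hyperplaneCutoff ε).differentiable one_ne_zero ξ).hasFDerivAt.mul
      (hη.differentiable one_ne_zero ξ).hasFDerivAt
    have hd' : fderiv ℝ (fun ξ => hyperplaneCutoff ε ξ * η ξ) ξ = _ := hd.fderiv
    simp only [hb]
    rw [hd', add_apply, smul_apply, smul_apply,
      fderiv_hyperplaneCutoff, smul_eq_mul, smul_eq_mul]
    ring
  · refine IntegrableOn.of_bound hΩvol (hmeasA ε).aestronglyMeasurable (R ^ (2 * α) * (H' * M)) ?_
    filter_upwards [ae_restrict_mem hΩ.isOpen.measurableSet] with ξ hξ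
    exact hboundA ε ξ (subset_closure hξ)
  · refine IntegrableOn.of_bound hΩvol (hbm ε).aestronglyMeasurable
      ((2 * ε) ^ (2 * α) * (H * M * D / ε)) ?_
    filter_upwards [ae_restrict_mem hΩ.isOpen.measurableSet] with ξ hξ
    exact hbb ε hε ξ hξ

end IsLyapunovDomain

end Cutoff


/-! ### Blow-up at the pole -/

section BlowUp

variable {m : ℕ}

/-- A radial cut-off function that vanishes for `‖u‖ ≤ 1` and equals `1` for `‖u‖² ≥ 2`. -/
def radialCutoff (u : EuclideanSpace ℝ (Fin m)) : ℝ := 1 - Real.smoothTransition (2 - ‖u‖ ^ 2)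

/-- The radial weight `⟪u, ∇ radialCutoff⟫ ‖u‖^{-m}`. -/
def radialWeight (u : EuclideanSpace ℝ (Fin m)) : ℝ :=
  2 * deriv Real.smoothTransition (2 - ‖u‖ ^ 2) * (‖u‖ ^ (m - 2))⁻¹

theorem contDiff_radialCutoff : ContDiff ℝ 1 (radialCutoff : EuclideanSpace ℝ (Fin m) → ℝ) :=
  contDiff_const.sub (contDiff_smoothTransition.comp (contDiff_const.sub (contDiff_norm_sq ℝ)))

theorem radialCutoff_eq_zero {u : EuclideanSpace ℝ (Fin m)} (hu : ‖u‖ ≤ 1) :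
    radialCutoff u = 0 := by
  rw [radialCutoff, Real.smoothTransition.one_of_one_le, sub_self]
  nlinarith [norm_nonneg u]

theorem radialCutoff_eq_one {u : EuclideanSpace ℝ (Fin m)} (hu : 2 ≤ ‖u‖ ^ 2) :
    radialCutoff u = 1 := by
  rw [radialCutoff, Real.smoothTransition.zero_of_nonpos (by linarith), sub_zero]

theorem abs_radialCutoff_le_one (u : EuclideanSpace ℝ (Fin m)) : |radialCutoff u| ≤ 1 := by
  have h0 := Real.smoothTransition.nonneg (2 - ‖u‖ ^ 2)
  have h1 := Real.smoothTransition.le_one (2 - ‖u‖ ^ 2)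
  rw [radialCutoff, abs_le]
  constructor <;> linarith

theorem fderiv_radialCutoff (u v : EuclideanSpace ℝ (Fin m)) :
    fderiv ℝ radialCutoff u v = 2 * deriv Real.smoothTransition (2 - ‖u‖ ^ 2) * ⟪u, v⟫_ℝ := by
  have h1 : HasFDerivAt (fun u : EuclideanSpace ℝ (Fin m) => 2 - ‖u‖ ^ 2)
      (-(2 • innerSL ℝ u)) u := (hasStrictFDerivAt_norm_sq u).hasFDerivAt.const_sub 2
  have h2 := ((hasDerivAt_smoothTransition (2 - ‖u‖ ^ 2)).comp_hasFDerivAt u h1).const_sub 1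
  have h3 : fderiv ℝ radialCutoff u = _ := h2.fderiv
  rw [h3]
  simp
  ring

theorem radialWeight_eq_zero {u : EuclideanSpace ℝ (Fin m)} (hu : 2 ≤ ‖u‖) :
    radialWeight u = 0 := by
  rw [radialWeight, deriv_smoothTransition_of_nonpos (by nlinarith)]
  ring

theorem radialWeight_zero : radialWeight (0 : EuclideanSpace ℝ (Fin m)) = 0 := by
  rw [radialWeight, deriv_smoothTransition_of_one_le (by simp)]
  ring

theorem radialWeight_neg (u : EuclideanSpace ℝ (Fin m)) : radialWeight (-u) = radialWeight u := by
  rw [radialWeight, radialWeight, norm_neg]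

theorem measurable_radialWeight :
    Measurable (radialWeight : EuclideanSpace ℝ (Fin m) → ℝ) := by
  have := continuous_deriv_smoothTransition.measurable
  unfold radialWeight
  fun_prop

theorem integrable_radialWeight : Integrable (radialWeight : EuclideanSpace ℝ (Fin m) → ℝ) := by
  obtain ⟨D, hD0, hD⟩ := exists_abs_deriv_smoothTransition_le
  have h1 : IntegrableOn (radialWeight : EuclideanSpace ℝ (Fin m) → ℝ) (Metric.ball 0 2) := by
    refine IntegrableOn.of_bound measure_ball_lt_top measurable_radialWeight.aestronglyMeasurable
      (2 * D) (Eventually.of_forall fun u => ?_)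
    rcases le_or_gt ‖u‖ 1 with h | h
    · rw [radialWeight, deriv_smoothTransition_of_one_le (by nlinarith [norm_nonneg u])]
      simp only [mul_zero, zero_mul, norm_zero]
      positivity
    · rw [radialWeight, Real.norm_eq_abs, abs_mul, abs_mul, abs_two,
        abs_of_nonneg (by positivity : 0 ≤ (‖u‖ ^ (m - 2))⁻¹)]
      have h2 : (‖u‖ ^ (m - 2))⁻¹ ≤ 1 := inv_le_one_of_one_le₀ (one_le_pow₀ h.le)
      have h3 := hD (2 - ‖u‖ ^ 2)
      calc 2 * |deriv Real.smoothTransition (2 - ‖u‖ ^ 2)| * (‖u‖ ^ (m - 2))⁻¹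
          ≤ 2 * D * 1 := by gcongr
        _ = 2 * D := mul_one _
  refine (integrableOn_iff_integrable_of_support_subset fun u hu => ?_).1 h1
  rw [mem_ball_zero_iff]
  by_contra hle
  exact hu (radialWeight_eq_zero (not_lt.1 hle))

/-- The total radial weight is the area of the unit sphere. -/
theorem integral_radialWeight (hm : 2 < m) :
    ∫ u : EuclideanSpace ℝ (Fin m), radialWeight u =
      2 * Real.pi ^ ((m : ℝ) / 2) / Real.Gamma ((m : ℝ) / 2) := by
  have hm0 : (0 : ℝ) < m := by exact_mod_cast (by omega : 0 < m)
  have : Nonempty (Fin m) := ⟨⟨0, by omega⟩⟩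
  have : Nontrivial (EuclideanSpace ℝ (Fin m)) :=
    Module.nontrivial_of_finrank_pos (R := ℝ) (by rw [finrank_euclideanSpace_fin]; omega)
  set g : ℝ → ℝ := fun y => Real.smoothTransition (2 - y ^ 2) with hg
  have hgd : ∀ y, HasDerivAt g (-(2 * y * deriv Real.smoothTransition (2 - y ^ 2))) y := fun y => by
    have h1 : HasDerivAt (fun y : ℝ => 2 - y ^ 2) (-(2 * y)) y := by
      simpa using (hasDerivAt_pow 2 y).const_sub 2
    have h2 := (hasDerivAt_smoothTransition (2 - y ^ 2)).comp y h1
    rw [mul_neg, mul_comm] at h2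
    exact h2
  have hgc : ContDiff ℝ 1 g := contDiff_smoothTransition.comp (by fun_prop)
  have hgs : HasCompactSupport g := by
    refine HasCompactSupport.of_support_subset_isCompact (isCompact_Icc (a := (-2 : ℝ)) (b := 2))
      fun y hy => ?_
    by_contra hle
    refine hy (Real.smoothTransition.zero_of_nonpos ?_)
    rw [mem_Icc, ← abs_le, not_le] at hle
    nlinarith [sq_abs y]
  have h1 := hgs.integral_Ioi_deriv_eq hgc 0
  have h2 : g 0 = 1 := Real.smoothTransition.one_of_one_le (by norm_num)
  rw [h2] at h1
  have h3 := integral_fun_norm_addHaar (volume : Measure (EuclideanSpace ℝ (Fin m)))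
    fun y : ℝ => 2 * deriv Real.smoothTransition (2 - y ^ 2) * (y ^ (m - 2))⁻¹
  -- In polar coordinates y^{m-1} y^{-(m-2)} = y, which makes the integrand -g', so the radial
  -- integral is g(0) = 1 and the angular factor m · vol(ball) remains.
  have h4 : ∫ y in Ioi (0 : ℝ), y ^ (m - 1) •
      (2 * deriv Real.smoothTransition (2 - y ^ 2) * (y ^ (m - 2))⁻¹) = 1 := by
    have : ∫ y in Ioi (0 : ℝ), y ^ (m - 1) •
      (2 * deriv Real.smoothTransition (2 - y ^ 2) * (y ^ (m - 2))⁻¹) =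
        ∫ y in Ioi (0 : ℝ), -deriv g y := by
      refine setIntegral_congr_fun measurableSet_Ioi fun y hy => ?_
      have hy0 : (y : ℝ) ≠ 0 := ne_of_gt hy
      rw [(hgd y).deriv, show m - 1 = (m - 2) + 1 by omega, pow_succ, smul_eq_mul]
      field_simp
    rw [this, integral_neg, h1, neg_neg]
  rw [finrank_euclideanSpace_fin, h4] at h3
  have h5 : volume.real (Metric.ball (0 : EuclideanSpace ℝ (Fin m)) 1) =
      Real.pi ^ ((m : ℝ) / 2) / (m / 2 * Real.Gamma ((m : ℝ) / 2)) := by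
    rw [Measure.real, EuclideanSpace.volume_ball, ENNReal.ofReal_one, one_pow, one_mul,
      Fintype.card_fin, ENNReal.toReal_ofReal, Real.Gamma_add_one (by positivity)]
    · congr 1
      rw [Real.sqrt_eq_rpow, ← Real.rpow_natCast, ← Real.rpow_mul Real.pi_pos.le]
      congr 1
      ring
    · have := Real.Gamma_pos_of_pos (show 0 < (m : ℝ) / 2 + 1 by positivity)
      positivity
  have hΓ := (Real.Gamma_pos_of_pos (show 0 < (m : ℝ) / 2 by positivity)).ne'
  refine Eq.trans h3 ?_
  rw [h5, nsmul_eq_mul, smul_eq_mul]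
  field_simp

theorem ae_inner_ne_zero {n : EuclideanSpace ℝ (Fin m)} (hn : n ≠ 0) :
    ∀ᵐ u : EuclideanSpace ℝ (Fin m), ⟪n, u⟫_ℝ ≠ 0 := by
  have h1 := Measure.addHaar_submodule (volume : Measure (EuclideanSpace ℝ (Fin m))) (ℝ ∙ n)ᗮ
    (fun h => by
      have : n ∈ (ℝ ∙ n)ᗮ := by rw [h]; trivial
      rw [Submodule.mem_orthogonal_singleton_iff_inner_right, inner_self_eq_zero] at this
      exact hn this)
  filter_upwards [compl_mem_ae_iff.2 h1] with u hu h0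
  exact hu (Submodule.mem_orthogonal_singleton_iff_inner_right.2 h0)

/-- A half-space carries half of the radial weight. -/
theorem setIntegral_radialWeight_halfSpace {n : EuclideanSpace ℝ (Fin m)} (hn : n ≠ 0) :
    ∫ u in {u | ⟪n, u⟫_ℝ < 0}, radialWeight u =
      1 / 2 * ∫ u : EuclideanSpace ℝ (Fin m), radialWeight u := by
  have hc : Continuous fun u : EuclideanSpace ℝ (Fin m) => ⟪n, u⟫_ℝ := by fun_prop
  have hS : MeasurableSet {u : EuclideanSpace ℝ (Fin m) | ⟪n, u⟫_ℝ < 0} :=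
    (isOpen_lt hc continuous_const).measurableSet
  -- The weight is even, so u ↦ -u exchanges the two open half-spaces; the hyperplane between them
  -- is null.
  have h1 : ∫ u in {u | ⟪n, u⟫_ℝ < 0}, radialWeight u =
      ∫ u in {u | ⟪n, u⟫_ℝ < 0}ᶜ, radialWeight u := by
    have e1 : ∫ u in {u | ⟪n, u⟫_ℝ < 0}, radialWeight u =
        ∫ u in {u | 0 < ⟪n, u⟫_ℝ}, radialWeight u := by
      have h2 := (Measure.measurePreserving_neg
        (volume : Measure (EuclideanSpace ℝ (Fin m)))).setIntegral_preimage_emb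
        (MeasurableEquiv.neg _).measurableEmbedding radialWeight {u | 0 < ⟪n, u⟫_ℝ}
      rw [← h2]
      simp only [radialWeight_neg]
      congr 2
      ext u
      simp
    rw [e1]
    refine setIntegral_congr_set ?_
    filter_upwards [ae_inner_ne_zero hn] with u hu
    refine propext ⟨fun h => ?_, fun h => ?_⟩
    · exact not_lt.2 (le_of_lt h)
    · exact lt_of_le_of_ne (not_lt.1 h) (Ne.symm hu)
  have h3 := integral_add_compl hS (integrable_radialWeight (m := m))
  rw [← h1] at h3
  linarith

/-- This is the normalisation behind k₁: all Gamma factors and powers of π cancel, and 4^{1-α} = 4 ·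
4^{-α}. -/
theorem fluxConst_mul_solidAngle {α : ℝ} (hα : 0 < α) (hm : 2 < m) :
    fluxConst m α * ((4 : ℝ) ^ (-α) *
        (Real.Gamma α * Real.Gamma ((m : ℝ) / 2) / Real.Gamma (α + (m : ℝ) / 2)) *
          ∫ u : EuclideanSpace ℝ (Fin m), radialWeight u) = 1 := by
  have hm0 : (0 : ℝ) < m := by exact_mod_cast (by omega : 0 < m)
  have h1 := (Real.Gamma_pos_of_pos hα).ne'
  have h2 := (Real.Gamma_pos_of_pos (show 0 < (m : ℝ) / 2 by positivity)).ne'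
  have h3 := (Real.Gamma_pos_of_pos (show 0 < α + (m : ℝ) / 2 by positivity)).ne'
  have h4 := (Real.rpow_pos_of_pos Real.pi_pos ((m : ℝ) / 2)).ne'
  have h5 := (Real.rpow_pos_of_pos (show (0 : ℝ) < 4 by norm_num) (-α)).ne'
  have h6 : (4 : ℝ) ^ (1 - α) = 4 * 4 ^ (-α) := by
    rw [sub_eq_add_neg, Real.rpow_add (by norm_num), Real.rpow_one]
  rw [integral_radialWeight hm, fluxConst, h6]
  field_simp
  norm_num

/-! ### Rescaling about the pole. -/

variable [NeZero m] {α : ℝ} {Ω : Set (EuclideanSpace ℝ (Fin m))}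

/-- The radial part of the kernel field has a limit at the pole after rescaling. -/
theorem tendsto_radial_kernelField (hα : 0 < α) (hm : 2 < m) {x : EuclideanSpace ℝ (Fin m)}
    (hx : 0 < x 0) :
    Tendsto (fun ξ => ‖ξ - x‖ ^ (m - 2) * (ξ 0 ^ (2 * α) * ⟪ξ - x, kernelField α x ξ⟫_ℝ))
      (𝓝[≠] x) (𝓝 ((4 : ℝ) ^ (-α) *
        (Real.Gamma α * Real.Gamma ((m : ℝ) / 2) / Real.Gamma (α + (m : ℝ) / 2)))) := by
  have hm0 : (0 : ℝ) < m := by exact_mod_cast (by omega : 0 < m)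
  have h0 := tendsto_kernelMoment (j := 0) hα (by omega) hx
  have h1 := tendsto_kernelMoment (j := 1) hα (by omega) hx
  have hL := (integral_rpow_mul_one_add_rpow (β := α) (γ := α + (m : ℝ) / 2) (c := 4 * x 0 * x 0) hα
    (by linarith) (by positivity)).2
  simp only [Nat.cast_zero, add_zero, mul_zero, Nat.sub_zero] at h0
  rw [hL, add_sub_cancel_left] at h0
  have hc : Continuous fun ξ : EuclideanSpace ℝ (Fin m) => ξ 0 := by fun_prop
  have hξ0 : Tendsto (fun ξ : EuclideanSpace ℝ (Fin m) => ξ 0) (𝓝[≠] x) (𝓝 (x 0)) :=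
    (hc.tendsto x).mono_left nhdsWithin_le_nhds
  have hp := hξ0.rpow_const (p := 2 * α) (Or.inl hx.ne')
  have hz : Tendsto (fun ξ : EuclideanSpace ℝ (Fin m) => 2 * x 0 * (ξ 0 - x 0)) (𝓝[≠] x) (𝓝 0) := by
    simpa using (hξ0.sub_const (x 0)).const_mul (2 * x 0)
  -- The moment j = 1 enters with the factor ξ₁ - x₁ → 0, so only j = 0 contributes to the limit.
  have hmain := hp.mul (h0.add (hz.mul h1))
  rw [zero_mul, add_zero] at hmain
  -- The powers of x₁ cancel: the limit does not depend on the pole.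
  have e : x 0 ^ (2 * α) * ((4 * x 0 * x 0) ^ (-α) *
      (Real.Gamma α * Real.Gamma ((m : ℝ) / 2) / Real.Gamma (α + (m : ℝ) / 2))) =
      (4 : ℝ) ^ (-α) *
        (Real.Gamma α * Real.Gamma ((m : ℝ) / 2) / Real.Gamma (α + (m : ℝ) / 2)) := by
    have h4 : (4 * x 0 * x 0) ^ (-α) = (4 : ℝ) ^ (-α) * x 0 ^ (-(2 * α)) := by
      rw [mul_assoc, Real.mul_rpow (by norm_num) (by positivity), ← pow_two, ← Real.rpow_natCast,
        ← Real.rpow_mul hx.le]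
      congr 2
      push_cast
      ring
    rw [h4, Real.rpow_neg hx.le]
    have := (Real.rpow_pos_of_pos hx (2 * α)).ne'
    field_simp
  rw [e] at hmain
  refine hmain.congr' (Eventually.of_forall fun ξ => ?_)
  have e1 : ⟪ξ - x, kernelField α x ξ⟫_ℝ =
      ‖ξ - x‖ ^ 2 * kernelMoment α 0 x ξ + 2 * x 0 * kernelMoment α 1 x ξ * (ξ 0 - x 0) := by
    rw [kernelField, inner_add_right, inner_smul_right, inner_smul_right,
      real_inner_self_eq_norm_sq, EuclideanSpace.inner_single_right]
    simp
    ring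
  have e2 : ‖ξ - x‖ ^ m = ‖ξ - x‖ ^ (m - 2) * ‖ξ - x‖ ^ 2 := by
    rw [← pow_add]; congr 1; omega
  simp only [e1, e2, mul_one]
  ring

/-- The volume integral of Green's formula after rescaling by the cut-off radius. -/
theorem setIntegral_fderiv_radialCutoff (hm : 2 < m) (hΩm : MeasurableSet Ω)
    (x : EuclideanSpace ℝ (Fin m)) {ρ : ℝ} (hρ : 0 < ρ) :
    ∫ ξ in Ω, ξ 0 ^ (2 * α) *
        fderiv ℝ (fun ξ => radialCutoff (ρ⁻¹ • (ξ - x))) ξ (kernelField α x ξ) =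
      ∫ u, Ω.indicator (fun ξ => ‖ξ - x‖ ^ (m - 2) *
        (ξ 0 ^ (2 * α) * ⟪ξ - x, kernelField α x ξ⟫_ℝ)) (x + ρ • u) * radialWeight u := by
  have hd : ∀ ξ v : EuclideanSpace ℝ (Fin m),
      fderiv ℝ (fun ξ => radialCutoff (ρ⁻¹ • (ξ - x))) ξ v =
        ρ⁻¹ * (2 * deriv Real.smoothTransition (2 - ‖ρ⁻¹ • (ξ - x)‖ ^ 2) *
          ⟪ρ⁻¹ • (ξ - x), v⟫_ℝ) := by
    intro ξ v
    have h1 : HasFDerivAt (fun ξ : EuclideanSpace ℝ (Fin m) => ρ⁻¹ • (ξ - x))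
        (ρ⁻¹ • ContinuousLinearMap.id ℝ (EuclideanSpace ℝ (Fin m))) ξ :=
      ((hasFDerivAt_id ξ).sub_const x).const_smul ρ⁻¹
    have h2 := ((contDiff_radialCutoff.differentiable one_ne_zero
      (ρ⁻¹ • (ξ - x))).hasFDerivAt.comp ξ h1).fderiv
    have h3 : fderiv ℝ (fun ξ => radialCutoff (ρ⁻¹ • (ξ - x))) ξ = _ := h2
    rw [h3, ContinuousLinearMap.comp_apply, smul_apply, ContinuousLinearMap.id_apply, map_smul,
      fderiv_radialCutoff, smul_eq_mul]
  rw [← integral_indicator hΩm]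
  set G : EuclideanSpace ℝ (Fin m) → ℝ := Ω.indicator fun ξ => ξ 0 ^ (2 * α) *
    fderiv ℝ (fun ξ => radialCutoff (ρ⁻¹ • (ξ - x))) ξ (kernelField α x ξ) with hG
  have h1 := Measure.integral_comp_smul_of_nonneg
    (volume : Measure (EuclideanSpace ℝ (Fin m))) (fun u => G (x + u)) ρ (hR := hρ.le)
  rw [integral_add_left_eq_self G x, finrank_euclideanSpace_fin, smul_eq_mul] at h1
  -- Substituting ξ = x + ρu has Jacobian ρ^m. It is shared out as ρ^{m-2} for ‖ξ - x‖^{m-2}, ρ for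
  -- ξ - x, and ρ for the derivative of the rescaled cut-off.
  have h2 : ∫ ξ, G ξ = ∫ u, ρ ^ m * G (x + ρ • u) := by
    rw [integral_const_mul, h1]
    field_simp
  rw [h2]
  refine integral_congr_ae (Eventually.of_forall fun u => ?_)
  by_cases hu : x + ρ • u ∈ Ω
  · simp only [hG, indicator_of_mem hu, hd, add_sub_cancel_left, radialWeight]
    rw [smul_smul, inv_mul_cancel₀ hρ.ne', one_smul]
    rcases eq_or_ne u 0 with rfl | hu0
    · simp
    · have hu1 : 0 < ‖u‖ := norm_pos_iff.2 hu0
      rw [inner_smul_left, conj_trivial, norm_smul, Real.norm_of_nonneg hρ.le, mul_pow]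
      have e2 : ρ ^ m = ρ ^ (m - 2) * ρ ^ 2 := by
        rw [← pow_add]; congr 1; omega
      rw [e2]
      field_simp
  · simp only [hG, indicator_of_notMem hu, mul_zero, zero_mul]

/-- If the domain looks like `S` from the point `x`, the rescaled volume integrals converge. -/
theorem tendsto_setIntegral_fderiv_radialCutoff (hα : 0 < α) (hm : 2 < m) (hΩm : MeasurableSet Ω)
    {x : EuclideanSpace ℝ (Fin m)} (hx : 0 < x 0) {S : Set (EuclideanSpace ℝ (Fin m))}
    (hSm : MeasurableSet S)
    (hS : ∀ᵐ u : EuclideanSpace ℝ (Fin m), ∀ᶠ ρ in 𝓝[>] (0 : ℝ), (x + ρ • u ∈ Ω ↔ u ∈ S)) :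
    Tendsto (fun ρ : ℝ => ∫ ξ in Ω, ξ 0 ^ (2 * α) *
        fderiv ℝ (fun ξ => radialCutoff (ρ⁻¹ • (ξ - x))) ξ (kernelField α x ξ)) (𝓝[>] 0)
      (𝓝 ((4 : ℝ) ^ (-α) *
        (Real.Gamma α * Real.Gamma ((m : ℝ) / 2) / Real.Gamma (α + (m : ℝ) / 2)) *
          ∫ u in S, radialWeight u)) := by
  set L := (4 : ℝ) ^ (-α) *
    (Real.Gamma α * Real.Gamma ((m : ℝ) / 2) / Real.Gamma (α + (m : ℝ) / 2)) with hL
  set Φ : EuclideanSpace ℝ (Fin m) → ℝ := fun ξ => ‖ξ - x‖ ^ (m - 2) *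
    (ξ 0 ^ (2 * α) * ⟪ξ - x, kernelField α x ξ⟫_ℝ) with hΦ
  have hΦm : Measurable Φ := by
    have := measurable_kernelField α x
    simp only [hΦ]
    fun_prop
  have hlim : Tendsto Φ (𝓝[≠] x) (𝓝 L) := tendsto_radial_kernelField hα hm hx
  have hev : ∀ᶠ ξ in 𝓝[≠] x, |Φ ξ| ≤ |L| + 1 := by
    filter_upwards [hlim.abs.eventually (gt_mem_nhds (lt_add_one |L|))] with ξ hξ using hξ.le
  obtain ⟨δ, hδ, hball⟩ := Metric.mem_nhdsWithin_iff.1 hev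
  have hnear : ∀ u : EuclideanSpace ℝ (Fin m), u ≠ 0 →
      Tendsto (fun ρ : ℝ => x + ρ • u) (𝓝[>] 0) (𝓝[≠] x) := fun u hu => by
    refine tendsto_nhdsWithin_iff.2 ⟨?_, ?_⟩
    · have : Continuous fun ρ : ℝ => x + ρ • u := by fun_prop
      simpa using (this.tendsto 0).mono_left nhdsWithin_le_nhds
    · filter_upwards [self_mem_nhdsWithin] with ρ hρ
      have hρ : 0 < ρ := hρ
      simp [hρ.ne', hu]
  have key : Tendsto (fun ρ : ℝ => ∫ u, Ω.indicator Φ (x + ρ • u) * radialWeight u) (𝓝[>] 0)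
      (𝓝 (∫ u, S.indicator (fun u => L * radialWeight u) u)) := by
    refine tendsto_integral_filter_of_dominated_convergence
      (fun u => (|L| + 1) * ‖radialWeight u‖) (Eventually.of_forall fun ρ => ?_) ?_
      (integrable_radialWeight.norm.const_mul _) ?_
    · have h1 : Measurable fun u : EuclideanSpace ℝ (Fin m) => x + ρ • u := by fun_prop
      exact (((hΦm.indicator hΩm).comp h1).mul measurable_radialWeight).aestronglyMeasurable
    -- The weight lives in ‖u‖ < 2, so ρ < δ/2 keeps x + ρu in the ball where Φ is bounded.
    · have h1 : ∀ᶠ ρ : ℝ in 𝓝[>] 0, ρ < δ / 2 :=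
        nhdsWithin_le_nhds (Iio_mem_nhds (by positivity))
      filter_upwards [h1, self_mem_nhdsWithin] with ρ hρδ hρ
      have hρ : 0 < ρ := hρ
      refine Eventually.of_forall fun u => ?_
      rw [norm_mul]
      rcases eq_or_ne u 0 with rfl | hu
      · rw [radialWeight_zero, norm_zero, mul_zero, mul_zero]
      rcases le_or_gt 2 ‖u‖ with h2 | h2
      · rw [radialWeight_eq_zero h2, norm_zero, mul_zero, mul_zero]
      · refine mul_le_mul_of_nonneg_right ?_ (norm_nonneg _)
        refine (norm_indicator_le_norm_self _ _).trans (hball ⟨?_, ?_⟩)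
        · rw [Metric.mem_ball, dist_eq_norm, add_sub_cancel_left, norm_smul,
            Real.norm_of_nonneg hρ.le]
          nlinarith [norm_nonneg u]
        · simp [hρ.ne', hu]
    · have : Nontrivial (EuclideanSpace ℝ (Fin m)) :=
        Module.nontrivial_of_finrank_pos (R := ℝ) (by rw [finrank_euclideanSpace_fin]; omega)
      filter_upwards [hS, compl_mem_ae_iff.2 (measure_singleton (0 : EuclideanSpace ℝ (Fin m)))]
        with u hu hu0
      by_cases huS : u ∈ S
      · rw [indicator_of_mem huS]
        refine ((hlim.comp (hnear u hu0)).mul_const (radialWeight u)).congr' ?_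
        filter_upwards [hu] with ρ hρ
        rw [indicator_of_mem (hρ.2 huS)]
        rfl
      · rw [indicator_of_notMem huS]
        refine tendsto_const_nhds.congr' ?_
        filter_upwards [hu] with ρ hρ
        rw [indicator_of_notMem fun h => huS (hρ.1 h), zero_mul]
  rw [integral_indicator hSm, integral_const_mul] at key
  refine key.congr' ?_
  filter_upwards [self_mem_nhdsWithin] with ρ hρ
  exact (setIntegral_fderiv_radialCutoff hm hΩm x hρ).symm

namespace IsLyapunovDomain

/-- If the domain looks like `S` from the point `x`, the flux of the kernel field is the solid
angle of `S`, up to a constant. -/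
theorem setIntegral_flux_eq (hΩ : IsLyapunovDomain Ω) (hα : 0 < α) (hm : 2 < m)
    {x : EuclideanSpace ℝ (Fin m)} (hx : 0 < x 0) {S : Set (EuclideanSpace ℝ (Fin m))}
    (hSm : MeasurableSet S)
    (hS : ∀ᵐ u : EuclideanSpace ℝ (Fin m), ∀ᶠ ρ in 𝓝[>] (0 : ℝ), (x + ρ • u ∈ Ω ↔ u ∈ S))
    (hInt : IntegrableOn (fun ξ => ξ 0 ^ (2 * α) * ⟪kernelField α x ξ, outerUnitNormal Ω ξ⟫_ℝ)
      (lateralBoundary Ω) μHE[m - 1]) :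
    ∫ ξ in lateralBoundary Ω, ξ 0 ^ (2 * α) * ⟪kernelField α x ξ, outerUnitNormal Ω ξ⟫_ℝ
        ∂μHE[m - 1] =
      (4 : ℝ) ^ (-α) *
        (Real.Gamma α * Real.Gamma ((m : ℝ) / 2) / Real.Gamma (α + (m : ℝ) / 2)) *
          ∫ u in S, radialWeight u := by
  have hcd : ∀ ρ : ℝ, ContDiff ℝ 1 fun ξ => radialCutoff (ρ⁻¹ • (ξ - x)) := fun ρ =>
    contDiff_radialCutoff.comp (by fun_prop)
  -- Absolute convergence of the flux allows the cut-off at the pole to be removed, since the pole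
  -- itself has surface measure zero.
  have hL : Tendsto (fun ρ : ℝ => ∫ ξ in lateralBoundary Ω, radialCutoff (ρ⁻¹ • (ξ - x)) *
        (ξ 0 ^ (2 * α) * ⟪kernelField α x ξ, outerUnitNormal Ω ξ⟫_ℝ) ∂μHE[m - 1]) (𝓝[>] 0)
      (𝓝 (∫ ξ in lateralBoundary Ω,
        ξ 0 ^ (2 * α) * ⟪kernelField α x ξ, outerUnitNormal Ω ξ⟫_ℝ ∂μHE[m - 1])) := by
    refine tendsto_integral_filter_of_dominated_convergence
      (fun ξ => ‖ξ 0 ^ (2 * α) * ⟪kernelField α x ξ, outerUnitNormal Ω ξ⟫_ℝ‖)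
      (Eventually.of_forall fun ρ => ?_)
      (Eventually.of_forall fun ρ => Eventually.of_forall fun ξ => ?_) hInt.norm ?_
    · exact (hcd ρ).continuous.aestronglyMeasurable.mul hInt.aestronglyMeasurable
    · rw [norm_mul]
      exact mul_le_of_le_one_left (norm_nonneg _) (abs_radialCutoff_le_one _)
    · have h2 : ∀ᵐ ξ ∂μHE[m - 1], ξ ≠ x :=
        compl_mem_ae_iff.2 (euclideanHausdorffMeasure_singleton (by omega) x)
      filter_upwards [ae_restrict_of_ae h2] with ξ hξ
      refine tendsto_const_nhds.congr' ?_
      have hr : 0 < ‖ξ - x‖ := norm_pos_iff.2 (sub_ne_zero.2 hξ)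
      have h3 : ∀ᶠ ρ : ℝ in 𝓝[>] 0, ρ < ‖ξ - x‖ / 2 :=
        nhdsWithin_le_nhds (Iio_mem_nhds (by positivity))
      filter_upwards [h3, self_mem_nhdsWithin] with ρ hρr hρ
      have hρ : 0 < ρ := hρ
      have h4 : 2 ≤ ‖ρ⁻¹ • (ξ - x)‖ := by
        rw [norm_smul, norm_inv, Real.norm_of_nonneg hρ.le, ← div_eq_inv_mul, le_div_iff₀ hρ]
        linarith
      rw [radialCutoff_eq_one (by nlinarith), one_mul]
  refine tendsto_nhds_unique hL
    ((tendsto_setIntegral_fderiv_radialCutoff hα hm hΩ.isOpen.measurableSet hx hSm hS).congr' ?_)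
  filter_upwards [self_mem_nhdsWithin] with ρ hρ
  have hρ : 0 < ρ := hρ
  refine (hΩ.setIntegral_cutoff_flux hα hx.le (hcd ρ) hρ fun ξ hξ => radialCutoff_eq_zero ?_).symm
  rw [norm_smul, norm_inv, Real.norm_of_nonneg hρ.le, ← div_eq_inv_mul, div_le_one hρ]
  exact hξ.le

/-- Outside the closure of the domain the flux of the kernel field vanishes. -/
theorem setIntegral_flux_eq_zero (hΩ : IsLyapunovDomain Ω) (hα : 0 < α)
    {x : EuclideanSpace ℝ (Fin m)} (hx : 0 ≤ x 0) (hxΩ : x ∉ closure Ω) :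
    ∫ ξ in lateralBoundary Ω, ξ 0 ^ (2 * α) * ⟪kernelField α x ξ, outerUnitNormal Ω ξ⟫_ℝ
        ∂μHE[m - 1] = 0 := by
  obtain ⟨c, hc, hcb⟩ := Metric.mem_nhds_iff.1 (isClosed_closure.isOpen_compl.mem_nhds hxΩ)
  -- Points of the closure are at distance at least c = 2ρ from x, so the cut-off is 1 there and its
  -- gradient vanishes on Ω.
  set ρ := c / 2 with hρ
  have hρ0 : 0 < ρ := by positivity
  have hone : ∀ ξ ∈ closure Ω, radialCutoff (ρ⁻¹ • (ξ - x)) = 1 := fun ξ hξ => by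
    have h1 : c ≤ ‖ξ - x‖ := by
      by_contra hlt
      exact hcb (by rw [Metric.mem_ball, dist_eq_norm]; exact not_le.1 hlt) hξ
    have h4 : 2 ≤ ‖ρ⁻¹ • (ξ - x)‖ := by
      rw [norm_smul, norm_inv, Real.norm_of_nonneg hρ0.le, ← div_eq_inv_mul, le_div_iff₀ hρ0]
      linarith
    exact radialCutoff_eq_one (by nlinarith)
  have h := hΩ.setIntegral_cutoff_flux hα hx (η := fun ξ => radialCutoff (ρ⁻¹ • (ξ - x)))
    (contDiff_radialCutoff.comp (by fun_prop)) hρ0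
    fun ξ hξ => radialCutoff_eq_zero (by
      rw [norm_smul, norm_inv, Real.norm_of_nonneg hρ0.le, ← div_eq_inv_mul, div_le_one hρ0]
      exact hξ.le)
  have h1 : ∫ ξ in Ω, ξ 0 ^ (2 * α) *
      fderiv ℝ (fun ξ => radialCutoff (ρ⁻¹ • (ξ - x))) ξ (kernelField α x ξ) = 0 := by
    refine setIntegral_eq_zero_of_forall_eq_zero fun ξ hξ => ?_
    have h2 : (fun ξ => radialCutoff (ρ⁻¹ • (ξ - x))) =ᶠ[𝓝 ξ] fun _ => 1 := by
      filter_upwards [hΩ.isOpen.mem_nhds hξ] with y hy using hone y (subset_closure hy)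
    rw [h2.fderiv_eq]
    simp
  rw [h1] at h
  rw [← h]
  refine setIntegral_congr_fun measurableSet_lateralBoundary fun ξ hξ => ?_
  simp only [hone ξ (frontier_subset_closure hξ.1), one_mul]

end IsLyapunovDomain

theorem IsOpen.eventually_add_smul_mem_iff {E : Type*} [NormedAddCommGroup E] [NormedSpace ℝ E]
    {Ω : Set E} (hΩ : IsOpen Ω) {x : E} (hx : x ∈ Ω) (u : E) :
    ∀ᶠ ρ in 𝓝[>] (0 : ℝ), (x + ρ • u ∈ Ω ↔ u ∈ (univ : Set E)) := by
  have hc : Continuous fun ρ : ℝ => x + ρ • u := by fun_prop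
  have ht : Tendsto (fun ρ : ℝ => x + ρ • u) (𝓝[>] 0) (𝓝 x) := by
    simpa using (hc.tendsto 0).mono_left nhdsWithin_le_nhds
  filter_upwards [ht (hΩ.mem_nhds hx)] with ρ hρ
  exact ⟨fun _ => mem_univ u, fun _ => hρ⟩

/-- From a boundary point with outer normal `n` the domain looks like the half-space
`⟪n, u⟫ < 0`. -/
theorem IsOuterUnitNormal.eventually_add_smul_mem_iff {E : Type*} [NormedAddCommGroup E]
    [InnerProductSpace ℝ E] {Ω : Set E} {x n : E} (h : IsOuterUnitNormal Ω x n) {u : E}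
    (hu : ⟪n, u⟫_ℝ ≠ 0) :
    ∀ᶠ ρ in 𝓝[>] (0 : ℝ), (x + ρ • u ∈ Ω ↔ u ∈ {u | ⟪n, u⟫_ℝ < 0}) := by
  have hu0 : 0 < ‖u‖ := norm_pos_iff.2 fun h0 => hu (by rw [h0, inner_zero_right])
  have habs : 0 < |⟪n, u⟫_ℝ| := abs_pos.2 hu
  have hc : Continuous fun ρ : ℝ => x + ρ • u := by fun_prop
  have ht : Tendsto (fun ρ : ℝ => x + ρ • u) (𝓝[>] 0) (𝓝 x) := by
    simpa using (hc.tendsto 0).mono_left nhdsWithin_le_nhds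
  -- Half the slope of the direction u is chosen, so that the ray x + ρu runs strictly inside one of
  -- the two cones.
  filter_upwards [ht.eventually (h.2 (|⟪n, u⟫_ℝ| / (2 * ‖u‖)) (by positivity)),
    self_mem_nhdsWithin] with ρ hρ hρ0
  have hρ0 : 0 < ρ := hρ0
  have e : |⟪n, u⟫_ℝ| / (2 * ‖u‖) * (ρ * ‖u‖) = ρ * (|⟪n, u⟫_ℝ| / 2) := by field_simp
  rw [add_sub_cancel_left, inner_smul_right, norm_smul, Real.norm_of_nonneg hρ0.le, e] at hρ
  rcases lt_or_gt_of_ne hu with h1 | h1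
  · rw [abs_of_neg h1] at hρ
    exact ⟨fun _ => h1, fun _ => hρ.1 (by nlinarith)⟩
  · rw [abs_of_pos h1] at hρ
    exact ⟨fun h2 => absurd h2 (hρ.2 (by nlinarith)), fun h2 => absurd h2 (not_lt.2 h1.le)⟩

end BlowUp

end

/-! ### The three positions of x. -/

theorem lemma1 {m : ℕ} [NeZero m] (hm : 2 < m) {α : ℝ} (hα₀ : 0 < 2 * α) (hα₁ : 2 * α < 1)
    {Ω : Set (EuclideanSpace ℝ (Fin m))} (hΩ : IsLyapunovDomain Ω)
    (x : EuclideanSpace ℝ (Fin m)) (hx : 0 ≤ x 0) :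
    (x ∈ Ω →
      IntegrableOn (doubleLayerIntegrand α Ω (fun _ => 1) x) (lateralBoundary Ω)
        (Measure.euclideanHausdorffMeasure (m - 1)) ∧
      doubleLayerPotential α Ω (fun _ => 1) x = -1) ∧
    (x ∈ lateralBoundary Ω →
      IntegrableOn (doubleLayerIntegrand α Ω (fun _ => 1) x) (lateralBoundary Ω)
        (Measure.euclideanHausdorffMeasure (m - 1)) ∧
      doubleLayerPotential α Ω (fun _ => 1) x = -(1 / 2)) ∧
    (x ∉ closure Ω →
      IntegrableOn (doubleLayerIntegrand α Ω (fun _ => 1) x) (lateralBoundary Ω)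
        (Measure.euclideanHausdorffMeasure (m - 1)) ∧
      doubleLayerPotential α Ω (fun _ => 1) x = 0) := by
  have hα : 0 < α := by linarith
  have hae := IsLyapunovDomain.doubleLayerIntegrand_ae_eq Ω hα hm hx
  have hpot : doubleLayerPotential α Ω (fun _ => 1) x = -fluxConst m α *
      ∫ ξ in lateralBoundary Ω, ξ 0 ^ (2 * α) * ⟪kernelField α x ξ, outerUnitNormal Ω ξ⟫_ℝ
        ∂(Measure.euclideanHausdorffMeasure (m - 1)) := by
    rw [doubleLayerPotential, integral_congr_ae hae, integral_const_mul]
  have hone := fluxConst_mul_solidAngle hα hm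
  refine ⟨fun hxΩ => ?_, fun hxΓ => ?_, fun hxΩ => ?_⟩
  · have hx0 : 0 < x 0 := hΩ.subset_halfSpace hxΩ
    have hnot : x ∉ closure (lateralBoundary Ω) := fun h => by
      have h1 : x ∈ frontier Ω :=
        closure_minimal (fun _ h => h.1 : lateralBoundary Ω ⊆ frontier Ω) isClosed_frontier h
      exact h1.2 (hΩ.isOpen.interior_eq.symm ▸ hxΩ)
    have hInt := hΩ.integrableOn_flux_of_notMem_closure hα hx hnot
    refine ⟨Integrable.congr (Integrable.const_mul hInt (-fluxConst m α)) hae.symm, ?_⟩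
    -- The tangent cone at an interior point is the whole space, and the normalisation gives the
    -- full value -1.
    rw [hpot, hΩ.setIntegral_flux_eq hα hm hx0 MeasurableSet.univ
      (Eventually.of_forall (hΩ.isOpen.eventually_add_smul_mem_iff hxΩ)) hInt,
      Measure.restrict_univ, neg_mul, hone]
  · have hInt := hΩ.integrableOn_flux_of_mem_lateralBoundary hα hm hxΓ
    refine ⟨Integrable.congr (Integrable.const_mul hInt (-fluxConst m α)) hae.symm, ?_⟩
    obtain ⟨n, hn⟩ := hΩ.exists_normal x hxΓ
    have hn0 : n ≠ 0 := by
      rintro rfl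
      simpa using hn.1
    have hS : MeasurableSet {u : EuclideanSpace ℝ (Fin m) | ⟪n, u⟫_ℝ < 0} :=
      (isOpen_lt (by fun_prop) continuous_const).measurableSet
    -- At a point of Γ the tangent cone is the half-space ⟪n, u⟫ < 0, which carries half of the
    -- weight; directions in the tangent hyperplane are negligible.
    rw [hpot, hΩ.setIntegral_flux_eq hα hm hxΓ.2 hS
      ((ae_inner_ne_zero hn0).mono fun u hu => hn.eventually_add_smul_mem_iff hu) hInt,
      setIntegral_radialWeight_halfSpace hn0]
    linear_combination (-(1 / 2) : ℝ) * hone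
  · have hInt := hΩ.integrableOn_flux_of_notMem_closure hα hx fun h =>
      hxΩ (closure_minimal (fun _ h => frontier_subset_closure h.1 : lateralBoundary Ω ⊆ closure Ω)
        isClosed_closure h)
    refine ⟨Integrable.congr (Integrable.const_mul hInt (-fluxConst m α)) hae.symm, ?_⟩
    rw [hpot, hΩ.setIntegral_flux_eq_zero hα hx hxΩ, mul_zero]
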